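/- **Setting.** Hilbert spaces are complex, with inner products linear in the second variable. Let $G$ be a compact Lie group of dimension $n$ and let $(\mathcal A,G,\alpha)$ be a free C$^*$-dynamical system: $\mathcal A$ is a unital C$^*$-algebra, $\alpha$ is an action of $G$ on $\mathcal A$ by $*$-automorphisms such that $(g,x)\mapsto\alpha_g(x)$ is continuous, and the linear span of the functions $g\mapsto x\,\alpha_g(y)$, $x,y\in\mathcal A$, is dense in $C(G,\mathcal A)$. Let $\mathcal B=\mathcal A^G$ be the fixed point algebra and $\mathcal A^\infty$ the set of $x\in\mathcal A$ for which $g\mapsto\alpha_g(x)$ is smooth. Choose representatives $(\sigma,V_\sigma)$ of the classes in $\mathrm{Irr}(G)$ of irreducible unitary representations of $G$ and, for each $\sigma$, a finite-dimensional Hilbert space $H_\sigma$ and an isometry $s(\sigma)\in\mathcal A\otimes\mathcal L(V_\sigma,H_\sigma)$ with $\alpha_g(s(\sigma))=s(\sigma)(1\otimes\sigma_g)$ for all $g\in G$; for the trivial class take $H_1=\mathbb C$, $s(1)=1$. Let $\pi_{\mathcal B}:\mathcal B\to\mathcal L(H_{\mathcal B})$ be a faithful unital $*$-representation on a Hilbert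 space. (All finite-dimensional Hilbert spaces are identified with some $\mathbb C^d$ by orthonormal bases.) Put $H=\bigoplus_\sigma H_\sigma\otimes\bar V_\sigma$, $\mu_g=\bigoplus_\sigma 1\otimes\bar\sigma_g$ and $p=\bigoplus_\sigma(\pi_{\mathcal B}\otimes\mathrm{id})(s(\sigma)s(\sigma)^*)\otimes1$, a projection on $H_{\mathcal B}\otimes H$. Let $H_p=p(H_{\mathcal B}\otimes H)$, and let $u_{\mathcal A}$ be the restriction of the unitary representation $1\otimes\mu$ of $G$ to $H_p$. For $x\in\mathcal A$ let $\pi_{\mathcal A}(x)=(\pi_{\mathcal B}\otimes\mathrm{id})\bigl(s\,j_\alpha(x)\,s^*\bigr)$, where $s=\bigoplus_\sigma s(\sigma)\otimes 1_{\bar V_\sigma}$, $j_\alpha(x)$ is multiplication by the function $h\mapsto\alpha_{h^{-1}}(x)$ on $L^2(G)$ (normalized Haar measure), and $L^2(G)=\bigoplus_\sigma V_\sigma\otimes\bar V_\sigma$ with $v\otimes\bar w$ corresponding to $h\mapsto\sqrt{\dim\sigma}\,\langle w,\sigma_hv\rangle$. That is, $\pi_{\mathcal A}(x)$ is the bounded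 operator on $H_p$ whose matrix coefficients with respect to orthonormal bases of the spaces $H_\sigma\otimes\bar V_\sigma$ are the images under $\pi_{\mathcal B}$ of those of $s\,j_\alpha(x)\,s^*$, which lie in $\mathcal B$. Endow $\mathrm{Lie}(G)$ with an $\mathrm{Ad}$-invariant inner product, let $X_1,\dots,X_n$ be an orthonormal basis, let $\pi_{\rm spin}$ be a unital $*$-representation on a finite-dimensional Hilbert space $H_{\rm spin}$ of the complex Clifford algebra of $\mathrm{Lie}(G)$ with $\xi\eta+\eta\xi=-2\langle\xi,\eta\rangle1$ and $\xi^*=-\xi$ for $\xi,\eta\in\mathrm{Lie}(G)$, and put $F_X=\pi_{\rm spin}(X)$. For a unitary representation $u$ of $G$ on $K$ let $K^\infty$ be the space of vectors $\eta$ for which $g\mapsto u_g\eta$ is smooth, and let $\partial_Xu(\eta)=\lim_{t\to0}t^{-1}(u_{\exp(tX)}\eta-\eta)$ for $\eta\in K^\infty$. Let $D_v$ be the closure of $\sum_k\partial_{X_k}\mu\otimes F_{X_k}$, with domain $H^\infty\otimes H_{\rm spin}$, on $H\otimes H_{\rm spin}$, and let $\hat D_v$ be the closure of $\sum_k\partial_{X_k}u_{\mathcal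 A}\otimes F_{X_k}$, with domain $H_p^\infty\otimes H_{\rm spin}$, on $H_p\otimes H_{\rm spin}$. Let $1\otimes D_v$ be the closure on $H_{\mathcal B}\otimes H\otimes H_{\rm spin}$ of the operator $\xi\otimes\zeta\mapsto\xi\otimes D_v\zeta$ with domain the algebraic tensor product $H_{\mathcal B}\otimes\mathrm{dom}(D_v)$. **Corollary.** The operators $\pi_{\mathcal A}(x)$, $x\in\mathcal A$, are well defined, and the following hold. 1. $\hat D_v$ is self-adjoint, and $H_p^\infty\otimes H_{\rm spin}$ is contained in the domains of $\hat D_v$ and of $1\otimes D_v$, with $\hat D_v=1\otimes D_v$ on $H_p^\infty\otimes H_{\rm spin}$. 2. For every $x\in\mathcal A^\infty$: $(\pi_{\mathcal A}(x)\otimes1)\,\mathrm{dom}(\hat D_v)\subseteq\mathrm{dom}(\hat D_v)$; the derivatives $\partial_{X_k}\pi_{\mathcal A}(\alpha(x))=\lim_{t\to0}t^{-1}\bigl(\pi_{\mathcal A}(\alpha_{\exp(tX_k)}(x))-\pi_{\mathcal A}(x)\bigr)$ exist in operator norm; and on $\mathrm{dom}(\hat D_v)$ $$[\hat D_v,\pi_{\mathcal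 A}(x)\otimes1]=\sum_{k=1}^n\partial_{X_k}\pi_{\mathcal A}(\alpha(x))\otimes F_{X_k},$$ so the commutator is bounded. -/

import Mathlib

open scoped Manifold ContDiff TensorProduct

noncomputable section

section LieGroups

variable {n : ℕ} {G : Type*} [TopologicalSpace G] [ChartedSpace (EuclideanSpace ℝ (Fin n)) G]
  [Group G]

/-- Left-invariant vector fields are preserved by left translations. -/
theorem mfderiv_mul_left_mulInvariantVectorField [LieGroup (𝓡 n) ∞ G]
    (X : GroupLieAlgebra (𝓡 n) G) (x g : G) :
    mfderiv (𝓡 n) (𝓡 n) (x * ·) g (mulInvariantVectorField X g) =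
      mulInvariantVectorField X (x * g) := by
  have M : (∞ : WithTop ℕ∞) ≠ 0 := by simp
  have D : (fun y : G => x * g * y) = (x * ·) ∘ (g * ·) := by
    ext y; simp [mul_assoc]
  have hA : MDifferentiableAt (𝓡 n) (𝓡 n) (fun y : G => x * y) (g * 1) :=
    (contMDiff_mul_left (I := 𝓡 n) (n := ∞)).contMDiffAt.mdifferentiableAt M
  have hB : MDifferentiableAt (𝓡 n) (𝓡 n) (fun y : G => g * y) 1 :=
    (contMDiff_mul_left (I := 𝓡 n) (n := ∞)).contMDiffAt.mdifferentiableAt M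
  have := mfderiv_comp (I' := 𝓡 n) (1 : G) hA hB
  unfold mulInvariantVectorField
  rw [D, this, mul_one]
  rfl

theorem contMDiff_one_mulInvariantVectorField [LieGroup (𝓡 n) ∞ G]
    (X : GroupLieAlgebra (𝓡 n) G) :
    ContMDiff (𝓡 n) (𝓡 n).tangent 1
      (fun g : G => (⟨g, mulInvariantVectorField X g⟩ : TangentBundle (𝓡 n) G)) := by
  have h3 : minSmoothness ℝ 3 ≤ (∞ : WithTop ℕ∞) := by
    rw [minSmoothness_of_isRCLikeNormedField]
    exact WithTop.coe_le_coe.2 (le_top : (3 : ℕ∞) ≤ ⊤)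
  have : LieGroup (𝓡 n) (minSmoothness ℝ 3) G := LieGroup.of_le h3
  have := contMDiff_mulInvariantVectorField (I := 𝓡 n) (G := G) X
  refine this.of_le ?_
  rw [minSmoothness_of_isRCLikeNormedField]; norm_num

/-- On a Lie group every left-invariant vector field has a global integral curve through `1`. -/
theorem exists_expCurve [LieGroup (𝓡 n) ∞ G] [T2Space G] (X : GroupLieAlgebra (𝓡 n) G) :
    ∃ γ : ℝ → G, γ 0 = 1 ∧
      IsMIntegralCurve (I := 𝓡 n) γ (fun g => mulInvariantVectorField X g) := by
  have : IsManifold (𝓡 n) 1 G := IsManifold.of_le (n := ∞) (by exact_mod_cast le_top)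
  have hv := contMDiff_one_mulInvariantVectorField X
  obtain ⟨γ, h0, hγ⟩ :=
    exists_isMIntegralCurveAt_of_contMDiffAt_boundaryless (I := 𝓡 n) (t₀ := 0) (hv.contMDiffAt (x := 1))
  rw [isMIntegralCurveAt_iff'] at hγ
  obtain ⟨ε, hε, hγ⟩ := hγ
  refine exists_isMIntegralCurve_of_isMIntegralCurveOn hv hε (fun x => ?_) 1
  refine ⟨fun t => x * γ t, by simp [h0], ?_⟩
  intro t ht
  have ht' : t ∈ Metric.ball (0 : ℝ) ε := by
    rw [Real.ball_eq_Ioo]; simpa using ht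
  have h1 := (hγ t ht')
  rw [Real.ball_eq_Ioo] at h1
  simp only [zero_sub, zero_add] at h1
  have hA : MDifferentiableAt (𝓡 n) (𝓡 n) (fun y : G => x * y) (γ t) :=
    (contMDiff_mul_left (I := 𝓡 n) (n := ∞)).contMDiffAt.mdifferentiableAt (by simp)
  have h2 := hA.hasMFDerivAt.comp_hasMFDerivWithinAt t h1
  have e := mfderiv_mul_left_mulInvariantVectorField X x (γ t)
  rw [← e]
  have e2 : (mfderiv (𝓡 n) (𝓡 n) (fun y : G => x * y) (γ t)).comp
      (ContinuousLinearMap.smulRight (1 : ℝ →L[ℝ] ℝ) (mulInvariantVectorField X (γ t))) =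
      ContinuousLinearMap.smulRight (1 : ℝ →L[ℝ] ℝ)
        (mfderiv (𝓡 n) (𝓡 n) (fun y : G => x * y) (γ t) (mulInvariantVectorField X (γ t))) :=
    ContinuousLinearMap.ext fun s =>
      (mfderiv (𝓡 n) (𝓡 n) (fun y : G => x * y) (γ t)).map_smul ((1 : ℝ →L[ℝ] ℝ) s)
        (mulInvariantVectorField X (γ t))
  exact e2 ▸ h2

/-- The integral curve through `1` of the left-invariant vector field determined by `X`. -/
def expCurve [LieGroup (𝓡 n) ∞ G] [T2Space G] (X : GroupLieAlgebra (𝓡 n) G) : ℝ → G :=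
  (exists_expCurve X).choose

/-- The exponential map `Lie(G) → G`: the value at time `1` of the integral curve through `1` of
the left-invariant vector field determined by `X`. -/
def lieExp [LieGroup (𝓡 n) ∞ G] [T2Space G] (X : GroupLieAlgebra (𝓡 n) G) : G := expCurve X 1

theorem lieExp_smul [LieGroup (𝓡 n) ∞ G] [T2Space G] (X : GroupLieAlgebra (𝓡 n) G) (t : ℝ) :
    lieExp (t • X) = expCurve X t := by
  have : IsManifold (𝓡 n) 1 G := IsManifold.of_le (n := ∞) (by exact_mod_cast le_top)
  have h1 := (exists_expCurve X).choose_spec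
  have h2 := (exists_expCurve (t • X)).choose_spec
  have h3 := h1.2.comp_mul t
  have e : (t • fun g : G => mulInvariantVectorField (I := 𝓡 n) X g) =
      fun g : G => mulInvariantVectorField (I := 𝓡 n) (t • X) g :=
    (mulInvariantVectorField_smul t X).symm
  rw [e] at h3
  have := isMIntegralCurve_Ioo_eq_of_contMDiff_boundaryless (t₀ := 0)
    (contMDiff_one_mulInvariantVectorField (t • X)) h2.2 h3
    (by simp only [Function.comp_apply, zero_mul]; rw [h1.1, h2.1])
  have h5 := congrFun this 1
  rw [Function.comp_apply, one_mul] at h5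
  exact h5

theorem mdifferentiableAt_lieExp_smul [LieGroup (𝓡 n) ∞ G] [T2Space G]
    (X : GroupLieAlgebra (𝓡 n) G) :
    MDifferentiableAt 𝓘(ℝ, ℝ) (𝓡 n) (fun t : ℝ => lieExp (t • X)) 0 := by
  simp only [lieExp_smul]
  exact ((exists_expCurve X).choose_spec.2 0).mdifferentiableAt

theorem lieExp_zero [LieGroup (𝓡 n) ∞ G] [T2Space G] :
    lieExp (0 : GroupLieAlgebra (𝓡 n) G) = 1 := by
  have := lieExp_smul (0 : GroupLieAlgebra (𝓡 n) G) 0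
  rw [zero_smul] at this
  rw [this]
  exact (exists_expCurve _).choose_spec.1

/-- The adjoint action of `G` on `Lie(G)`: the derivative at `1` of `h ↦ g h g⁻¹`. -/
def adjointAction (g : G) : GroupLieAlgebra (𝓡 n) G →L[ℝ] GroupLieAlgebra (𝓡 n) G :=
  mfderiv (𝓡 n) (𝓡 n) (fun h : G => g * h * g⁻¹) 1

/-- The function `f` on `G` has derivative `e` along `X` at the identity: `e` is the limit of
`(f(exp(tX)) - f(1)) / t` as `t → 0`. -/
def HasLieDeriv [LieGroup (𝓡 n) ∞ G] [T2Space G] {E : Type*} [NormedAddCommGroup E]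
    [NormedSpace ℂ E] (f : G → E) (X : GroupLieAlgebra (𝓡 n) G) (e : E) : Prop :=
  HasDerivAt (fun t : ℝ => f (lieExp (t • X))) e 0

end LieGroups

section UnitaryRepresentations

variable {n : ℕ} {G : Type*} [TopologicalSpace G] [ChartedSpace (EuclideanSpace ℝ (Fin n)) G]
  [Group G] {K : Type*} [NormedAddCommGroup K] [InnerProductSpace ℂ K]

/-- The subspace `K^∞` of smooth vectors of a unitary representation `u` of `G` on `K`: those `η`
whose orbit map `g ↦ u_g η` is smooth. -/
def smoothVectors (u : G →* (K ≃ₗᵢ[ℂ] K)) : Submodule ℂ K where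
  carrier := {η | ContMDiff (𝓡 n) 𝓘(ℝ, K) ∞ (fun g => u g η)}
  zero_mem' := by simpa using contMDiff_const
  add_mem' := fun {a b} ha hb => by
    have : (fun g => u g (a + b)) = fun g => u g a + u g b := by ext g; simp
    change ContMDiff (𝓡 n) 𝓘(ℝ, K) ∞ (fun g => u g (a + b))
    rw [this]
    exact ContMDiff.add ha hb
  smul_mem' := fun c a ha => by
    have : (fun g => u g (c • a)) = fun g => (c • ContinuousLinearMap.id ℝ K) (u g a) := by
      ext g; simp
    change ContMDiff (𝓡 n) 𝓘(ℝ, K) ∞ (fun g => u g (c • a))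
    rw [this]
    exact (c • ContinuousLinearMap.id ℝ K).contMDiff.comp ha

variable [LieGroup (𝓡 n) ∞ G] [T2Space G]

theorem differentiableAt_orbit (u : G →* (K ≃ₗᵢ[ℂ] K)) (X : GroupLieAlgebra (𝓡 n) G)
    (η : smoothVectors (n := n) u) :
    DifferentiableAt ℝ (fun t : ℝ => u (lieExp (t • X)) (η : K)) 0 := by
  rw [← mdifferentiableAt_iff_differentiableAt]
  have h : MDifferentiableAt (𝓡 n) 𝓘(ℝ, K) (fun g => u g (η : K))
      (lieExp ((0 : ℝ) • X)) := ContMDiff.mdifferentiableAt η.2 (by simp)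
  exact h.comp (0 : ℝ) (mdifferentiableAt_lieExp_smul X)

/-- The operator `∂_X u`, with domain the smooth vectors of `u`, given by
`∂_X u (η) = lim_{t → 0} (u_{exp(tX)} η - η) / t`. -/
def partialRep (u : G →* (K ≃ₗᵢ[ℂ] K)) (X : GroupLieAlgebra (𝓡 n) G) :
    smoothVectors (n := n) u →ₗ[ℂ] K where
  toFun η := deriv (fun t : ℝ => u (lieExp (t • X)) (η : K)) 0
  map_add' a b := by
    rw [← deriv_add (differentiableAt_orbit u X a) (differentiableAt_orbit u X b)]
    congr 1; ext t; simp
  map_smul' c a := by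
    rw [RingHom.id_apply, ← deriv_const_smul c (differentiableAt_orbit u X a)]
    congr 1; ext t; simp

end UnitaryRepresentations

section SpinTensor

variable {K : Type*} [NormedAddCommGroup K] [InnerProductSpace ℂ K] {r : ℕ}

/-- The Hilbert space tensor product `K ⊗ ℂ^r`: the vector `Σ_a η_a ⊗ e_a` is the tuple `(η_a)`. -/
abbrev TensorSpin (K : Type*) [NormedAddCommGroup K] [InnerProductSpace ℂ K] (r : ℕ) : Type _ :=
  PiLp 2 (fun _ : Fin r => K)

/-- The algebraic tensor product `W ⊗ ℂ^r ⊆ K ⊗ ℂ^r` for a linear subspace `W ⊆ K`. -/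
def subTensorSpin (W : Submodule ℂ K) (r : ℕ) : Submodule ℂ (TensorSpin K r) where
  carrier := {η | ∀ a, η a ∈ W}
  zero_mem' := fun _ => W.zero_mem
  add_mem' := fun hx hy a => W.add_mem (hx a) (hy a)
  smul_mem' := fun c _ hx a => W.smul_mem c (hx a)

/-- The unbounded operator `T ⊗ F` on `K ⊗ ℂ^r` with domain `W ⊗ ℂ^r`, for an operator `T` on `K`
with domain `W` and a matrix `F`. -/
def unboundedTensor {W : Submodule ℂ K} (T : W →ₗ[ℂ] K) (F : Matrix (Fin r) (Fin r) ℂ) :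
    subTensorSpin W r →ₗ[ℂ] TensorSpin K r where
  toFun η := WithLp.toLp 2 fun a => ∑ b, F a b • T ⟨(η : TensorSpin K r) b, η.2 b⟩
  map_add' x y := by
    ext a
    simp only [PiLp.add_apply, ← Finset.sum_add_distrib, ← smul_add, ← map_add]
    rfl
  map_smul' c x := by
    ext a
    simp only [PiLp.smul_apply, RingHom.id_apply, Finset.smul_sum, smul_comm c, ← map_smul]
    rfl

/-- The bounded operator `T ⊗ F` on `K ⊗ ℂ^r`. -/
def boundedTensor (T : K →L[ℂ] K) (F : Matrix (Fin r) (Fin r) ℂ) :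
    TensorSpin K r →L[ℂ] TensorSpin K r :=
  (PiLp.continuousLinearEquiv 2 ℂ (fun _ : Fin r => K)).symm.toContinuousLinearMap ∘L
    ContinuousLinearMap.pi fun a => ∑ b, F a b • (T ∘L PiLp.proj 2 (fun _ : Fin r => K) b)

/-- The bounded operator `a` preserves the domain of the unbounded operator `D`, and the commutator
`[D, a]`, defined on `dom(D)`, is (the restriction of) the bounded operator `T`. -/
def HasBoundedCommutator {E : Type*} [NormedAddCommGroup E] [NormedSpace ℂ E] (D : E →ₗ.[ℂ] E)
    (a T : E →L[ℂ] E) : Prop :=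
  ∀ η : D.domain, ∃ h : a η ∈ D.domain, D ⟨a η, h⟩ - a (D η) = T η

/-- The operator `D` is defined at `η`, and `D η = ζ`. -/
def TakesValue {E : Type*} [NormedAddCommGroup E] [NormedSpace ℂ E] (D : E →ₗ.[ℂ] E)
    (η ζ : E) : Prop :=
  ∃ h : η ∈ D.domain, D ⟨η, h⟩ = ζ

/-- The operator `Σ_k ∂_{X_k} u ⊗ F_k` on `K ⊗ ℂ^r` with domain `K^∞ ⊗ ℂ^r`. -/
def diracCore {n : ℕ} {G : Type*} [TopologicalSpace G]
    [ChartedSpace (EuclideanSpace ℝ (Fin n)) G] [Group G] [LieGroup (𝓡 n) ∞ G] [T2Space G]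
    (u : G →* (K ≃ₗᵢ[ℂ] K)) (X : Fin n → GroupLieAlgebra (𝓡 n) G)
    (F : Fin n → Matrix (Fin r) (Fin r) ℂ) : TensorSpin K r →ₗ.[ℂ] TensorSpin K r where
  domain := subTensorSpin (smoothVectors (n := n) u) r
  toFun := ∑ k, unboundedTensor (partialRep u (X k)) (F k)

end SpinTensor

section Clifford

variable {V : Type*} [AddCommGroup V] [Module ℝ V]

/-- The real Clifford algebra is a `*`-algebra over `ℝ` (with the trivial involution of `ℝ`). -/
instance cliffordStarModule (Q : QuadraticForm ℝ V) : StarModule ℝ (CliffordAlgebra Q) :=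
  ⟨fun r x => by rw [CliffordAlgebra.star_smul, star_trivial r]⟩

/-- The complex Clifford algebra `Cℓ(V, ⟨·,·⟩)` with the convention `ξη + ηξ = -2⟨ξ,η⟩`; the
canonical `*`-structure has `ξ* = -ξ` for `ξ ∈ V`. -/
abbrev ComplexClifford (B : LinearMap.BilinForm ℝ V) : Type _ :=
  ℂ ⊗[ℝ] CliffordAlgebra (-(B.toQuadraticMap))

/-- The inclusion `V ⊆ Cℓ(V)`. -/
def cliffordVec (B : LinearMap.BilinForm ℝ V) (X : V) : ComplexClifford B :=
  1 ⊗ₜ[ℝ] CliffordAlgebra.ι (-(B.toQuadraticMap)) X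

/-- The matrices `F_{X_k} = π_spin(X_k)` for a `*`-representation `π_spin` of the complex Clifford
algebra on `H_spin = ℂ^r`. -/
def spinMatrix (B : LinearMap.BilinForm ℝ V) {r n : ℕ}
    (πspin : ComplexClifford B →⋆ₐ[ℂ] Matrix (Fin r) (Fin r) ℂ) (X : Fin n → V) (k : Fin n) :
    Matrix (Fin r) (Fin r) ℂ := πspin (cliffordVec B (X k))

end Clifford

section Representations

variable {G : Type*} [Group G]

/-- The representation of `G` on `ℂ^d` given by a homomorphism into the unitary matrices. -/
def matrixRep {d : ℕ} (ρ : G →* Matrix.unitaryGroup (Fin d) ℂ) :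
    Representation ℂ G (Fin d → ℂ) :=
  ((Matrix.toLinAlgEquiv' : Matrix (Fin d) (Fin d) ℂ ≃ₐ[ℂ] _) :
      Matrix (Fin d) (Fin d) ℂ →* Module.End ℂ (Fin d → ℂ)).comp
    ((Matrix.unitaryGroup (Fin d) ℂ).subtype.comp ρ)

/-- A system of representatives for the set `Irrep(G)` of equivalence classes of irreducible
(continuous, finite-dimensional) unitary representations of the compact group `G`, indexed by
`ι = Irrep(G)`: the class `σ` is represented on `V_σ = ℂ^(dim σ)` by unitary matrices. -/
structure IrrepSystem (G : Type*) [Group G] [TopologicalSpace G] (ι : Type*) where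
  dim : ι → ℕ
  rep : ∀ σ, G →* Matrix.unitaryGroup (Fin (dim σ)) ℂ
  continuous_rep : ∀ σ, Continuous (rep σ)
  irreducible : ∀ σ, (matrixRep (rep σ)).IsIrreducible
  inequivalent : ∀ σ τ, Nonempty ((matrixRep (rep σ)).Equiv (matrixRep (rep τ))) → σ = τ
  complete : ∀ (d : ℕ) (ρ : G →* Matrix.unitaryGroup (Fin d) ℂ), Continuous ρ →
    (matrixRep ρ).IsIrreducible → ∃ σ, Nonempty ((matrixRep ρ).Equiv (matrixRep (rep σ)))

end Representations

section CStarDynamics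

/-- The Haar measure of a compact group is right invariant. -/
theorem isMulRightInvariant_of_compact {G : Type*} [Group G] [TopologicalSpace G]
    [IsTopologicalGroup G] [CompactSpace G] [MeasurableSpace G] [BorelSpace G]
    (ν : MeasureTheory.Measure G) [ν.IsHaarMeasure] : ν.IsMulRightInvariant := by
  refine ⟨fun g => ?_⟩
  have hm : Measurable fun x : G => x * g := (continuous_mul_const g).measurable
  have : MeasureTheory.IsFiniteMeasure (ν.map (· * g)) := inferInstance
  have h := MeasureTheory.Measure.isMulInvariant_eq_smul_of_compactSpace (ν.map (· * g)) ν
  have h1 := congrArg (fun m : MeasureTheory.Measure G => m Set.univ) h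
  simp only [MeasureTheory.Measure.map_apply hm MeasurableSet.univ, Set.preimage_univ,
    MeasureTheory.Measure.smul_apply] at h1
  have hne : ν Set.univ ≠ 0 := 
    isOpen_univ.measure_ne_zero ν Set.univ_nonempty
  have hc : (MeasureTheory.Measure.haarScalarFactor (ν.map (· * g)) ν : ENNReal) = 1 := by
    have h2 : (1 : ENNReal) * ν Set.univ =
        (MeasureTheory.Measure.haarScalarFactor (ν.map (· * g)) ν : ENNReal) * ν Set.univ := by
      rw [one_mul]; exact h1
    exact ((ENNReal.mul_left_inj hne (MeasureTheory.measure_ne_top ν _)).1 h2).symm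
  have hc' : MeasureTheory.Measure.haarScalarFactor (ν.map (· * g)) ν = 1 := by
    exact_mod_cast hc
  rw [h, hc', one_smul]

/-- A C*-dynamical system `(A, G, α)`: a strongly continuous action of `G` on the unital
C*-algebra `A` by `*`-automorphisms. -/
structure CStarDynamicalSystem (G A : Type*) [Group G] [TopologicalSpace G] [CStarAlgebra A] where
  act : G →* (A ≃⋆ₐ[ℂ] A)
  continuous_act : Continuous fun p : G × A => act p.1 p.2

variable {G A : Type*} [Group G] [TopologicalSpace G] [CStarAlgebra A]

namespace CStarDynamicalSystem

/-- The fixed point algebra `B = A^G`. -/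
def fixedAlgebra (α : CStarDynamicalSystem G A) : StarSubalgebra ℂ A where
  carrier := {a | ∀ g, α.act g a = a}
  mul_mem' ha hb g := by rw [map_mul, ha g, hb g]
  add_mem' ha hb g := by rw [map_add, ha g, hb g]
  algebraMap_mem' c g := by rw [Algebra.algebraMap_eq_smul_one, map_smul, map_one]
  star_mem' ha g := by rw [map_star, ha g]

/-- The element `Φ(x ⊗ y)` of `C(G, A)` given by `g ↦ x α_g(y)`. -/
def ellwood (α : CStarDynamicalSystem G A) (x y : A) : C(G, A) where
  toFun g := x * α.act g y
  continuous_toFun := continuous_const.mul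
    (α.continuous_act.comp (continuous_id.prodMk continuous_const))

/-- The system is free if the Ellwood map `A ⊗ A → C(G, A)`, `Φ(x ⊗ y)(g) = x α_g(y)`, has dense
range. -/
def IsFree (α : CStarDynamicalSystem G A) : Prop :=
  Dense (Submodule.span ℂ (Set.range fun p : A × A => α.ellwood p.1 p.2) : Set C(G, A))

/-- The subspace `A^∞` of smooth elements: those `x` for which `g ↦ α_g(x)` is smooth. -/
def smoothElements {n : ℕ} [ChartedSpace (EuclideanSpace ℝ (Fin n)) G]
    (α : CStarDynamicalSystem G A) : Set A :=
  {x | ContMDiff (𝓡 n) 𝓘(ℝ, A) ∞ (fun g => α.act g x)}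

end CStarDynamicalSystem

/-- For each `σ ∈ Irrep(G)` a finite-dimensional Hilbert space `H_σ = ℂ^(mult σ)` and an isometry
`s(σ) ∈ A ⊗ L(V_σ, H_σ)`, that is a `mult σ × dim σ`-matrix over `A`, with
`α_g(s(σ)) = s(σ) (1 ⊗ σ_g)`; for the trivial class, `H_1 = ℂ` and `s(1) = 1`. -/
structure IsometryFamily {ι : Type*} (α : CStarDynamicalSystem G A) (R : IrrepSystem G ι) where
  mult : ι → ℕ
  s : ∀ σ, Matrix (Fin (mult σ)) (Fin (R.dim σ)) A
  isometry : ∀ σ, (s σ).conjTranspose * s σ = 1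
  equivariant : ∀ σ g, (s σ).map (α.act g) =
    s σ * (R.rep σ g : Matrix (Fin (R.dim σ)) (Fin (R.dim σ)) ℂ).map (algebraMap ℂ A)
  mult_trivial : ∀ σ, R.rep σ = 1 → mult σ = 1
  s_trivial : ∀ σ, R.rep σ = 1 → ∀ i a, s σ i a = 1

namespace IsometryFamily

variable {ι : Type*} {α : CStarDynamicalSystem G A} {R : IrrepSystem G ι}

/-- The entries of the projection `p(σ) = s(σ) s(σ)^*`, which lie in the fixed point algebra. -/
def projEntry (S : IsometryFamily α R) (σ : ι) (i k : Fin (S.mult σ)) : α.fixedAlgebra :=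
  ⟨(S.s σ * (S.s σ).conjTranspose) i k, fun g => by
    have key : ((S.s σ).map (α.act g)) * ((S.s σ).map (α.act g)).conjTranspose =
        S.s σ * (S.s σ).conjTranspose := by
      rw [S.equivariant, Matrix.conjTranspose_mul, Matrix.mul_assoc, ← Matrix.mul_assoc _ _
        (S.s σ).conjTranspose]
      have h1 : ((R.rep σ g : Matrix (Fin (R.dim σ)) (Fin (R.dim σ)) ℂ).map (algebraMap ℂ A)) *
          ((R.rep σ g : Matrix (Fin (R.dim σ)) (Fin (R.dim σ)) ℂ).map
            (algebraMap ℂ A)).conjTranspose = 1 := by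
        have h2 : (R.rep σ g : Matrix (Fin (R.dim σ)) (Fin (R.dim σ)) ℂ) *
            (R.rep σ g : Matrix (Fin (R.dim σ)) (Fin (R.dim σ)) ℂ).conjTranspose = 1 :=
          Matrix.mem_unitaryGroup_iff.1 (R.rep σ g).2
        rw [← Matrix.conjTranspose_map (algebraMap ℂ A)
          (fun c => algebraMap_star_comm c), ← Matrix.map_mul, h2]
        simp
      rw [h1, Matrix.one_mul]
    have := congrFun (congrFun key i) k
    refine Eq.trans ?_ this
    simp only [Matrix.mul_apply, Matrix.conjTranspose_apply, Matrix.map_apply, map_sum, map_mul,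
      map_star]⟩

theorem act_inv_s (S : IsometryFamily α R) (ρ : ι) (i : Fin (S.mult ρ)) (j : Fin (R.dim ρ))
    (h : G) : α.act h⁻¹ (S.s ρ i j) =
      ∑ a, star ((R.rep ρ h : Matrix (Fin (R.dim ρ)) (Fin (R.dim ρ)) ℂ) j a) • S.s ρ i a := by
  have := congrFun (congrFun (S.equivariant ρ h⁻¹) i) j
  rw [Matrix.map_apply] at this
  rw [this, Matrix.mul_apply]
  refine Finset.sum_congr rfl fun a _ => ?_
  rw [Matrix.map_apply, map_inv, ← Algebra.commutes, ← Algebra.smul_def]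
  rfl

section Coefficients

variable [MeasurableSpace G] (ν : MeasureTheory.Measure G)

/-- The vector `e_a ⊗ \bar e_j ∈ V_σ ⊗ \bar V_σ` as a function on `G`, under the decomposition
`L²(G) = ⨁ V_σ ⊗ \bar V_σ` for which `λ_g = ⨁ 1 ⊗ \bar σ_g` and `r_g = ⨁ σ_g ⊗ 1`:
the unit vector `v ⊗ \bar w` is the function `h ↦ √(dim σ) ⟨w, σ_h v⟩`. -/
def peterWeyl (R : IrrepSystem G ι) (σ : ι) (a j : Fin (R.dim σ)) (h : G) : ℂ :=
  (Real.sqrt (R.dim σ) : ℂ) * (R.rep σ h : Matrix (Fin (R.dim σ)) (Fin (R.dim σ)) ℂ) j a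

/-- The matrix coefficients in `A` of the multiplication operator `j_α(x)`,
`j_α(x)(h) = α_{h⁻¹}(x)`, on `L²(G)` with respect to the Peter-Weyl basis. -/
def jEntry (α : CStarDynamicalSystem G A) (R : IrrepSystem G ι) (x : A)
    (ρ : ι) (a j : Fin (R.dim ρ)) (τ : ι) (c l : Fin (R.dim τ)) : A :=
  ∫ h, (star (peterWeyl R ρ a j h) * peterWeyl R τ c l h) • α.act h⁻¹ x ∂ν

/-- The matrix coefficients of `π_s(x) = s j_α(x) s^*` with respect to the bases
`e_i ⊗ \bar e_j` of `H_σ ⊗ \bar V_σ`, where `s = ⨁ s(σ) ⊗ 1`. -/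
def piEntryAux (S : IsometryFamily α R) (x : A) (ρ : ι) (i : Fin (S.mult ρ)) (j : Fin (R.dim ρ))
    (τ : ι) (k : Fin (S.mult τ)) (l : Fin (R.dim τ)) : A :=
  ∑ a, ∑ c, S.s ρ i a * jEntry ν α R x ρ a j τ c l * star (S.s τ k c)

variable [BorelSpace G] [CompactSpace G] [IsTopologicalGroup G] [ν.IsHaarMeasure]

theorem jEntry_integrable (α : CStarDynamicalSystem G A) (R : IrrepSystem G ι) (x : A)
    (ρ : ι) (a j : Fin (R.dim ρ)) (τ : ι) (c l : Fin (R.dim τ)) :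
    MeasureTheory.Integrable
      (fun h => (star (peterWeyl R ρ a j h) * peterWeyl R τ c l h) • α.act h⁻¹ x) ν := by
  have h1 : ∀ σ (a j : Fin (R.dim σ)), Continuous (peterWeyl R σ a j) := fun σ a j =>
    continuous_const.mul
      ((continuous_subtype_val.comp (R.continuous_rep σ)).matrix_elem j a)
  refine Continuous.integrable_of_hasCompactSupport ?_ (HasCompactSupport.of_compactSpace _)
  exact (((h1 ρ a j).star).mul (h1 τ c l)).smul
    (α.continuous_act.comp (continuous_inv.prodMk continuous_const))

theorem piEntryAux_eq (S : IsometryFamily α R) (x : A) (ρ : ι) (i : Fin (S.mult ρ))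
    (j : Fin (R.dim ρ)) (τ : ι) (k : Fin (S.mult τ)) (l : Fin (R.dim τ)) :
    piEntryAux ν S x ρ i j τ k l = ((Real.sqrt (R.dim ρ) * Real.sqrt (R.dim τ) : ℝ) : ℂ) •
      ∫ h, α.act h⁻¹ (S.s ρ i j * x * star (S.s τ k l)) ∂ν := by
  have hint := fun a c => jEntry_integrable ν α R x ρ a j τ c l
  have e1 : ∀ a c, S.s ρ i a * jEntry ν α R x ρ a j τ c l * star (S.s τ k c) =
      ∫ h, S.s ρ i a * ((star (peterWeyl R ρ a j h) * peterWeyl R τ c l h) • α.act h⁻¹ x) *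
        star (S.s τ k c) ∂ν := fun a c => by
    unfold jEntry
    rw [integral_mul_const_of_integrable ((hint a c).const_mul _),
      integral_const_mul_of_integrable (hint a c)]
  unfold piEntryAux
  simp only [e1]
  simp only [← MeasureTheory.integral_finsetSum Finset.univ
    (fun c _ => ((hint _ c).const_mul (S.s ρ i _)).mul_const (star (S.s τ k c)))]
  rw [← MeasureTheory.integral_finsetSum Finset.univ (fun a _ =>
      MeasureTheory.integrable_finsetSum Finset.univ
        (fun c _ => ((hint a c).const_mul (S.s ρ i a)).mul_const (star (S.s τ k c)))),
    ← MeasureTheory.integral_smul]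
  congr 1
  ext h
  rw [map_mul, map_mul, map_star, act_inv_s, act_inv_s, star_sum, Finset.sum_mul,
    Finset.sum_mul, Finset.smul_sum]
  refine Finset.sum_congr rfl fun a _ => ?_
  rw [Finset.mul_sum, Finset.smul_sum]
  refine Finset.sum_congr rfl fun c _ => ?_
  simp only [peterWeyl, star_smul, mul_smul_comm, smul_mul_assoc, smul_smul, star_mul',
    Complex.ofReal_mul, Complex.star_def, Complex.conj_ofReal, Complex.conj_conj]
  congr 1
  ring

theorem piEntryAux_mem (S : IsometryFamily α R) (x : A) (ρ : ι) (i : Fin (S.mult ρ))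
    (j : Fin (R.dim ρ)) (τ : ι) (k : Fin (S.mult τ)) (l : Fin (R.dim τ)) :
    piEntryAux ν S x ρ i j τ k l ∈ α.fixedAlgebra := by
  intro g
  rw [piEntryAux_eq, map_smul]
  congr 1
  generalize S.s ρ i j * x * star (S.s τ k l) = y
  have hc : Continuous (α.act g : A → A) :=
    α.continuous_act.comp (continuous_const.prodMk continuous_id)
  have hi : MeasureTheory.Integrable (fun h => α.act h⁻¹ y) ν :=
    Continuous.integrable_of_hasCompactSupport
      (α.continuous_act.comp (continuous_inv.prodMk continuous_const))
      (HasCompactSupport.of_compactSpace _)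
  let L : A →L[ℂ] A := ⟨(α.act g : A →ₗ[ℂ] A), hc⟩
  have h1 := L.integral_comp_comm hi
  have h2 : ∀ h, L (α.act h⁻¹ y) = α.act (h * g⁻¹)⁻¹ y := fun h => by
    have : (h * g⁻¹)⁻¹ = g * h⁻¹ := by group
    rw [this, map_mul]; rfl
  simp only [h2] at h1
  have := isMulRightInvariant_of_compact ν
  rw [MeasureTheory.integral_mul_right_eq_self (fun h => α.act h⁻¹ y) g⁻¹] at h1
  exact h1.symm

end Coefficients

end IsometryFamily

end CStarDynamics

section HilbertSpaces

variable {K : Type*} [NormedAddCommGroup K] [InnerProductSpace ℂ K]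

/-- The action `1 ⊗ \bar U` of a unitary matrix `U` on `K ⊗ ℂ^m ⊗ \bar{ℂ^d}`, linear part. -/
def conjActionLin (K : Type*) [NormedAddCommGroup K] [InnerProductSpace ℂ K] (m : ℕ) {d : ℕ}
    (U : Matrix.unitaryGroup (Fin d) ℂ) :
    PiLp 2 (fun _ : Fin m × Fin d => K) →ₗ[ℂ] PiLp 2 (fun _ : Fin m × Fin d => K) where
  toFun v := WithLp.toLp 2 fun p => ∑ l, star ((U : Matrix (Fin d) (Fin d) ℂ) p.2 l) • v (p.1, l)
  map_add' v w := by
    ext p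
    simp only [PiLp.add_apply, smul_add, Finset.sum_add_distrib]
  map_smul' c v := by
    ext p
    simp only [PiLp.smul_apply, RingHom.id_apply, Finset.smul_sum]
    exact Finset.sum_congr rfl fun l _ => smul_comm _ _ _

theorem conjActionLin_one (m d : ℕ) (v : PiLp 2 (fun _ : Fin m × Fin d => K)) :
    conjActionLin K m (1 : Matrix.unitaryGroup (Fin d) ℂ) v = v := by
  ext p
  simp [conjActionLin, Matrix.one_apply]

theorem conjActionLin_mul (m : ℕ) {d : ℕ} (U W : Matrix.unitaryGroup (Fin d) ℂ)
    (v : PiLp 2 (fun _ : Fin m × Fin d => K)) :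
    conjActionLin K m (U * W) v = conjActionLin K m U (conjActionLin K m W v) := by
  ext p
  simp only [conjActionLin, LinearMap.coe_mk, AddHom.coe_mk, Submonoid.coe_mul, Matrix.mul_apply,
    star_sum, Finset.sum_smul, Finset.smul_sum, smul_smul, star_mul']
  exact Finset.sum_comm

theorem inner_conjActionLin (m : ℕ) {d : ℕ} (U : Matrix.unitaryGroup (Fin d) ℂ)
    (v w : PiLp 2 (fun _ : Fin m × Fin d => K)) :
    inner ℂ (conjActionLin K m U v) w = inner ℂ v (conjActionLin K m U⁻¹ w) := by
  simp only [PiLp.inner_apply, conjActionLin, LinearMap.coe_mk, AddHom.coe_mk, sum_inner,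
    inner_sum, inner_smul_left, inner_smul_right, Fintype.sum_prod_type]
  refine Finset.sum_congr rfl fun i _ => ?_
  rw [Finset.sum_comm]
  refine Finset.sum_congr rfl fun l _ => Finset.sum_congr rfl fun j _ => ?_
  congr 1

/-- The unitary `1 ⊗ \bar U` on `K ⊗ ℂ^m ⊗ \bar{ℂ^d}` for a unitary matrix `U`, where `\bar U` acts
on the conjugate space `\bar{ℂ^d}`; in coordinates it is the entrywise conjugate of `U`. -/
def conjAction (K : Type*) [NormedAddCommGroup K] [InnerProductSpace ℂ K] (m : ℕ) {d : ℕ}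
    (U : Matrix.unitaryGroup (Fin d) ℂ) :
    PiLp 2 (fun _ : Fin m × Fin d => K) ≃ₗᵢ[ℂ] PiLp 2 (fun _ : Fin m × Fin d => K) where
  toLinearEquiv := LinearEquiv.ofLinearMap (conjActionLin K m U) (conjActionLin K m U⁻¹)
    (LinearMap.ext fun v => by
      rw [LinearMap.comp_apply, ← conjActionLin_mul, mul_inv_cancel, conjActionLin_one]; rfl)
    (LinearMap.ext fun v => by
      rw [LinearMap.comp_apply, ← conjActionLin_mul, inv_mul_cancel, conjActionLin_one]; rfl)
  norm_map' v := by
    have h := inner_conjActionLin m U v (conjActionLin K m U v)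
    rw [← conjActionLin_mul, inv_mul_cancel, conjActionLin_one, inner_self_eq_norm_sq_to_K,
      inner_self_eq_norm_sq_to_K] at h
    have h2 : ‖conjActionLin K m U v‖ ^ 2 = ‖v‖ ^ 2 := by exact_mod_cast h
    exact (pow_left_inj₀ (norm_nonneg _) (norm_nonneg _) two_ne_zero).1 h2

section DirectSum

theorem memℓp_of_isometry {ι : Type*} {E E' : ι → Type*} [∀ σ, NormedAddCommGroup (E σ)]
    [∀ σ, NormedAddCommGroup (E' σ)]
    {f : ∀ σ, E σ} {f' : ∀ σ, E' σ} (hf : Memℓp f 2) (h : ∀ σ, ‖f' σ‖ = ‖f σ‖) :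
    Memℓp f' 2 := by
  rw [← memℓp_norm_iff] at hf ⊢
  simpa only [h] using hf

variable {ι : Type*} {E : ι → Type*} [∀ σ, NormedAddCommGroup (E σ)]
  [∀ σ, InnerProductSpace ℂ (E σ)]

/-- The direct sum of a family of linear isometric automorphisms, as a linear map. -/
def lpMap (e : ∀ σ, E σ ≃ₗᵢ[ℂ] E σ) : lp E 2 →ₗ[ℂ] lp E 2 where
  toFun f := ⟨fun σ => e σ (f σ), memℓp_of_isometry (lp.memℓp f) fun σ => (e σ).norm_map _⟩
  map_add' f g := lp.ext (funext fun σ => (e σ).map_add (f σ) (g σ))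
  map_smul' c f := lp.ext (funext fun σ => (e σ).map_smul c (f σ))

/-- The direct sum of a family of linear isometric automorphisms. -/
def lpCongr (e : ∀ σ, E σ ≃ₗᵢ[ℂ] E σ) : lp E 2 ≃ₗᵢ[ℂ] lp E 2 where
  toLinearEquiv := LinearEquiv.ofLinearMap (lpMap e) (lpMap fun σ => (e σ).symm)
    (LinearMap.ext fun f => lp.ext (funext fun σ => (e σ).apply_symm_apply (f σ)))
    (LinearMap.ext fun f => lp.ext (funext fun σ => (e σ).symm_apply_apply (f σ)))
  norm_map' f := by
    change ‖lpMap e f‖ = ‖f‖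
    rw [lp.norm_eq_tsum_rpow (by norm_num), lp.norm_eq_tsum_rpow (by norm_num)]
    congr 1
    exact tsum_congr fun σ => congrArg (· ^ _) ((e σ).norm_map (f σ))

end DirectSum

variable {G A ι : Type*} [Group G] [TopologicalSpace G] [CStarAlgebra A]
  {α : CStarDynamicalSystem G A} {R : IrrepSystem G ι}

namespace IsometryFamily

/-- The Hilbert space `K ⊗ H_σ ⊗ \bar V_σ`: the coordinate at `(i, j)` is the one at
`e_i ⊗ \bar e_j`. -/
abbrev Block (S : IsometryFamily α R) (K : Type*) [NormedAddCommGroup K] [InnerProductSpace ℂ K]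
    (σ : ι) : Type _ := PiLp 2 (fun _ : Fin (S.mult σ) × Fin (R.dim σ) => K)

/-- The Hilbert space `K ⊗ H`, where `H = ⨁_σ H_σ ⊗ \bar V_σ`; so `H` itself is the case
`K = ℂ`. -/
abbrev TensorH (S : IsometryFamily α R) (K : Type*) [NormedAddCommGroup K]
    [InnerProductSpace ℂ K] : Type _ := lp (fun σ => S.Block K σ) 2

/-- The unitary representation `1_K ⊗ μ` of `G` on `K ⊗ H`, where `μ_g = ⨁_σ 1 ⊗ \bar σ_g`. -/
def oneTensorMu (S : IsometryFamily α R) (K : Type*) [NormedAddCommGroup K]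
    [InnerProductSpace ℂ K] : G →* (S.TensorH K ≃ₗᵢ[ℂ] S.TensorH K) where
  toFun g := lpCongr fun σ => conjAction K (S.mult σ) (R.rep σ g)
  map_one' := LinearIsometryEquiv.ext fun f => lp.ext (funext fun σ => by
    change conjActionLin K (S.mult σ) (R.rep σ 1) (f σ) = f σ
    rw [map_one, conjActionLin_one])
  map_mul' g h := LinearIsometryEquiv.ext fun f => lp.ext (funext fun σ => by
    change conjActionLin K (S.mult σ) (R.rep σ (g * h)) (f σ) =
      conjActionLin K (S.mult σ) (R.rep σ g) (conjActionLin K (S.mult σ) (R.rep σ h) (f σ))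
    rw [map_mul, conjActionLin_mul])

theorem oneTensorMu_apply (S : IsometryFamily α R) (g : G) (ξ : S.TensorH K) (σ : ι)
    (i : Fin (S.mult σ)) (j : Fin (R.dim σ)) :
    (S.oneTensorMu K g ξ) σ (i, j) =
      ∑ l, star ((R.rep σ g : Matrix (Fin (R.dim σ)) (Fin (R.dim σ)) ℂ) j l) • ξ σ (i, l) :=
  rfl

/-- The element `ξ ⊗ h` of `K ⊗ H` for `ξ ∈ K` and `h ∈ H`. -/
def tmulH (S : IsometryFamily α R) (ξ : K) (h : S.TensorH ℂ) : S.TensorH K :=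
  ⟨fun σ => WithLp.toLp 2 fun p => h σ p • ξ, by
    refine Memℓp.mono (g := fun σ => ‖ξ‖ * ‖h σ‖) ((lp.memℓp h).norm.const_mul ‖ξ‖) fun σ => ?_
    refine le_of_eq ?_
    rw [PiLp.norm_eq_of_L2, PiLp.norm_eq_of_L2]
    simp only [norm_smul, mul_pow]
    rw [← Finset.sum_mul, Real.sqrt_mul (Finset.sum_nonneg fun _ _ => sq_nonneg _),
      Real.sqrt_sq (norm_nonneg _), mul_comm]⟩

/-- The element `ξ ⊗ ζ` of `K ⊗ H ⊗ ℂ^r` for `ξ ∈ K` and `ζ ∈ H ⊗ ℂ^r`. -/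
def tmulHSpin (S : IsometryFamily α R) {r : ℕ} (ξ : K) (ζ : TensorSpin (S.TensorH ℂ) r) :
    TensorSpin (S.TensorH K) r :=
  WithLp.toLp 2 fun a => S.tmulH ξ (ζ a)

/-- The unbounded operator `1_K ⊗ D` on `K ⊗ H ⊗ ℂ^r` for an unbounded operator `D` on `H ⊗ ℂ^r`:
the closure of the operator `ξ ⊗ ζ ↦ ξ ⊗ D ζ` on the algebraic tensor product `K ⊗ dom(D)`. -/
def oneTensorOp (S : IsometryFamily α R) (K : Type*) [NormedAddCommGroup K]
    [InnerProductSpace ℂ K] {r : ℕ}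
    (D : TensorSpin (S.TensorH ℂ) r →ₗ.[ℂ] TensorSpin (S.TensorH ℂ) r) :
    TensorSpin (S.TensorH K) r →ₗ.[ℂ] TensorSpin (S.TensorH K) r :=
  (Submodule.span ℂ (Set.range fun q : K × D.domain =>
    (S.tmulHSpin q.1 (q.2 : TensorSpin (S.TensorH ℂ) r),
      S.tmulHSpin q.1 (D q.2)))).topologicalClosure.toLinearPMap

section Lift

variable {HB : Type*} [NormedAddCommGroup HB] [InnerProductSpace ℂ HB] [CompleteSpace HB]

/-- The Hilbert space `H_p = p(H_B ⊗ H)`, where `p = (π_B ⊗ id)(s s^*) = ⨁_σ π_B(p(σ)) ⊗ 1`, as the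
space of vectors `ξ` with `p ξ = ξ`. -/
def hilbertP (S : IsometryFamily α R) (πB : α.fixedAlgebra →⋆ₐ[ℂ] (HB →L[ℂ] HB)) :
    Submodule ℂ (S.TensorH HB) where
  carrier := {ξ | ∀ σ i j, ξ σ (i, j) = ∑ k, πB (S.projEntry σ i k) (ξ σ (k, j))}
  zero_mem' σ i j := by simp
  add_mem' {ξ η} hξ hη σ i j := by
    change ξ σ (i, j) + η σ (i, j) = ∑ k, πB (S.projEntry σ i k) (ξ σ (k, j) + η σ (k, j))
    simp only [map_add, Finset.sum_add_distrib]
    rw [← hξ σ i j, ← hη σ i j]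
  smul_mem' c ξ hξ σ i j := by
    change c • ξ σ (i, j) = ∑ k, πB (S.projEntry σ i k) (c • ξ σ (k, j))
    simp only [map_smul, ← Finset.smul_sum]
    rw [← hξ σ i j]

instance hilbertPNormedAddCommGroup (S : IsometryFamily α R)
    (πB : α.fixedAlgebra →⋆ₐ[ℂ] (HB →L[ℂ] HB)) : NormedAddCommGroup (S.hilbertP πB) :=
  Submodule.normedAddCommGroup _

instance hilbertPInnerProductSpace (S : IsometryFamily α R)
    (πB : α.fixedAlgebra →⋆ₐ[ℂ] (HB →L[ℂ] HB)) : InnerProductSpace ℂ (S.hilbertP πB) :=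
  Submodule.innerProductSpace _

instance hilbertPNormedSpace (S : IsometryFamily α R)
    (πB : α.fixedAlgebra →⋆ₐ[ℂ] (HB →L[ℂ] HB)) : NormedSpace ℂ (S.hilbertP πB) :=
  InnerProductSpace.toNormedSpace

instance completeSpace_hilbertP (S : IsometryFamily α R)
    (πB : α.fixedAlgebra →⋆ₐ[ℂ] (HB →L[ℂ] HB)) : CompleteSpace (S.hilbertP πB) := by
  have hev : ∀ σ p, Continuous fun ξ : S.TensorH HB => ξ σ p := fun σ p =>
    (PiLp.continuous_apply 2 (fun _ => HB) p).comp
      ((continuous_apply σ).comp (lp.uniformContinuous_coe (p := 2)).continuous)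
  have hcl : IsClosed (S.hilbertP πB : Set (S.TensorH HB)) := by
    have : (S.hilbertP πB : Set (S.TensorH HB)) = ⋂ σ, ⋂ i, ⋂ j,
        {ξ | ξ σ (i, j) = ∑ k, πB (S.projEntry σ i k) (ξ σ (k, j))} := by
      ext ξ
      simp only [Set.mem_iInter]
      rfl
    rw [this]
    refine isClosed_iInter fun σ => isClosed_iInter fun i => isClosed_iInter fun j => ?_
    exact isClosed_eq (hev σ _)
      (continuous_finsetSum _ fun k _ => (πB (S.projEntry σ i k)).continuous.comp (hev σ _))
  exact hcl.completeSpace_coe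

theorem oneTensorMu_mem (S : IsometryFamily α R) (πB : α.fixedAlgebra →⋆ₐ[ℂ] (HB →L[ℂ] HB))
    (g : G) {ξ : S.TensorH HB} (hξ : ξ ∈ S.hilbertP πB) :
    S.oneTensorMu HB g ξ ∈ S.hilbertP πB := by
  intro σ i j
  simp only [oneTensorMu_apply, map_sum, map_smul]
  rw [Finset.sum_comm]
  refine Finset.sum_congr rfl fun l _ => ?_
  rw [← Finset.smul_sum, ← hξ σ i l]

/-- The unitary representation `u_A` of `G` on `H_p`: the restriction of `1 ⊗ μ`. -/
def uA (S : IsometryFamily α R) (πB : α.fixedAlgebra →⋆ₐ[ℂ] (HB →L[ℂ] HB)) :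
    G →* (S.hilbertP πB ≃ₗᵢ[ℂ] S.hilbertP πB) where
  toFun g :=
    { toFun := fun ξ => ⟨S.oneTensorMu HB g ξ, S.oneTensorMu_mem πB g ξ.2⟩
      invFun := fun ξ => ⟨S.oneTensorMu HB g⁻¹ ξ, S.oneTensorMu_mem πB g⁻¹ ξ.2⟩
      map_add' := fun ξ η => Subtype.ext (map_add (S.oneTensorMu HB g) (ξ : S.TensorH HB) η)
      map_smul' := fun c ξ => Subtype.ext (map_smul (S.oneTensorMu HB g) c (ξ : S.TensorH HB))
      left_inv := fun ξ => Subtype.ext (by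
        change (S.oneTensorMu HB g⁻¹ * S.oneTensorMu HB g) (ξ : S.TensorH HB) = ξ
        rw [← map_mul, inv_mul_cancel, map_one]; rfl)
      right_inv := fun ξ => Subtype.ext (by
        change (S.oneTensorMu HB g * S.oneTensorMu HB g⁻¹) (ξ : S.TensorH HB) = ξ
        rw [← map_mul, mul_inv_cancel, map_one]; rfl)
      norm_map' := fun ξ => (S.oneTensorMu HB g).norm_map ξ }
  map_one' := LinearIsometryEquiv.ext fun ξ => Subtype.ext (by
    change S.oneTensorMu HB 1 (ξ : S.TensorH HB) = ξ
    rw [map_one]; rfl)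
  map_mul' g h := LinearIsometryEquiv.ext fun ξ => Subtype.ext (by
    change S.oneTensorMu HB (g * h) (ξ : S.TensorH HB) =
      S.oneTensorMu HB g (S.oneTensorMu HB h ξ)
    rw [map_mul]; rfl)

/-- The inclusion `H_p ⊗ ℂ^r ⊆ H_B ⊗ H ⊗ ℂ^r`. -/
def inclSpin (S : IsometryFamily α R) (πB : α.fixedAlgebra →⋆ₐ[ℂ] (HB →L[ℂ] HB)) {r : ℕ}
    (η : TensorSpin (S.hilbertP πB) r) : TensorSpin (S.TensorH HB) r :=
  WithLp.toLp 2 fun a => (η a : S.TensorH HB)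

section PiA

variable [MeasurableSpace G] [BorelSpace G] [CompactSpace G] [IsTopologicalGroup G]
  (ν : MeasureTheory.Measure G) [ν.IsHaarMeasure]

/-- The matrix coefficients of `π_s(x) = s j_α(x) s^*`, as elements of the fixed point algebra
`B`. -/
def piEntry (S : IsometryFamily α R) (x : A) (ρ : ι) (i : Fin (S.mult ρ)) (j : Fin (R.dim ρ))
    (τ : ι) (k : Fin (S.mult τ)) (l : Fin (R.dim τ)) : α.fixedAlgebra :=
  ⟨S.piEntryAux ν x ρ i j τ k l, S.piEntryAux_mem ν x ρ i j τ k l⟩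

open scoped Classical in
/-- The bounded operator `T` on `H_p` equals `(π_B ⊗ id)(π_s(x))`: its matrix coefficients with
respect to the decomposition of `H` are the images under `π_B` of those of `π_s(x)`. Since the
vectors `v` of `H_p` that are supported in one of the summands `H_B ⊗ H_τ ⊗ \bar V_τ` span a dense
subspace of `H_p`, this determines `T`. -/
def IsPiA (S : IsometryFamily α R) (πB : α.fixedAlgebra →⋆ₐ[ℂ] (HB →L[ℂ] HB)) (x : A)
    (T : S.hilbertP πB →L[ℂ] S.hilbertP πB) : Prop :=
  ∀ (τ : ι) (v : S.Block HB τ) (hv : lp.single 2 τ v ∈ S.hilbertP πB) (ρ : ι)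
    (i : Fin (S.mult ρ)) (j : Fin (R.dim ρ)),
    (T ⟨lp.single 2 τ v, hv⟩ : S.TensorH HB) ρ (i, j) =
      ∑ k, ∑ l, πB (S.piEntry ν x ρ i j τ k l) (v (k, l))

open scoped Classical in
/-- The representation `π_A = (π_B ⊗ id) ∘ π_s` of `A` on `H_p`. -/
def piA (S : IsometryFamily α R) (πB : α.fixedAlgebra →⋆ₐ[ℂ] (HB →L[ℂ] HB)) (x : A) :
    S.hilbertP πB →L[ℂ] S.hilbertP πB :=
  if h : ∃ T, S.IsPiA ν πB x T then h.choose else 0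

end PiA

/-- The vertical Dirac operator `D_v` on `H ⊗ ℂ^r`: the closure of `Σ_k ∂_{X_k} μ ⊗ F_k`, defined
on `H^∞ ⊗ ℂ^r`. -/
def verticalDirac {n : ℕ} [ChartedSpace (EuclideanSpace ℝ (Fin n)) G] [LieGroup (𝓡 n) ∞ G]
    [T2Space G] (S : IsometryFamily α R) {r : ℕ} (X : Fin n → GroupLieAlgebra (𝓡 n) G)
    (F : Fin n → Matrix (Fin r) (Fin r) ℂ) :
    TensorSpin (S.TensorH ℂ) r →ₗ.[ℂ] TensorSpin (S.TensorH ℂ) r :=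
  (diracCore (S.oneTensorMu ℂ) X F).closure

/-- The operator `\hat D_v` on `H_p ⊗ ℂ^r`: the closure of `Σ_k ∂_{X_k} u_A ⊗ F_k`, defined
on `H_p^∞ ⊗ ℂ^r`. -/
def hatVerticalDirac {n : ℕ} [ChartedSpace (EuclideanSpace ℝ (Fin n)) G] [LieGroup (𝓡 n) ∞ G]
    [T2Space G] (S : IsometryFamily α R) (πB : α.fixedAlgebra →⋆ₐ[ℂ] (HB →L[ℂ] HB)) {r : ℕ}
    (X : Fin n → GroupLieAlgebra (𝓡 n) G) (F : Fin n → Matrix (Fin r) (Fin r) ℂ) :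
    TensorSpin (S.hilbertP πB) r →ₗ.[ℂ] TensorSpin (S.hilbertP πB) r :=
  (diracCore (S.uA πB) X F).closure

end Lift

end IsometryFamily

end HilbertSpaces

end

/-!
*The operators `π_A(x)`.* Write `t_{σ,(i,j)} = √(dim σ) s(σ)_{ij}^*`. The matrix coefficients of
`s j_α(x) s^*` are `E(t_p^* x t_q)`, where `E(y) = ∫ α_{h⁻¹}(y) dh` is the conditional expectation
of `A` onto the fixed point algebra (`IsometryFamily.piEntry_eq_average`). The map `E` is completely
positive, in the sense that the matrices `(E(a_p^* a_q))` have the form `c^* c` over the fixed point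
algebra (`exists_average_star_mul_eq`), so `x ↦ Σ_{p,q} ⟨ξ_p, π_B(E(t_p^* x t_q)) ξ_q⟩` is a
positive functional for every finitely supported vector `ξ`, and it is bounded by its value at
`x = 1` (`norm_averagedForm_le`). By the Schur orthogonality relations, which are proved here from Schur's
lemma, the coefficients at `x = 1` are those of `p`, so that for `ξ` in `H_p` this value is at most
`‖ξ‖²` (`coeffForm_one`). Hence the finite truncations of the matrix of `s j_α(x) s^*` are uniformly
bounded forms on `H_p`, and a limit point of them is the required operator (`exists_isPiA`). It is
unique, so `π_A` is linear and bounded in `x`, and the invariance of Haar measure together with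
`α_g(s(σ)) = s(σ)(1 ⊗ σ_g)` gives the covariance
`u_A(g) π_A(x) u_A(g)^* = π_A(α_g(x))` (`piA_act_uA`).

*The Dirac operators.* For a unitary representation `u` the operator `Σ_k ∂_{X_k} u ⊗ F_k` on smooth
vectors is symmetric, since `∂_X u` and `F_k` are skew. The projections onto finitely many isotypic
components commute with `u`, have smooth vectors as their values, and converge strongly to the
identity; applied to a vector in the domain of the adjoint they approximate it in the graph norm by
elements of the core. So the closure is self-adjoint (`isSelfAdjoint_diracCore_closure`). Values of
the projections are smooth because matrix coefficients of continuous finite-dimensional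
representations of a compact Lie group are smooth, which follows by convolution with a bump function
(`contMDiff_of_continuous_monoidHom`). The same projections turn a smooth vector into finite sums of
elementary tensors, which compares `1 ⊗ D_v` with the Dirac operator of `1 ⊗ μ`
(`takesValue_oneTensorOp`) and hence, as the inclusion of `H_p` intertwines `u_A` and `1 ⊗ μ`, with
the closure of the Dirac operator of `u_A`.

For smooth `x` the map `g ↦ π_A(α_g(x))` is smooth in norm because `π_A` is linear and bounded. The
product rule applied to `u_A(g) π_A(x) η = π_A(α_g(x)) u_A(g) η` yields the commutator formula on
the core, and the formula passes to the closure of the graph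
(`hasBoundedCommutator_diracCore_closure`).
-/

noncomputable section

/-! ### Parametric integrals over compact manifolds -/

section ParametricIntegral

variable {n : ℕ} {G : Type*} [TopologicalSpace G] [ChartedSpace (EuclideanSpace ℝ (Fin n)) G]
  {E : Type*} [NormedAddCommGroup E] [NormedSpace ℝ E]

theorem integrable_of_continuous_compact {G : Type*} [TopologicalSpace G] [CompactSpace G]
    [MeasurableSpace G] [BorelSpace G] {F : Type*} [NormedAddCommGroup F] {f : G → F}
    (hf : Continuous f) (ν : MeasureTheory.Measure G) [MeasureTheory.IsFiniteMeasureOnCompacts ν] :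
    MeasureTheory.Integrable f ν :=
  hf.integrable_of_hasCompactSupport (HasCompactSupport.of_compactSpace f)

/-- The partial derivative in the first variable of a function that is smooth on `U × G`
is smooth on `U × G`. -/
theorem contMDiffOn_fderiv_fst [IsManifold (𝓡 n) ∞ G] {W : Type*} [NormedAddCommGroup W]
    [NormedSpace ℝ W] {U : Set E} (hU : IsOpen U) {Φ : E → G → W}
    (hΦ : ContMDiffOn (𝓘(ℝ, E).prod (𝓡 n)) 𝓘(ℝ, W) ∞ (Function.uncurry Φ) (U ×ˢ Set.univ)) :
    ContMDiffOn (𝓘(ℝ, E).prod (𝓡 n)) 𝓘(ℝ, E →L[ℝ] W) ∞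
      (Function.uncurry fun x h => fderiv ℝ (fun y => Φ y h) x) (U ×ˢ Set.univ) := by
  have : IsManifold (𝓡 n) 1 G := IsManifold.of_le (n := ∞) (by exact_mod_cast le_top)
  rintro ⟨x, h⟩ hx
  refine ContMDiffAt.contMDiffWithinAt ?_
  have hopen : IsOpen (U ×ˢ (Set.univ : Set G)) := hU.prod isOpen_univ
  have h1 : ContMDiffAt (𝓘(ℝ, E).prod (𝓡 n)) 𝓘(ℝ, W) ∞ (Function.uncurry Φ) (x, h) :=
    (hΦ (x, h) hx).contMDiffAt (hopen.mem_nhds hx)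
  have h2 : ContMDiffAt ((𝓘(ℝ, E).prod (𝓡 n)).prod 𝓘(ℝ, E)) 𝓘(ℝ, W) ∞
      (Function.uncurry fun (p : E × G) (y : E) => Φ y p.2) ((x, h), x) := by
    have h3 : ContMDiffAt ((𝓘(ℝ, E).prod (𝓡 n)).prod 𝓘(ℝ, E)) (𝓘(ℝ, E).prod (𝓡 n)) ∞
        (fun q : (E × G) × E => (q.2, q.1.2)) ((x, h), x) :=
      contMDiffAt_snd.prodMk (contMDiffAt_snd.comp _ contMDiffAt_fst)
    exact ContMDiffAt.comp ((x, h), x) (g := Function.uncurry Φ) h1 h3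
  have h4 := ContMDiffAt.mfderiv (J := 𝓘(ℝ, E).prod (𝓡 n)) (I := 𝓘(ℝ, E)) (I' := 𝓘(ℝ, W))
    (m := ∞) (n := ∞) (x₀ := (x, h)) (fun (p : E × G) (y : E) => Φ y p.2) Prod.fst h2
    contMDiffAt_fst (by simp)
  simp only [mfderiv_eq_fderiv] at h4
  have h5 := inTangentCoordinates_model_space (I := 𝓘(ℝ, E)) (I' := 𝓘(ℝ, W)) Prod.fst
    (fun p : E × G => Φ p.1 p.2) (fun p => fderiv ℝ (fun y => Φ y p.2) p.1) (x, h)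
  exact (congrArg (ContMDiffAt (𝓘(ℝ, E).prod (𝓡 n)) 𝓘(ℝ, E →L[ℝ] W) ∞ · (x, h)) h5).mp h4

variable [CompactSpace G] [MeasurableSpace G] [BorelSpace G]

/-- One differentiation step under the integral sign. -/
theorem hasFDerivAt_integral_clm [ProperSpace E] [IsManifold (𝓡 n) ∞ G]
    (ν : MeasureTheory.Measure G) [MeasureTheory.IsFiniteMeasureOnCompacts ν] {W F : Type*}
    [NormedAddCommGroup W] [NormedSpace ℝ W] [NormedAddCommGroup F] [NormedSpace ℝ F]
    {U : Set E} (hU : IsOpen U) {Φ : E → G → W}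
    (hΦ : ContMDiffOn (𝓘(ℝ, E).prod (𝓡 n)) 𝓘(ℝ, W) ∞ (Function.uncurry Φ) (U ×ˢ Set.univ))
    {T : G → W →L[ℝ] F} (hT : Continuous T) {x : E} (hx : x ∈ U) :
    HasFDerivAt (fun y => ∫ h, T h (Φ y h) ∂ν)
      (∫ h, ContinuousLinearMap.compL ℝ E W F (T h) (fderiv ℝ (fun y => Φ y h) x) ∂ν) x := by
  obtain ⟨ε, hε, hball⟩ := Metric.isOpen_iff.1 hU x hx
  have hsub : Metric.closedBall x (ε / 2) ⊆ U :=
    (Metric.closedBall_subset_ball (by linarith)).trans hball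
  have hcont : ∀ y ∈ U, Continuous (Φ y) := fun y hy => by
    have h1 := hΦ.continuousOn
    have h2 : Continuous fun h : G => ((y, h) : E × G) := by fun_prop
    exact h1.comp_continuous h2 fun h => ⟨hy, trivial⟩
  have hD := contMDiffOn_fderiv_fst hU hΦ
  have hDc : ContinuousOn (Function.uncurry fun y h =>
      ContinuousLinearMap.compL ℝ E W F (T h) (fderiv ℝ (fun y => Φ y h) y))
      (U ×ˢ Set.univ) :=
    (((ContinuousLinearMap.compL ℝ E W F).continuous.comp
      (hT.comp continuous_snd)).continuousOn).clm_apply hD.continuousOn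
  have hK : IsCompact (Metric.closedBall x (ε / 2) ×ˢ (Set.univ : Set G)) :=
    (isCompact_closedBall x _).prod isCompact_univ
  obtain ⟨C, hC⟩ := hK.exists_bound_of_continuousOn
    (hDc.mono (Set.prod_mono hsub subset_rfl))
  refine hasFDerivAt_integral_of_dominated_of_fderiv_le (s := Metric.closedBall x (ε / 2))
    (bound := fun _ => C) (F' := fun y h =>
      ContinuousLinearMap.compL ℝ E W F (T h) (fderiv ℝ (fun y => Φ y h) y))
    (Metric.closedBall_mem_nhds x (by linarith)) ?_ ?_ ?_ ?_ ?_ ?_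
  · filter_upwards [hU.mem_nhds hx] with y hy
    exact (integrable_of_continuous_compact (hT.clm_apply (hcont y hy)) ν).aestronglyMeasurable
  · exact integrable_of_continuous_compact (hT.clm_apply (hcont x hx)) ν
  · refine (integrable_of_continuous_compact ?_ ν).aestronglyMeasurable
    have h2 : Continuous fun h : G => ((x, h) : E × G) := by fun_prop
    exact hDc.comp_continuous h2 fun h => ⟨hx, trivial⟩
  · exact Filter.Eventually.of_forall fun h y hy => hC (y, h) ⟨hy, trivial⟩
  · exact integrable_of_continuous_compact continuous_const ν
  · refine Filter.Eventually.of_forall fun h y hy => ?_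
    refine (T h).hasFDerivAt.comp y (DifferentiableAt.hasFDerivAt ?_)
    have hy' : (y, h) ∈ U ×ˢ (Set.univ : Set G) := ⟨hsub hy, trivial⟩
    have h1 := (hΦ (y, h) hy').contMDiffAt ((hU.prod isOpen_univ).mem_nhds hy')
    have h3 : ContMDiffAt 𝓘(ℝ, E) (𝓘(ℝ, E).prod (𝓡 n)) ∞ (fun z : E => (z, h)) y :=
      contMDiffAt_id.prodMk contMDiffAt_const
    have h5 := ContMDiffAt.comp y (g := Function.uncurry Φ) h1 h3
    exact (contMDiffAt_iff_contDiffAt.1 h5).differentiableAt (by simp)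

/-- An integral over a compact manifold depends smoothly on a parameter in which the integrand
is smooth; the weights `T h` only have to be continuous in the variable of integration. The class
of such integrals is closed under differentiation. -/
theorem contDiffOn_integral_clm {E : Type} [NormedAddCommGroup E] [NormedSpace ℝ E] [ProperSpace E]
    [IsManifold (𝓡 n) ∞ G] (ν : MeasureTheory.Measure G)
    [MeasureTheory.IsFiniteMeasureOnCompacts ν] {U : Set E} (hU : IsOpen U) (k : ℕ) : ∀ {W F : Type}
    [NormedAddCommGroup W] [NormedSpace ℝ W] [NormedAddCommGroup F] [NormedSpace ℝ F]
    -- `W` and `F` are quantified after `k`: the induction passes to `E →L[ℝ] W` and `E →L[ℝ] F`,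
    -- for which all spaces have to live in one universe.
    {Φ : E → G → W}
    (_ : ContMDiffOn (𝓘(ℝ, E).prod (𝓡 n)) 𝓘(ℝ, W) ∞ (Function.uncurry Φ) (U ×ˢ Set.univ))
    {T : G → W →L[ℝ] F} (_ : Continuous T),
    ContDiffOn ℝ k (fun y => ∫ h, T h (Φ y h) ∂ν) U := by
  induction k with
  | zero =>
    intro W F _ _ _ _ Φ hΦ T hT
    rw [Nat.cast_zero, contDiffOn_zero]
    exact fun x hx => (hasFDerivAt_integral_clm ν hU hΦ hT hx).continuousAt.continuousWithinAt
  | succ k ih =>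
    intro W F _ _ _ _ Φ hΦ T hT
    rw [Nat.cast_succ, contDiffOn_succ_iff_fderiv_of_isOpen hU]
    refine ⟨fun x hx => (hasFDerivAt_integral_clm ν hU hΦ hT
      hx).differentiableAt.differentiableWithinAt, by simp, ?_⟩
    refine (ih (contMDiffOn_fderiv_fst hU hΦ)
      ((ContinuousLinearMap.compL ℝ E W F).continuous.comp hT)).congr fun x hx => ?_
    exact (hasFDerivAt_integral_clm ν hU hΦ hT hx).fderiv

end ParametricIntegral

/-! ### Smoothness of continuous homomorphisms -/

section ContinuousHom

variable {n : ℕ} {G : Type*} [TopologicalSpace G] [ChartedSpace (EuclideanSpace ℝ (Fin n)) G]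
  [Group G] [LieGroup (𝓡 n) ∞ G] [CompactSpace G] [MeasurableSpace G] [BorelSpace G]

/-- The convolution of a continuous function by a smooth one is smooth. -/
theorem contMDiff_integral_inv_mul (ν : MeasureTheory.Measure G)
    [MeasureTheory.IsFiniteMeasureOnCompacts ν] {F : Type} [NormedAddCommGroup F]
    [NormedSpace ℝ F] {φ : G → ℝ} (hφ : ContMDiff (𝓡 n) 𝓘(ℝ, ℝ) ∞ φ) {c : G → F}
    (hc : Continuous c) : ContMDiff (𝓡 n) 𝓘(ℝ, F) ∞ (fun g => ∫ h, φ (g⁻¹ * h) • c h ∂ν) := by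
  intro g₀
  set χ := extChartAt (𝓡 n) g₀ with hχ
  have hU : IsOpen χ.target := isOpen_extChartAt_target g₀
  have hΦ : ContMDiffOn (𝓘(ℝ, EuclideanSpace ℝ (Fin n)).prod (𝓡 n)) 𝓘(ℝ, ℝ) ∞
      (Function.uncurry fun (x : EuclideanSpace ℝ (Fin n)) (h : G) => φ ((χ.symm x)⁻¹ * h))
      (χ.target ×ˢ Set.univ) := by
    have h1 : ContMDiffOn (𝓘(ℝ, EuclideanSpace ℝ (Fin n)).prod (𝓡 n)) (𝓡 n) ∞
        (fun p : EuclideanSpace ℝ (Fin n) × G => χ.symm p.1) (χ.target ×ˢ Set.univ) :=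
      (contMDiffOn_extChartAt_symm g₀).comp contMDiffOn_fst fun p hp => hp.1
    exact hφ.comp_contMDiffOn (h1.inv.mul contMDiffOn_snd)
  have hT : Continuous fun h => ContinuousLinearMap.toSpanSingleton ℝ (c h) :=
    (ContinuousLinearMap.toSpanSingletonCLE (𝕜 := ℝ) (E := F)).continuous.comp hc
  have h2 : ContDiffOn ℝ ∞ (fun x => ∫ h, φ ((χ.symm x)⁻¹ * h) • c h ∂ν) χ.target := by
    rw [contDiffOn_infty]
    intro k
    exact contDiffOn_integral_clm ν hU k hΦ hT
  have h3 : ContMDiffAt (𝓡 n) 𝓘(ℝ, F) ∞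
      ((fun x => ∫ h, φ ((χ.symm x)⁻¹ * h) • c h ∂ν) ∘ χ) g₀ :=
    ContMDiffAt.comp g₀
      (h2.contDiffAt (hU.mem_nhds (mem_extChartAt_target g₀))).contMDiffAt contMDiffAt_extChartAt
  refine h3.congr_of_eventuallyEq ?_
  filter_upwards [extChartAt_source_mem_nhds (I := 𝓡 n) g₀] with g hg
  simp only [Function.comp_apply]
  rw [χ.left_inv hg]

variable [IsTopologicalGroup G] [T2Space G]

/-- A continuous homomorphism from a compact Lie group to the multiplicative monoid of a Banach
algebra is smooth: averaging against a smooth bump function `φ` near `1` gives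
`∫ φ(g⁻¹h) ρ(h) dh = ρ(g) ∫ φ(h) ρ(h) dh`, in which the left side is smooth in `g` and the last
factor is invertible. -/
theorem contMDiff_of_continuous_monoidHom {𝔐 : Type} [NormedRing 𝔐] [NormedAlgebra ℝ 𝔐]
    [CompleteSpace 𝔐] (ρ : G →* 𝔐) (hρ : Continuous ρ) : ContMDiff (𝓡 n) 𝓘(ℝ, 𝔐) ∞ ρ := by
  let ν : MeasureTheory.Measure G := MeasureTheory.Measure.haar
  have hV : {g : G | ‖ρ g - 1‖ < 1 / 2} ∈ nhds (1 : G) := by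
    have h1 : Continuous fun g => ‖ρ g - 1‖ := by fun_prop
    exact (isOpen_lt h1 continuous_const).mem_nhds (by simp)
  obtain ⟨φ, hφ, -⟩ := (SmoothBumpFunction.nhds_basis_support (I := 𝓡 n) hV).mem_iff.1
    (Filter.univ_mem)
  have hφs : ContMDiff (𝓡 n) 𝓘(ℝ, ℝ) ∞ φ := φ.contMDiff
  have hφc : Continuous φ := hφs.continuous
  have hf := contMDiff_integral_inv_mul ν hφs hρ
  have hφρ : MeasureTheory.Integrable (fun h => φ h • ρ h) ν :=
    integrable_of_continuous_compact (hφc.smul hρ) ν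
  have hmul : ∀ g, ∫ h, φ (g⁻¹ * h) • ρ h ∂ν = ρ g * ∫ h, φ h • ρ h ∂ν := fun g => by
    rw [← MeasureTheory.integral_mul_left_eq_self (fun h => φ (g⁻¹ * h) • ρ h) g,
      ← integral_const_mul_of_integrable hφρ]
    simp
  set m : 𝔐 := ∫ h, φ h • ρ h ∂ν with hm
  set c : ℝ := ∫ h, φ h ∂ν with hc
  have hφi : MeasureTheory.Integrable φ ν := integrable_of_continuous_compact hφc ν
  have hcpos : 0 < c := by
    refine hφc.integral_pos_of_hasCompactSupport_nonneg_nonzero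
      (HasCompactSupport.of_compactSpace φ) (fun x => φ.nonneg) (x := 1) ?_
    simp
  -- `φ` is supported where `‖ρ - 1‖ < 1/2`, so `c⁻¹ m` has distance at most `1/2` from `1`.
  have hmc : ‖c • (1 : 𝔐) - m‖ ≤ c / 2 := by
    have h1 : c • (1 : 𝔐) - m = ∫ h, φ h • (1 - ρ h) ∂ν := by
      simp only [smul_sub]
      rw [MeasureTheory.integral_sub (hφi.smul_const 1) hφρ, integral_smul_const]
    rw [h1, hc, div_eq_mul_inv, ← MeasureTheory.integral_mul_const]
    refine MeasureTheory.norm_integral_le_of_norm_le (hφi.mul_const _)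
      (Filter.Eventually.of_forall fun h => ?_)
    rw [norm_smul, Real.norm_eq_abs, abs_of_nonneg φ.nonneg]
    by_cases h0 : φ h = 0
    · simp [h0]
    · have h2 : ‖ρ h - 1‖ < 1 / 2 := hφ (subset_tsupport _ h0)
      rw [norm_sub_rev]
      exact mul_le_mul_of_nonneg_left (by linarith) φ.nonneg
  have hunit : IsUnit m := by
    have h1 : IsUnit (1 - (1 - c⁻¹ • m)) := by
      refine isUnit_one_sub_of_norm_lt_one ?_
      have h2 : 1 - c⁻¹ • m = c⁻¹ • (c • (1 : 𝔐) - m) := by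
        rw [smul_sub, smul_smul, inv_mul_cancel₀ hcpos.ne', one_smul]
      rw [h2, norm_smul, norm_inv, Real.norm_eq_abs, abs_of_pos hcpos]
      calc c⁻¹ * ‖c • (1 : 𝔐) - m‖ ≤ c⁻¹ * (c / 2) := by gcongr
        _ = 1 / 2 := by field_simp
        _ < 1 := by norm_num
    have h3 : m = (algebraMap ℝ 𝔐 c) * (1 - (1 - c⁻¹ • m)) := by
      rw [sub_sub_cancel, ← Algebra.smul_def, smul_smul, mul_inv_cancel₀ hcpos.ne', one_smul]
    rw [h3]
    exact ((IsUnit.mk0 c hcpos.ne').map (algebraMap ℝ 𝔐)).mul h1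
  obtain ⟨w, hw⟩ := hunit
  have h4 : (ρ : G → 𝔐) = fun g => (∫ h, φ (g⁻¹ * h) • ρ h ∂ν) * ((w⁻¹ : 𝔐ˣ) : 𝔐) := by
    ext g
    rw [hmul, mul_assoc, ← hw, Units.mul_inv, mul_one]
  rw [h4]
  exact (((ContinuousLinearMap.mul ℝ 𝔐).flip ((w⁻¹ : 𝔐ˣ) : 𝔐)).contMDiff).comp hf

attribute [local instance] Matrix.linftyOpNormedRing Matrix.linftyOpNormedAlgebra in
/-- The matrix coefficients of a continuous unitary representation of a compact Lie group on `ℂ^d`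
are smooth. -/
theorem contMDiff_unitary_entry {d : ℕ} (ρ : G →* Matrix.unitaryGroup (Fin d) ℂ)
    (hρ : Continuous ρ) (i j : Fin d) :
    ContMDiff (𝓡 n) 𝓘(ℝ, ℂ) ∞ (fun g => (ρ g : Matrix (Fin d) (Fin d) ℂ) i j) := by
  have h := contMDiff_of_continuous_monoidHom (n := n)
    ((Matrix.unitaryGroup (Fin d) ℂ).subtype.comp ρ) (continuous_subtype_val.comp hρ)
  let e : Matrix (Fin d) (Fin d) ℂ →L[ℝ] ℂ :=
    ⟨(Matrix.entryLinearMap ℝ ℂ i j), continuous_id.matrix_elem i j⟩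
  exact e.contMDiff.comp h

end ContinuousHom

/-! ### Dirac-type operators of a unitary representation -/

section DiracCore

variable {n r : ℕ} {G : Type*} [TopologicalSpace G] [ChartedSpace (EuclideanSpace ℝ (Fin n)) G]
  [Group G]
  {K : Type*} [NormedAddCommGroup K] [InnerProductSpace ℂ K]
  {K' : Type*} [NormedAddCommGroup K'] [InnerProductSpace ℂ K']
  {u : G →* (K ≃ₗᵢ[ℂ] K)} {u' : G →* (K' ≃ₗᵢ[ℂ] K')}

/-- A bounded map that carries the orbit of `η` to the orbit of `ζ` makes `ζ` smooth along with `η`.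
It does not have to intertwine the representations, so it may be an orthogonal projection onto an
invariant subspace or the left inverse of an inclusion. -/
theorem mem_smoothVectors_of_map (Q : K →L[ℂ] K') {η : K} {ζ : K'}
    (h : ∀ g, Q (u g η) = u' g ζ) (hη : η ∈ smoothVectors (n := n) u) :
    ζ ∈ smoothVectors (n := n) u' := by
  have h1 : ContMDiff (𝓡 n) 𝓘(ℝ, K') ∞ ((Q.restrictScalars ℝ) ∘ fun g => u g η) :=
    (Q.restrictScalars ℝ).contMDiff.comp hη
  change ContMDiff (𝓡 n) 𝓘(ℝ, K') ∞ fun g => u' g ζ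
  simp only [← h]
  exact h1

theorem mem_smoothVectors_of_intertwining (Q : K →L[ℂ] K') (hQ : ∀ g v, Q (u g v) = u' g (Q v))
    {η : K} (hη : η ∈ smoothVectors (n := n) u) : Q η ∈ smoothVectors (n := n) u' :=
  mem_smoothVectors_of_map Q (fun g => hQ g η) hη

variable [LieGroup (𝓡 n) ∞ G] [T2Space G]

theorem hasDerivAt_partialRep (X : GroupLieAlgebra (𝓡 n) G) (η : smoothVectors (n := n) u) :
    HasDerivAt (fun t : ℝ => u (lieExp (t • X)) (η : K)) (partialRep u X η) 0 :=
  (differentiableAt_orbit u X η).hasDerivAt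

/-- The derivative of the constant function `t ↦ ⟨u_{exp(tX)} η, u_{exp(tX)} ζ⟩` vanishes. -/
theorem partialRep_skew (X : GroupLieAlgebra (𝓡 n) G) (η ζ : smoothVectors (n := n) u) :
    inner ℂ (partialRep u X η) (ζ : K) = -inner ℂ (η : K) (partialRep u X ζ) := by
  have h1 := (hasDerivAt_partialRep X η).inner ℂ (hasDerivAt_partialRep X ζ)
  simp only [LinearIsometryEquiv.inner_map_map, zero_smul, lieExp_zero, map_one] at h1
  have h2 := h1.unique (hasDerivAt_const (0 : ℝ) (inner ℂ (η : K) (ζ : K)))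
  exact eq_neg_of_add_eq_zero_right h2

theorem partialRep_of_intertwining (Q : K →L[ℂ] K') (hQ : ∀ g v, Q (u g v) = u' g (Q v))
    (X : GroupLieAlgebra (𝓡 n) G) (η : smoothVectors (n := n) u) :
    partialRep u' X ⟨Q η, mem_smoothVectors_of_intertwining Q hQ η.2⟩ = Q (partialRep u X η) := by
  have h1 := (Q.restrictScalars ℝ).hasFDerivAt.comp_hasDerivAt (0 : ℝ) (hasDerivAt_partialRep X η)
  have h2 := hasDerivAt_partialRep X
    (⟨Q η, mem_smoothVectors_of_intertwining Q hQ η.2⟩ : smoothVectors (n := n) u')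
  refine h2.unique ?_
  simp only [← hQ]
  exact h1

theorem diracCore_apply (X : Fin n → GroupLieAlgebra (𝓡 n) G)
    (F : Fin n → Matrix (Fin r) (Fin r) ℂ) (η : (diracCore u X F).domain) (a : Fin r) :
    (diracCore u X F η) a =
      ∑ k, ∑ b, F k a b • partialRep u (X k) ⟨(η : TensorSpin K r) b, η.2 b⟩ := by
  have h1 : ∀ f : Fin n → TensorSpin K r, (∑ k, f k) a = ∑ k, f k a := fun f =>
    map_sum (PiLp.proj (𝕜 := ℂ) 2 (fun _ : Fin r => K) a) f Finset.univ
  have h2 : ∀ ξ : subTensorSpin (smoothVectors (n := n) u) r,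
      ((∑ k, unboundedTensor (partialRep u (X k)) (F k)) ξ) a =
        ∑ k, ∑ b, F k a b • partialRep u (X k) ⟨(ξ : TensorSpin K r) b, ξ.2 b⟩ := fun ξ => by
    rw [LinearMap.sum_apply, h1]
    rfl
  exact h2 η

theorem boundedTensor_apply (T : K →L[ℂ] K) (F : Matrix (Fin r) (Fin r) ℂ) (η : TensorSpin K r)
    (a : Fin r) : boundedTensor T F η a = ∑ b, F a b • T (η b) := by
  change (ContinuousLinearMap.pi fun a =>
    ∑ b, F a b • (T ∘L PiLp.proj 2 (fun _ : Fin r => K) b)) η a = _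
  simp

theorem boundedTensor_one_apply (T : K →L[ℂ] K) (η : TensorSpin K r) (a : Fin r) :
    boundedTensor T 1 η a = T (η a) := by
  simp [boundedTensor_apply, Matrix.one_apply]

theorem diracCore_symmetric (X : Fin n → GroupLieAlgebra (𝓡 n) G)
    {F : Fin n → Matrix (Fin r) (Fin r) ℂ} (hF : ∀ k, star (F k) = -F k)
    (η ζ : (diracCore u X F).domain) :
    inner ℂ (diracCore u X F η) (ζ : TensorSpin K r) =
      inner ℂ (η : TensorSpin K r) (diracCore u X F ζ) := by
  simp only [PiLp.inner_apply, diracCore_apply, sum_inner, inner_sum, inner_smul_left,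
    inner_smul_right]
  rw [Finset.sum_comm]
  conv_rhs => rw [Finset.sum_comm]
  refine Finset.sum_congr rfl fun k _ => ?_
  rw [Finset.sum_comm]
  refine Finset.sum_congr rfl fun b _ => Finset.sum_congr rfl fun a _ => ?_
  have h1 : star (F k a b) = -F k b a := by
    rw [← Matrix.star_apply, hF, Matrix.neg_apply]
  have h2 := partialRep_skew (X k)
    (⟨(η : TensorSpin K r) b, η.2 b⟩ : smoothVectors (n := n) u)
    (⟨(ζ : TensorSpin K r) a, ζ.2 a⟩ : smoothVectors (n := n) u)
  dsimp only at h2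
  rw [h2, starRingEnd_apply, h1, neg_mul_neg]

theorem mem_diracCore_domain_of_commute {X : Fin n → GroupLieAlgebra (𝓡 n) G}
    {F : Fin n → Matrix (Fin r) (Fin r) ℂ} (Q : K →L[ℂ] K) (hQ : ∀ g v, Q (u g v) = u g (Q v))
    (η : (diracCore u X F).domain) :
    boundedTensor Q 1 (η : TensorSpin K r) ∈ (diracCore u X F).domain := fun a => by
  rw [boundedTensor_one_apply]
  exact mem_smoothVectors_of_intertwining Q hQ (η.2 a)

theorem diracCore_commute (X : Fin n → GroupLieAlgebra (𝓡 n) G)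
    (F : Fin n → Matrix (Fin r) (Fin r) ℂ) (Q : K →L[ℂ] K) (hQ : ∀ g v, Q (u g v) = u g (Q v))
    (η : (diracCore u X F).domain) :
    diracCore u X F ⟨boundedTensor Q 1 (η : TensorSpin K r),
      mem_diracCore_domain_of_commute Q hQ η⟩ = boundedTensor Q 1 (diracCore u X F η) := by
  ext a
  rw [boundedTensor_one_apply, diracCore_apply, diracCore_apply, map_sum]
  refine Finset.sum_congr rfl fun k _ => ?_
  rw [map_sum]
  refine Finset.sum_congr rfl fun b _ => ?_
  rw [map_smul, ← partialRep_of_intertwining Q hQ]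
  congr 3
  exact boundedTensor_one_apply Q _ b

theorem tendsto_tensorSpin {κ : Type*} {l : Filter κ} {f : κ → TensorSpin K r} {η : TensorSpin K r}
    (h : ∀ a, Filter.Tendsto (fun s => f s a) l (nhds (η a))) : Filter.Tendsto f l (nhds η) := by
  have h1 := (PiLp.continuous_toLp 2 (fun _ : Fin r => K)).tendsto (WithLp.ofLp η)
  exact h1.comp (tendsto_pi_nhds.2 h)

variable {κ : Type*} {l : Filter κ} [l.NeBot] {Q : κ → K →L[ℂ] K}

/-- Smooth vectors are dense when the identity is a strong limit of operators with smooth values. -/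
theorem dense_diracCore_domain (X : Fin n → GroupLieAlgebra (𝓡 n) G)
    (F : Fin n → Matrix (Fin r) (Fin r) ℂ)
    (hrange : ∀ s v, Q s v ∈ smoothVectors (n := n) u)
    (hlim : ∀ v, Filter.Tendsto (fun s => Q s v) l (nhds v)) :
    Dense ((diracCore u X F).domain : Set (TensorSpin K r)) := fun η => by
  refine mem_closure_of_tendsto (f := fun s => boundedTensor (Q s) 1 η) (b := l)
    (tendsto_tensorSpin fun a => ?_) (Filter.Eventually.of_forall fun s a => ?_)
  · simpa only [boundedTensor_one_apply] using hlim (η a)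
  · rw [boundedTensor_one_apply]; exact hrange s _

theorem inner_boundedTensor_one {T : K →L[ℂ] K}
    (hT : ∀ v w, inner ℂ (T v) w = inner ℂ v (T w)) (η ζ : TensorSpin K r) :
    inner ℂ (boundedTensor T 1 η) ζ = inner ℂ η (boundedTensor T 1 ζ) := by
  simp only [PiLp.inner_apply, boundedTensor_one_apply, hT]

/-- A symmetric operator is closable and its closure is self-adjoint as soon as the graph of its
adjoint is contained in the closure of its graph. -/
theorem LinearPMap.isSelfAdjoint_closure_of_le {E : Type*} [NormedAddCommGroup E]
    [InnerProductSpace ℂ E] [CompleteSpace E] {D : E →ₗ.[ℂ] E} (hd : Dense (D.domain : Set E))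
    (hsymm : ∀ x y : D.domain, inner ℂ (D x) (y : E) = inner ℂ (x : E) (D y))
    (hle : D.graph.adjoint ≤ D.graph.topologicalClosure) :
    D.IsClosable ∧ IsSelfAdjoint D.closure := by
  have hformal : D.IsFormalAdjoint D := fun x y => hsymm x y
  have hDle := hformal.le_adjoint hd
  have hcl : D.IsClosable := (LinearPMap.adjoint_isClosed hd).isClosable.leIsClosable hDle
  refine ⟨hcl, ?_⟩
  -- The adjoint graph is closed, and symmetry puts the graph inside it: the two graphs coincide.
  have hle2 : D.graph.topologicalClosure ≤ D.graph.adjoint := by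
    rw [← LinearPMap.adjoint_graph_eq_graph_adjoint hd]
    exact Submodule.topologicalClosure_minimal _ (LinearPMap.le_graph_of_le hDle)
      (LinearPMap.adjoint_isClosed hd)
  have heq := le_antisymm hle hle2
  have hd' : Dense (D.closure.domain : Set E) := hd.mono (LinearPMap.le_closure D).1
  rw [LinearPMap.isSelfAdjoint_def]
  apply LinearPMap.eq_of_eq_graph
  rw [LinearPMap.adjoint_graph_eq_graph_adjoint hd', ← hcl.graph_closure_eq_closure_graph, ← heq]
  refine le_antisymm (fun p hp => ?_) (fun p hp => ?_)
  · rw [Submodule.mem_adjoint_iff] at hp ⊢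
    exact fun a b hab => hp a b (heq ▸ D.graph.le_topologicalClosure hab)
  · rw [Submodule.mem_adjoint_iff]
    intro a b hab
    rw [heq] at hab
    have hclosed : _root_.IsClosed {q : E × E | inner ℂ q.2 p.1 - inner ℂ q.1 p.2 = 0} :=
      isClosed_eq (by fun_prop) continuous_const
    have hsub : (D.graph : Set (E × E)) ⊆
        {q : E × E | inner ℂ q.2 p.1 - inner ℂ q.1 p.2 = 0} := fun q hq =>
      (Submodule.mem_adjoint_iff _ _).1 hp q.1 q.2 hq
    exact closure_minimal hsub hclosed hab

/-- The Dirac-type operator `Σ_k ∂_{X_k} u ⊗ F_k` with skew-adjoint `F_k` is essentially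
self-adjoint when a net of self-adjoint operators commuting with `u` and mapping into the smooth
vectors converges strongly to the identity: applying them to a vector in the domain of the adjoint
gives approximations in the graph norm from the core. -/
theorem isSelfAdjoint_diracCore_closure [CompleteSpace K] (X : Fin n → GroupLieAlgebra (𝓡 n) G)
    {F : Fin n → Matrix (Fin r) (Fin r) ℂ} (hF : ∀ k, star (F k) = -F k)
    (hcomm : ∀ s g v, Q s (u g v) = u g (Q s v))
    (hsymm : ∀ s v w, inner ℂ (Q s v) w = inner ℂ v (Q s w))
    (hrange : ∀ s v, Q s v ∈ smoothVectors (n := n) u)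
    (hlim : ∀ v, Filter.Tendsto (fun s => Q s v) l (nhds v)) :
    (diracCore u X F).IsClosable ∧ IsSelfAdjoint (diracCore u X F).closure := by
  have hd := dense_diracCore_domain (u := u) X F hrange hlim
  refine LinearPMap.isSelfAdjoint_closure_of_le hd (diracCore_symmetric X hF) ?_
  rintro ⟨η, ζ⟩ hp
  rw [Submodule.mem_adjoint_iff] at hp
  have hp' : ∀ φ : (diracCore u X F).domain,
      inner ℂ (diracCore u X F φ) η = inner ℂ (φ : TensorSpin K r) ζ := fun φ =>
    sub_eq_zero.1 (hp _ _ ((diracCore u X F).mem_graph φ))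
  have hmem : ∀ s, boundedTensor (Q s) 1 η ∈ (diracCore u X F).domain := fun s a => by
    rw [boundedTensor_one_apply]; exact hrange s _
  -- `Q_s` commutes with the operator on the core, hence with its adjoint, and `Q_s η` is in the
  -- core.
  have hval : ∀ s, diracCore u X F ⟨boundedTensor (Q s) 1 η, hmem s⟩ =
      boundedTensor (Q s) 1 ζ := fun s => by
    refine hd.eq_of_inner_right ℂ fun φ hφ => ?_
    have h1 := diracCore_symmetric X hF ⟨φ, hφ⟩ ⟨boundedTensor (Q s) 1 η, hmem s⟩
    rw [← h1]
    dsimp only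
    rw [← inner_boundedTensor_one (hsymm s), ← inner_boundedTensor_one (hsymm s),
      ← diracCore_commute X F (Q s) (hcomm s), hp']
  refine mem_closure_of_tendsto
    (f := fun s => (boundedTensor (Q s) 1 η, boundedTensor (Q s) 1 ζ)) (b := l) ?_
    (Filter.Eventually.of_forall fun s => ?_)
  · refine Filter.Tendsto.prodMk_nhds (tendsto_tensorSpin fun a => ?_)
      (tendsto_tensorSpin fun a => ?_) <;>
    · simp only [boundedTensor_one_apply]
      exact hlim _
  · rw [← hval s]
    exact (diracCore u X F).mem_graph ⟨boundedTensor (Q s) 1 η, hmem s⟩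

/-- If the orbit `g ↦ P g = u_g a u_g⁻¹` of a bounded operator `a` is smooth with derivatives `T k`
along `X k`, then `a ⊗ 1` has the bounded commutator `Σ_k T k ⊗ F_k` with the closure of
`Σ_k ∂_{X_k} u ⊗ F_k`: by the product rule this holds on the core, and it passes to the closure of
the graph. -/
theorem hasBoundedCommutator_diracCore_closure {X : Fin n → GroupLieAlgebra (𝓡 n) G}
    {F : Fin n → Matrix (Fin r) (Fin r) ℂ} (hcl : (diracCore u X F).IsClosable)
    {P : G → K →L[ℂ] K} (hP : ContMDiff (𝓡 n) 𝓘(ℝ, K →L[ℂ] K) ∞ P)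
    (hPu : ∀ g v, P g (u g v) = u g (P 1 v)) {T : Fin n → K →L[ℂ] K}
    (hT : ∀ k, HasLieDeriv P (X k) (T k)) :
    HasBoundedCommutator (diracCore u X F).closure (boundedTensor (P 1) 1)
      (∑ k, boundedTensor (T k) (F k)) := by
  have hP' : ContMDiff (𝓡 n) 𝓘(ℝ, K →L[ℝ] K) ∞ fun g => (P g).restrictScalars ℝ :=
    (ContinuousLinearMap.restrictScalarsL ℂ K K ℝ ℝ).contMDiff.comp hP
  have hsm : ∀ v ∈ smoothVectors (n := n) u, P 1 v ∈ smoothVectors (n := n) u := fun v hv => by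
    have h1 : ContMDiff (𝓡 n) 𝓘(ℝ, K) ∞ fun g => (P g).restrictScalars ℝ (u g v) :=
      hP'.clm_apply hv
    change ContMDiff (𝓡 n) 𝓘(ℝ, K) ∞ fun g => u g (P 1 v)
    simp only [← hPu]
    exact h1
  have hder : ∀ k (v : smoothVectors (n := n) u),
      partialRep u (X k) ⟨P 1 v, hsm v v.2⟩ = T k v + P 1 (partialRep u (X k) v) := fun k v => by
    have h1 := hasDerivAt_partialRep (X k) (⟨P 1 v, hsm v v.2⟩ : smoothVectors (n := n) u)
    have h2 : HasDerivAt (fun t : ℝ => (P (lieExp (t • X k))).restrictScalars ℝ)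
        ((T k).restrictScalars ℝ) 0 :=
      (ContinuousLinearMap.restrictScalarsL ℂ K K ℝ ℝ).hasFDerivAt.comp_hasDerivAt (0 : ℝ) (hT k)
    have h3 := h2.clm_apply (hasDerivAt_partialRep (X k) v)
    refine h1.unique ?_
    simp only [ContinuousLinearMap.coe_restrictScalars', zero_smul, lieExp_zero, map_one] at h3
    simp only [← hPu]
    exact h3
  set D := diracCore u X F with hD
  have hcore : ∀ p ∈ D.graph, (boundedTensor (P 1) 1 p.1,
      boundedTensor (P 1) 1 p.2 + (∑ k, boundedTensor (T k) (F k)) p.1) ∈ D.graph := by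
    rintro p hp
    rw [LinearPMap.mem_graph_iff] at hp
    obtain ⟨η, h1, h2⟩ := hp
    rw [← h1, ← h2]
    have hmem : boundedTensor (P 1) 1 (η : TensorSpin K r) ∈ D.domain := fun a => by
      rw [boundedTensor_one_apply]; exact hsm _ (η.2 a)
    rw [LinearPMap.mem_graph_iff]
    refine ⟨⟨_, hmem⟩, rfl, ?_⟩
    ext a
    have hsum : ((∑ k, boundedTensor (T k) (F k)) (η : TensorSpin K r)) a =
        ∑ k, ∑ b, F k a b • T k ((η : TensorSpin K r) b) := by
      rw [sum_apply]
      have h3 : ∀ f : Fin n → TensorSpin K r, (∑ k, f k) a = ∑ k, f k a := fun f =>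
        map_sum (PiLp.proj (𝕜 := ℂ) 2 (fun _ : Fin r => K) a) f Finset.univ
      rw [h3]
      simp only [boundedTensor_apply]
    rw [PiLp.add_apply, hsum, boundedTensor_one_apply, diracCore_apply, diracCore_apply, map_sum,
      ← Finset.sum_add_distrib]
    refine Finset.sum_congr rfl fun k _ => ?_
    rw [map_sum, ← Finset.sum_add_distrib]
    refine Finset.sum_congr rfl fun b _ => ?_
    rw [map_smul, ← smul_add, add_comm]
    refine congrArg (fun v => F k a b • v) (Eq.trans ?_ (hder k ⟨(η : TensorSpin K r) b, η.2 b⟩))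
    exact congrArg (partialRep u (X k)) (Subtype.ext (boundedTensor_one_apply _ _ b))
  have hgr := hcl.graph_closure_eq_closure_graph
  have hclos : ∀ p ∈ D.closure.graph, (boundedTensor (P 1) 1 p.1,
      boundedTensor (P 1) 1 p.2 + (∑ k, boundedTensor (T k) (F k)) p.1) ∈ D.closure.graph := by
    intro p hp
    rw [← hgr] at hp ⊢
    refine map_mem_closure (f := fun p : TensorSpin K r × TensorSpin K r =>
      (boundedTensor (P 1) 1 p.1, boundedTensor (P 1) 1 p.2 +
        (∑ k, boundedTensor (T k) (F k)) p.1)) ?_ hp hcore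
    fun_prop
  intro η
  have h1 := hclos _ (D.closure.mem_graph η)
  rw [LinearPMap.mem_graph_iff] at h1
  obtain ⟨ζ, h2, h3⟩ := h1
  dsimp only at h2 h3
  have hm : boundedTensor (P 1) 1 (η : TensorSpin K r) ∈ D.closure.domain := h2 ▸ ζ.2
  have h4 : ζ = ⟨_, hm⟩ := Subtype.ext h2
  refine ⟨hm, ?_⟩
  rw [← h4, h3]
  abel

end DiracCore

/-! ### Schur orthogonality relations -/

section SchurOrthogonality

variable {G : Type*} [Group G]

theorem matrixRep_apply {d : ℕ} (ρ : G →* Matrix.unitaryGroup (Fin d) ℂ) (g : G) :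
    matrixRep ρ g = Matrix.toLin' (ρ g : Matrix (Fin d) (Fin d) ℂ) := rfl

variable [TopologicalSpace G] {ι : Type*} (R : IrrepSystem G ι)

theorem IrrepSystem.continuous_entry (σ : ι) (i j : Fin (R.dim σ)) :
    Continuous fun g => (R.rep σ g : Matrix (Fin (R.dim σ)) (Fin (R.dim σ)) ℂ) i j :=
  (continuous_subtype_val.comp (R.continuous_rep σ)).matrix_elem i j

variable [MeasurableSpace G] (ν : MeasureTheory.Measure G)

/-- The matrix `∫ ρ(h)^* E_{jl} τ(h) dh`, whose entries are the `L²`-inner products of matrix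
coefficients of `ρ` and `τ`. -/
def IrrepSystem.averagedUnit (ρ τ : ι) (j : Fin (R.dim ρ)) (l : Fin (R.dim τ)) :
    Matrix (Fin (R.dim ρ)) (Fin (R.dim τ)) ℂ :=
  Matrix.of fun a c => ∫ h, star ((R.rep ρ h : Matrix (Fin (R.dim ρ)) (Fin (R.dim ρ)) ℂ) j a) *
    (R.rep τ h : Matrix (Fin (R.dim τ)) (Fin (R.dim τ)) ℂ) l c ∂ν

variable {A : Type*} [CStarAlgebra A] (α : CStarDynamicalSystem G A)

/-- The matrix coefficients of `j_α(1)` in the Peter–Weyl basis are `L²`-inner products of matrix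
coefficients. -/
theorem IsometryFamily.jEntry_one (ρ : ι) (a j : Fin (R.dim ρ)) (τ : ι) (c l : Fin (R.dim τ)) :
    jEntry ν α R 1 ρ a j τ c l =
      ((Real.sqrt (R.dim ρ) * Real.sqrt (R.dim τ) : ℂ) * R.averagedUnit ν ρ τ j l a c) •
        (1 : A) := by
  unfold jEntry
  simp only [map_one]
  rw [integral_smul_const]
  congr 1
  simp only [IrrepSystem.averagedUnit, Matrix.of_apply]
  rw [← MeasureTheory.integral_const_mul]
  congr 1
  ext h
  simp only [peterWeyl, star_mul', Complex.star_def, Complex.conj_ofReal]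
  ring

variable [CompactSpace G] [BorelSpace G] [ν.IsHaarMeasure]

theorem IrrepSystem.integrable_star_entry_mul_entry (ρ τ : ι) (j a : Fin (R.dim ρ))
    (l c : Fin (R.dim τ)) :
    MeasureTheory.Integrable (fun h =>
      star ((R.rep ρ h : Matrix (Fin (R.dim ρ)) (Fin (R.dim ρ)) ℂ) j a) *
        (R.rep τ h : Matrix (Fin (R.dim τ)) (Fin (R.dim τ)) ℂ) l c) ν :=
  integrable_of_continuous_compact
    ((R.continuous_entry ρ j a).star.mul (R.continuous_entry τ l c)) ν

variable [IsTopologicalGroup G]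

namespace IrrepSystem

/-- Right invariance of Haar measure makes the averaged matrix unit an intertwiner. -/
theorem averagedUnit_mul_rep (ρ τ : ι) (j : Fin (R.dim ρ)) (l : Fin (R.dim τ)) (g : G) :
    R.averagedUnit ν ρ τ j l * (R.rep τ g : Matrix (Fin (R.dim τ)) (Fin (R.dim τ)) ℂ) =
      (R.rep ρ g : Matrix (Fin (R.dim ρ)) (Fin (R.dim ρ)) ℂ) * R.averagedUnit ν ρ τ j l := by
  have := isMulRightInvariant_of_compact ν
  ext a c
  simp only [Matrix.mul_apply, averagedUnit, Matrix.of_apply]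
  simp only [← MeasureTheory.integral_mul_const, ← MeasureTheory.integral_const_mul]
  rw [← MeasureTheory.integral_finsetSum _
      fun b _ => (R.integrable_star_entry_mul_entry ν ρ τ j a l b).mul_const _,
    ← MeasureTheory.integral_finsetSum _
      fun b _ => (R.integrable_star_entry_mul_entry ν ρ τ j b l c).const_mul _,
    ← MeasureTheory.integral_mul_right_eq_self (fun h => ∑ b,
      (R.rep ρ g : Matrix (Fin (R.dim ρ)) (Fin (R.dim ρ)) ℂ) a b *
        (star ((R.rep ρ h : Matrix (Fin (R.dim ρ)) (Fin (R.dim ρ)) ℂ) j b) *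
          (R.rep τ h : Matrix (Fin (R.dim τ)) (Fin (R.dim τ)) ℂ) l c)) g]
  congr 1
  ext h
  have h1 : (R.rep ρ h : Matrix (Fin (R.dim ρ)) (Fin (R.dim ρ)) ℂ) =
      (R.rep ρ (h * g) : Matrix (Fin (R.dim ρ)) (Fin (R.dim ρ)) ℂ) *
        star (R.rep ρ g : Matrix (Fin (R.dim ρ)) (Fin (R.dim ρ)) ℂ) := by
    rw [map_mul, Submonoid.coe_mul, mul_assoc, Matrix.mem_unitaryGroup_iff.1 (R.rep ρ g).2,
      mul_one]
  have h2 : (R.rep τ (h * g) : Matrix (Fin (R.dim τ)) (Fin (R.dim τ)) ℂ) l c =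
      ∑ b, (R.rep τ h : Matrix (Fin (R.dim τ)) (Fin (R.dim τ)) ℂ) l b *
        (R.rep τ g : Matrix (Fin (R.dim τ)) (Fin (R.dim τ)) ℂ) b c := by
    rw [map_mul, Submonoid.coe_mul, Matrix.mul_apply]
  have h3 := congrArg star (congrFun (congrFun h1 j) a)
  rw [Matrix.mul_apply, star_sum] at h3
  simp only [mul_assoc]
  rw [← Finset.mul_sum, ← h2, h3, Finset.sum_mul]
  refine Finset.sum_congr rfl fun b _ => ?_
  rw [Matrix.star_apply, star_mul', star_star]
  ring

/-- The averaged matrix unit as an intertwiner. -/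
def averagedIntertwiner (ρ τ : ι) (j : Fin (R.dim ρ)) (l : Fin (R.dim τ)) :
    (matrixRep (R.rep τ)).IntertwiningMap (matrixRep (R.rep ρ)) where
  toLinearMap := Matrix.toLin' (R.averagedUnit ν ρ τ j l)
  isIntertwining' g := by
    rw [matrixRep_apply, matrixRep_apply, ← Matrix.toLin'_mul, ← Matrix.toLin'_mul,
      averagedUnit_mul_rep]

/-- Orthogonality of the matrix coefficients of inequivalent irreducible representations. -/
theorem averagedUnit_of_ne {ρ τ : ι} (hne : ρ ≠ τ) (j : Fin (R.dim ρ)) (l : Fin (R.dim τ)) :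
    R.averagedUnit ν ρ τ j l = 0 := by
  have := R.irreducible ρ
  have := R.irreducible τ
  rcases Representation.IsIrreducible.bijective_or_eq_zero (R.averagedIntertwiner ν ρ τ j l) with
    h | h
  · exact absurd (R.inequivalent τ ρ ⟨Representation.IntertwiningMap.ofBijective _ h⟩).symm hne
  · have h1 := congrArg Representation.IntertwiningMap.toLinearMap h
    exact Matrix.toLin'.injective (h1.trans (map_zero _).symm)

/-- Orthogonality of the matrix coefficients of one irreducible representation. -/
theorem averagedUnit_self [MeasureTheory.IsProbabilityMeasure ν] (ρ : ι) (j l : Fin (R.dim ρ)) :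
    (R.dim ρ : ℂ) • R.averagedUnit ν ρ ρ j l = (if j = l then 1 else 0 : ℂ) • 1 := by
  have := R.irreducible ρ
  obtain ⟨c, hc⟩ :=
    (Representation.IsIrreducible.algebraMap_intertwiningMap_bijective_of_isAlgClosed
      (ρ := matrixRep (R.rep ρ))).2 (R.averagedIntertwiner ν ρ ρ j l)
  have h1 : R.averagedUnit ν ρ ρ j l = c • 1 := by
    have h2 := congrArg Representation.IntertwiningMap.toLinearMap hc
    apply Matrix.toLin'.injective
    refine h2.symm.trans ?_
    rw [map_smul, Matrix.toLin'_one]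
    rfl
  have h2 : (R.averagedUnit ν ρ ρ j l).trace = if j = l then 1 else 0 := by
    simp only [Matrix.trace, Matrix.diag, averagedUnit, Matrix.of_apply]
    rw [← MeasureTheory.integral_finsetSum _
      fun b _ => R.integrable_star_entry_mul_entry ν ρ ρ j b l b]
    have h3 : ∀ h, ∑ b, star ((R.rep ρ h : Matrix (Fin (R.dim ρ)) (Fin (R.dim ρ)) ℂ) j b) *
        (R.rep ρ h : Matrix (Fin (R.dim ρ)) (Fin (R.dim ρ)) ℂ) l b = if j = l then 1 else 0 := by
      intro h
      have h4 := congrFun (congrFun (Matrix.mem_unitaryGroup_iff.1 (R.rep ρ h).2) l) j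
      rw [Matrix.mul_apply, Matrix.one_apply] at h4
      simp only [Matrix.star_apply] at h4
      simp only [mul_comm (star _)]
      rw [h4]
      simp only [eq_comm]
    rw [MeasureTheory.integral_congr_ae (Filter.Eventually.of_forall h3)]
    simp
  -- The averaged matrix is a scalar by Schur's lemma, and its trace determines the scalar.
  rw [h1, Matrix.trace_smul, Matrix.trace_one, Fintype.card_fin, smul_eq_mul] at h2
  rw [h1, smul_smul, mul_comm, h2]

end IrrepSystem

namespace IsometryFamily

variable {R α} (S : IsometryFamily α R)

theorem piEntry_one_of_ne {ρ τ : ι} (hne : ρ ≠ τ) (i : Fin (S.mult ρ)) (j : Fin (R.dim ρ))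
    (k : Fin (S.mult τ)) (l : Fin (R.dim τ)) : S.piEntry ν 1 ρ i j τ k l = 0 := by
  apply Subtype.ext
  change S.piEntryAux ν 1 ρ i j τ k l = 0
  simp [piEntryAux, jEntry_one, R.averagedUnit_of_ne ν hne]

theorem piEntry_one_self [MeasureTheory.IsProbabilityMeasure ν] (ρ : ι) (i : Fin (S.mult ρ))
    (j : Fin (R.dim ρ)) (k : Fin (S.mult ρ)) (l : Fin (R.dim ρ)) :
    S.piEntry ν 1 ρ i j ρ k l = if j = l then S.projEntry ρ i k else 0 := by
  have h1 : ∀ a c, jEntry ν α R 1 ρ a j ρ c l = if j = l then if a = c then 1 else 0 else 0 := by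
    intro a c
    have h2 : (Real.sqrt (R.dim ρ) * Real.sqrt (R.dim ρ) : ℂ) = R.dim ρ := by
      rw [← Complex.ofReal_mul, Real.mul_self_sqrt (Nat.cast_nonneg _), Complex.ofReal_natCast]
    have h3 := congrFun (congrFun (R.averagedUnit_self ν ρ j l) a) c
    rw [Matrix.smul_apply, Matrix.smul_apply, smul_eq_mul, smul_eq_mul] at h3
    rw [jEntry_one, h2, h3, Matrix.one_apply]
    split_ifs <;> simp
  apply Subtype.ext
  change S.piEntryAux ν 1 ρ i j ρ k l = _
  unfold piEntryAux
  simp only [h1]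
  split_ifs with hjl
  · change _ = (S.s ρ * (S.s ρ).conjTranspose) i k
    simp [Matrix.mul_apply]
  · simp

/-- `p (s j_α(x) s^*) = s j_α(x) s^*`. -/
theorem sum_projEntry_mul_piEntry (x : A) (ρ : ι) (i : Fin (S.mult ρ)) (j : Fin (R.dim ρ))
    (τ : ι) (k : Fin (S.mult τ)) (l : Fin (R.dim τ)) :
    ∑ i', S.projEntry ρ i i' * S.piEntry ν x ρ i' j τ k l = S.piEntry ν x ρ i j τ k l := by
  have h1 : S.s ρ * (S.s ρ).conjTranspose * S.s ρ = S.s ρ := by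
    rw [Matrix.mul_assoc, S.isometry, Matrix.mul_one]
  apply Subtype.ext
  rw [AddSubmonoidClass.coe_finsetSum]
  change ∑ i', (S.s ρ * (S.s ρ).conjTranspose) i i' * S.piEntryAux ν x ρ i' j τ k l =
    S.piEntryAux ν x ρ i j τ k l
  unfold piEntryAux
  simp only [Finset.mul_sum]
  rw [Finset.sum_comm]
  refine Finset.sum_congr rfl fun a _ => ?_
  rw [Finset.sum_comm]
  refine Finset.sum_congr rfl fun c _ => ?_
  have h2 := congrFun (congrFun h1 i) a
  rw [Matrix.mul_apply] at h2
  simp only [← mul_assoc]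
  rw [← Finset.sum_mul, ← Finset.sum_mul, h2]

end IsometryFamily

end SchurOrthogonality

/-! ### Complete positivity of the conditional expectation -/

section AveragePositivity

/-- A positive element of a C*-algebra is of the form `c^* c` with `c` fixed by all endomorphisms
that fix the element. -/
theorem exists_star_mul_self_eq_and_fixed {M : Type*} [CStarAlgebra M] [PartialOrder M]
    [StarOrderedRing M] {m : M} (hm : 0 ≤ m) :
    ∃ c : M, star c * c = m ∧ ∀ φ : M →⋆ₙₐ[ℂ] M, φ m = m → φ c = c := by
  have hcc : CFC.sqrt m * CFC.sqrt m = m := CFC.sqrt_mul_sqrt_self m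
  refine ⟨CFC.sqrt m, ?_, fun φ hφ => ?_⟩
  · rw [(IsSelfAdjoint.of_nonneg (CFC.sqrt_nonneg m)).star_eq, hcc]
  · exact (CFC.sqrt_unique (by rw [← map_mul, hcc, hφ])
      (map_nonneg φ (CFC.sqrt_nonneg m))).symm

variable {G : Type*} [Group G] [TopologicalSpace G] [IsTopologicalGroup G] {A : Type*}
  [CStarAlgebra A] (α : CStarDynamicalSystem G A)

namespace CStarDynamicalSystem

theorem continuous_act_inv (x : A) : Continuous fun h => α.act h⁻¹ x :=
  α.continuous_act.comp (continuous_inv.prodMk continuous_const)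

variable [CompactSpace G] [MeasurableSpace G] [BorelSpace G] (ν : MeasureTheory.Measure G)
  [ν.IsHaarMeasure]

theorem integrable_act_inv (x : A) : MeasureTheory.Integrable (fun h => α.act h⁻¹ x) ν :=
  integrable_of_continuous_compact (α.continuous_act_inv x) ν

/-- The conditional expectation `x ↦ ∫ α_{h⁻¹}(x) dh` of `A` onto the fixed point algebra. -/
def average : A →ₗ[ℂ] α.fixedAlgebra where
  toFun x := ⟨∫ h, α.act h⁻¹ x ∂ν, fun g => by
    have hc : Continuous (α.act g : A → A) :=
      α.continuous_act.comp (continuous_const.prodMk continuous_id)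
    let L : A →L[ℂ] A := ⟨(α.act g : A →ₗ[ℂ] A), hc⟩
    have h1 := L.integral_comp_comm (α.integrable_act_inv ν x)
    have h2 : ∀ h, L (α.act h⁻¹ x) = α.act (h * g⁻¹)⁻¹ x := fun h => by
      have : (h * g⁻¹)⁻¹ = g * h⁻¹ := by group
      rw [this, map_mul]; rfl
    simp only [h2] at h1
    have := isMulRightInvariant_of_compact ν
    rw [MeasureTheory.integral_mul_right_eq_self (fun h => α.act h⁻¹ x) g⁻¹] at h1
    exact h1.symm⟩
  map_add' x y := Subtype.ext (by
    change ∫ h, α.act h⁻¹ (x + y) ∂ν = ∫ h, α.act h⁻¹ x ∂ν + ∫ h, α.act h⁻¹ y ∂ν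
    simp only [map_add]
    exact MeasureTheory.integral_add (α.integrable_act_inv ν x) (α.integrable_act_inv ν y))
  map_smul' c x := Subtype.ext (by
    change ∫ h, α.act h⁻¹ (c • x) ∂ν = c • ∫ h, α.act h⁻¹ x ∂ν
    simp only [map_smul]
    exact MeasureTheory.integral_smul c _)

theorem coe_average (x : A) : (α.average ν x : A) = ∫ h, α.act h⁻¹ x ∂ν := rfl

/-- The conditional expectation is completely positive: the matrix with entries `E(a_p^* a_q)` is
of the form `c^* c` for a matrix `c` over the fixed point algebra. It is an average of the positive
matrices `(α_h(a_p)^* α_h(a_q))`, and its positive square root is fixed by `α`, because it is unique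
and the matrix itself is fixed. -/
theorem exists_average_star_mul_eq [MeasureTheory.IsProbabilityMeasure ν] {J : Type*} [Fintype J]
    (a : J → A) : ∃ c : J → J → α.fixedAlgebra,
      ∀ p q, α.average ν (star (a p) * a q) = ∑ k, star (c k p) * c k q := by
  classical
  let _ : PartialOrder A := CStarAlgebra.spectralOrder A
  have : StarOrderedRing A := CStarAlgebra.spectralOrderedRing A
  let m : CStarMatrix J J A := fun p q => (α.average ν (star (a p) * a q) : A)
  let f : G → CStarMatrix J J A := fun h p q => α.act h⁻¹ (star (a p) * a q)
  have hf : Continuous f := by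
    have h1 : Continuous fun h => (Matrix.of fun p q => α.act h⁻¹ (star (a p) * a q) :
        Matrix J J A) :=
      continuous_matrix fun p q => α.continuous_act_inv _
    exact (CStarMatrix.ofMatrixL (A := A) (m := J) (n := J)).continuous.comp h1
  have hfi : MeasureTheory.Integrable f ν := integrable_of_continuous_compact hf ν
  have hfm : ∫ h, f h ∂ν = m := by
    ext p q
    let e : CStarMatrix J J A →L[ℂ] A :=
      ⟨{ toFun := fun M => M p q, map_add' := fun _ _ => rfl, map_smul' := fun _ _ => rfl },
        (continuous_id.matrix_elem p q).comp
          (CStarMatrix.ofMatrixL (A := A) (m := J) (n := J)).symm.continuous⟩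
    exact (e.integral_comp_comm hfi).symm
  have hpos : ∀ h, 0 ≤ f h := fun h => by
    -- `f h = b^* b` for the matrix `b` whose only non-zero row is `(α_{h⁻¹}(a_q))_q`.
    rcases isEmpty_or_nonempty J with hJ | ⟨⟨i₀⟩⟩
    · exact le_of_eq (CStarMatrix.ext fun p => hJ.elim p)
    · let b : CStarMatrix J J A := fun i q => if i = i₀ then α.act h⁻¹ (a q) else 0
      have h1 : f h = star b * b := by
        ext p q
        rw [CStarMatrix.mul_apply]
        have h2 : ∀ i, star b p i = star (b i p) := fun i => rfl
        simp only [h2]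
        simp [f, b, apply_ite star, -map_inv, map_star]
      rw [h1]
      exact star_mul_self_nonneg b
  have hm : 0 ≤ m := by
    rw [← hfm]
    exact Convex.integral_mem (convex_Ici (0 : CStarMatrix J J A)) isClosed_Ici
      (Filter.Eventually.of_forall hpos) hfi
  obtain ⟨c, hcm, hc⟩ := exists_star_mul_self_eq_and_fixed hm
  have hfix : ∀ g p q, α.act g (c p q) = c p q := fun g p q => by
    -- The entrywise action of `g` on matrices fixes `m`, hence its square root.
    let φ : CStarMatrix J J A →⋆ₙₐ[ℂ] CStarMatrix J J A :=
      CStarMatrix.mapₙₐ ((α.act g : A →⋆ₐ[ℂ] A) : A →⋆ₙₐ[ℂ] A)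
    have hφm : φ m = m := by
      ext p q
      exact (α.average ν (star (a p) * a q)).2 g
    exact congrFun (congrFun (hc φ hφm) p) q
  refine ⟨fun k p => ⟨c k p, fun g => hfix g k p⟩, fun p q => Subtype.ext ?_⟩
  have h2 := congrFun (congrFun hcm.symm p) q
  rw [CStarMatrix.mul_apply] at h2
  rw [AddSubmonoidClass.coe_finsetSum]
  exact h2

/-- Complete positivity of the conditional expectation, evaluated on vectors. -/
theorem exists_inner_average_eq [MeasureTheory.IsProbabilityMeasure ν] {HB : Type*}
    [NormedAddCommGroup HB] [InnerProductSpace ℂ HB] [CompleteSpace HB]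
    (πB : α.fixedAlgebra →⋆ₐ[ℂ] (HB →L[ℂ] HB)) {J : Type*} [Fintype J] (a : J → A) (ξ : J → HB) :
    ∃ t : ℝ, 0 ≤ t ∧
      ∑ p, ∑ q, inner ℂ (ξ p) (πB (α.average ν (star (a p) * a q)) (ξ q)) = (t : ℂ) := by
  obtain ⟨c, hc⟩ := α.exists_average_star_mul_eq ν a
  refine ⟨∑ k, ‖∑ p, πB (c k p) (ξ p)‖ ^ 2, by positivity, ?_⟩
  have h1 : ∀ p q, inner ℂ (ξ p) (πB (α.average ν (star (a p) * a q)) (ξ q)) =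
      ∑ k, inner ℂ (πB (c k p) (ξ p)) (πB (c k q) (ξ q)) := fun p q => by
    rw [hc, map_sum, sum_apply, inner_sum]
    refine Finset.sum_congr rfl fun k _ => ?_
    rw [map_mul, map_star, ContinuousLinearMap.star_eq_adjoint, mul_apply_eq_comp,
      ContinuousLinearMap.adjoint_inner_right]
  simp only [h1]
  rw [Complex.ofReal_sum, Finset.sum_congr rfl fun p _ => Finset.sum_comm, Finset.sum_comm]
  refine Finset.sum_congr rfl fun k _ => ?_
  have h2 := inner_self_eq_norm_sq_to_K (𝕜 := ℂ) (∑ p, πB (c k p) (ξ p))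
  rw [sum_inner] at h2
  simp only [inner_sum] at h2
  rw [h2, Complex.ofReal_pow]
  rfl

end CStarDynamicalSystem

end AveragePositivity

/-! ### Bounded sesquilinear forms -/

section SesquilinearForms

variable {E : Type*} [NormedAddCommGroup E] [InnerProductSpace ℂ E]

/-- Polarization: a bound for the quadratic form of a sesquilinear form bounds the form. -/
theorem norm_sesquilinear_le_of_quadratic (B : E →ₗ⋆[ℂ] E →ₗ[ℂ] ℂ) {c : ℝ}
    (h : ∀ v, ‖B v v‖ ≤ c * ‖v‖ ^ 2) (w v : E) : ‖B w v‖ ≤ 2 * c * ‖w‖ * ‖v‖ := by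
  -- The polarization identity and the parallelogram law; the claim follows by scaling `w` and `v`
  -- to unit length.
  have h1 : ∀ w v, ‖B w v‖ ≤ c * (‖w‖ ^ 2 + ‖v‖ ^ 2) := fun w v => by
    have hp : ∀ z : E, ‖w + z‖ ^ 2 + ‖w - z‖ ^ 2 = 2 * (‖w‖ ^ 2 + ‖z‖ ^ 2) := fun z => by
      have := parallelogram_law_with_norm ℂ w z
      nlinarith
    have e1 : 4 * B w v = B (w + v) (w + v) - B (w - v) (w - v) -
        Complex.I * (B (w + Complex.I • v) (w + Complex.I • v) -
          B (w - Complex.I • v) (w - Complex.I • v)) := by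
      simp only [map_add, map_sub, LinearMap.add_apply, LinearMap.sub_apply, map_smulₛₗ,
        LinearMap.smul_apply, smul_eq_mul, Complex.conj_I, RingHom.id_apply]
      linear_combination (2 * B w v - 2 * B v w) * Complex.I_sq
    have e2 : ‖4 * B w v‖ = 4 * ‖B w v‖ := by simp
    have n1 := hp v
    have n2 := hp (Complex.I • v)
    rw [norm_smul, Complex.norm_I, one_mul] at n2
    have n3 := norm_sub_le (B (w + v) (w + v) - B (w - v) (w - v))
      (Complex.I * (B (w + Complex.I • v) (w + Complex.I • v) -
          B (w - Complex.I • v) (w - Complex.I • v)))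
    rw [← e1, e2, norm_mul, Complex.norm_I, one_mul] at n3
    have n4 := norm_sub_le (B (w + v) (w + v)) (B (w - v) (w - v))
    have n5 := norm_sub_le (B (w + Complex.I • v) (w + Complex.I • v))
      (B (w - Complex.I • v) (w - Complex.I • v))
    have m1 := h (w + v)
    have m2 := h (w - v)
    have m3 := h (w + Complex.I • v)
    have m4 := h (w - Complex.I • v)
    have n1' := congrArg (c * ·) n1
    have n2' := congrArg (c * ·) n2
    simp only [mul_add] at n1' n2'
    linarith
  rcases eq_or_ne w 0 with rfl | hw
  · simp
  rcases eq_or_ne v 0 with rfl | hv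
  · simp
  have hw' : 0 < ‖w‖ := norm_pos_iff.2 hw
  have hv' : 0 < ‖v‖ := norm_pos_iff.2 hv
  have h2 := h1 (((‖w‖⁻¹ : ℝ) : ℂ) • w) (((‖v‖⁻¹ : ℝ) : ℂ) • v)
  simp only [map_smulₛₗ, LinearMap.smul_apply, norm_smul, Complex.norm_real, norm_inv, norm_norm,
    RingHom.id_apply, RCLike.norm_conj] at h2
  rw [inv_mul_cancel₀ hw'.ne', inv_mul_cancel₀ hv'.ne'] at h2
  have h3 : ‖B w v‖ = ‖w‖ * ‖v‖ * (‖w‖⁻¹ * (‖v‖⁻¹ * ‖B w v‖)) := by field_simp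
  rw [h3]
  have h4 := mul_le_mul_of_nonneg_left h2 (mul_pos hw' hv').le
  nlinarith

/-- A net of uniformly bounded sesquilinear forms has a bounded operator as a limit point: along an
ultrafilter finer than `l` the forms converge pointwise to the form of the operator. -/
theorem exists_clm_tendsto_of_bounded [CompleteSpace E] {κ : Type*} (l : Filter κ) [l.NeBot]
    (B : κ → E →ₗ⋆[ℂ] E →ₗ[ℂ] ℂ) {C : ℝ} (hB : ∀ s w v, ‖B s w v‖ ≤ C * ‖w‖ * ‖v‖) :
    ∃ T : E →L[ℂ] E, (∀ v, ‖T v‖ ≤ C * ‖v‖) ∧ ∃ l' : Ultrafilter κ, (l' : Filter κ) ≤ l ∧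
      ∀ w v, Filter.Tendsto (fun s => B s w v) l' (nhds (inner ℂ w (T v))) := by
  let l' : Ultrafilter κ := Ultrafilter.of l
  have hlim : ∀ w v, ∃ z, Filter.Tendsto (fun s => B s w v) l' (nhds z) := fun w v => by
    have hc := isCompact_closedBall (0 : ℂ) (C * ‖w‖ * ‖v‖)
    -- The values stay in a closed disc, which is compact, so they converge along an ultrafilter.
    obtain ⟨z, -, hz⟩ := hc.ultrafilter_le_nhds (l'.map fun s => B s w v) (by
      rw [Filter.le_principal_iff]
      exact Filter.mem_map.2 (Filter.univ_mem' fun s => by simpa using hB s w v))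
    exact ⟨z, hz⟩
  choose L hL using hlim
  have hLb : ∀ w v, ‖L w v‖ ≤ C * ‖w‖ * ‖v‖ := fun w v =>
    le_of_tendsto (hL w v).norm (Filter.Eventually.of_forall fun s => hB s w v)
  let Φ : E →ₗ⋆[ℂ] E →ₗ[ℂ] ℂ := LinearMap.mk₂'ₛₗ (starRingEnd ℂ) (RingHom.id ℂ) L
    (fun w w' v => tendsto_nhds_unique (hL (w + w') v) (by
      simpa using (hL w v).add (hL w' v)))
    (fun c w v => tendsto_nhds_unique (hL (c • w) v) (by
      simpa using (hL w v).const_mul (starRingEnd ℂ c)))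
    (fun w v v' => tendsto_nhds_unique (hL w (v + v')) (by
      simpa using (hL w v).add (hL w v')))
    (fun c w v => tendsto_nhds_unique (hL w (c • v)) (by
      simpa using (hL w v).const_mul c))
  let Ψ : E →L⋆[ℂ] E →L[ℂ] ℂ := Φ.mkContinuous₂ C hLb
  let T := (InnerProductSpace.continuousLinearMapOfBilin Ψ).adjoint
  have hT : ∀ w v, inner ℂ w (T v) = L w v := fun w v => by
    rw [ContinuousLinearMap.adjoint_inner_right,
      InnerProductSpace.continuousLinearMapOfBilin_apply]
    rfl
  refine ⟨T, fun v => ?_, l', Ultrafilter.of_le l, fun w v => by rw [hT]; exact hL w v⟩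
  have h1 := hLb (T v) v
  rw [← hT, inner_self_eq_norm_sq_to_K, norm_pow, RCLike.norm_ofReal,
    abs_norm] at h1
  rcases (norm_nonneg (T v)).eq_or_lt' with h0 | h0
  · rcases eq_or_ne v 0 with rfl | hv
    · simp
    · have h2 := (norm_nonneg _).trans (hLb v v)
      rw [h0]
      exact nonneg_of_mul_nonneg_left h2 (norm_pos_iff.2 hv)
  · nlinarith

end SesquilinearForms

/-! ### Positive functionals from the conditional expectation -/

section AveragedForm

variable {G : Type*} [Group G] [TopologicalSpace G] [IsTopologicalGroup G] [CompactSpace G]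
  [MeasurableSpace G] [BorelSpace G] (ν : MeasureTheory.Measure G) [ν.IsHaarMeasure]
  {A : Type*} [CStarAlgebra A] (α : CStarDynamicalSystem G A)
  {HB : Type*} [NormedAddCommGroup HB] [InnerProductSpace ℂ HB]
  [CompleteSpace HB] (πB : α.fixedAlgebra →⋆ₐ[ℂ] (HB →L[ℂ] HB)) {J : Type*} [Fintype J]

namespace CStarDynamicalSystem

/-- The quadratic form `Σ ⟨ξ_p, π_B(E(t_p^* x t_q)) ξ_q⟩`, linear in `x`. -/
def averagedForm (t : J → A) (ξ : J → HB) : A →ₗ[ℂ] ℂ where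
  toFun x := ∑ p, ∑ q, inner ℂ (ξ p) (πB (α.average ν (star (t p) * x * t q)) (ξ q))
  map_add' x y := by
    simp only [mul_add, add_mul, map_add, add_apply, inner_add_right,
      Finset.sum_add_distrib]
  map_smul' c x := by
    simp only [mul_smul_comm, smul_mul_assoc, map_smul, smul_apply,
      inner_smul_right, RingHom.id_apply, smul_eq_mul, Finset.mul_sum]

variable [MeasureTheory.IsProbabilityMeasure ν]

theorem averagedForm_star_mul_self (t : J → A) (ξ : J → HB) (y : A) :
    ∃ c : ℝ, 0 ≤ c ∧ α.averagedForm ν πB t ξ (star y * y) = c := by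
  obtain ⟨c, hc, h⟩ := α.exists_inner_average_eq ν πB (fun p => y * t p) ξ
  refine ⟨c, hc, ?_⟩
  rw [← h]
  simp only [averagedForm, LinearMap.coe_mk, AddHom.coe_mk, star_mul, mul_assoc]

/-- The form is positive in `x`, so it is bounded by its value at `1`. -/
theorem norm_averagedForm_le (t : J → A) (ξ : J → HB) (x : A) :
    ‖α.averagedForm ν πB t ξ x‖ ≤ 2 * ‖x‖ * ‖α.averagedForm ν πB t ξ 1‖ := by
  let _ : PartialOrder A := CStarAlgebra.spectralOrder A
  have : StarOrderedRing A := CStarAlgebra.spectralOrderedRing A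
  obtain ⟨c, hc, h1⟩ := α.averagedForm_star_mul_self ν πB t ξ 1
  rw [star_one, one_mul] at h1
  have hn1 : ‖α.averagedForm ν πB t ξ 1‖ = c := by
    rw [h1, Complex.norm_real, Real.norm_of_nonneg hc]
  have hpos : ∀ z : A, 0 ≤ z → ∃ d : ℝ, 0 ≤ d ∧ α.averagedForm ν πB t ξ z = d := fun z hz => by
    obtain ⟨y, rfl⟩ := CStarAlgebra.nonneg_iff_eq_star_mul_self.1 hz
    exact α.averagedForm_star_mul_self ν πB t ξ y
  -- For self-adjoint `z` the form is non-negative at `‖z‖ ± z`.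
  have hsa : ∀ z : A, IsSelfAdjoint z → ‖α.averagedForm ν πB t ξ z‖ ≤ ‖z‖ * c := fun z hz => by
    have e : algebraMap ℝ A ‖z‖ = ((‖z‖ : ℝ) : ℂ) • (1 : A) := by
      rw [Algebra.algebraMap_eq_smul_one, Complex.coe_smul]
    obtain ⟨d, hd, h2⟩ := hpos (algebraMap ℝ A ‖z‖ - z)
      (sub_nonneg.2 hz.le_algebraMap_norm_self)
    obtain ⟨d', hd', h3⟩ := hpos (algebraMap ℝ A ‖z‖ + z)
      (by simpa [add_comm] using sub_nonneg.2 hz.neg_algebraMap_norm_le_self)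
    rw [map_sub, e, map_smul, h1, smul_eq_mul] at h2
    rw [map_add, e, map_smul, h1, smul_eq_mul] at h3
    have h4 : α.averagedForm ν πB t ξ z = ((‖z‖ * c - d : ℝ) : ℂ) := by
      push_cast
      linear_combination -h2
    have h5 : ((‖z‖ * c + (‖z‖ * c - d) : ℝ) : ℂ) = d' := by
      rw [← h3, h4]; push_cast; ring
    have h6 : ‖z‖ * c + (‖z‖ * c - d) = d' := by exact_mod_cast h5
    rw [h4, Complex.norm_real, Real.norm_eq_abs, abs_le]
    constructor <;> linarith
  have hx := realPart_add_I_smul_imaginaryPart x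
  rw [← hx, map_add, map_smul, hn1, hx]
  have h2 := hsa _ (realPart x).2
  have h3 := hsa _ (imaginaryPart x).2
  refine (norm_add_le _ _).trans ?_
  rw [norm_smul, Complex.norm_I, one_mul]
  have h4 : ‖(realPart x : A)‖ ≤ ‖x‖ := realPart.norm_le x
  have h5 : ‖(imaginaryPart x : A)‖ ≤ ‖x‖ := imaginaryPart.norm_le x
  nlinarith

end CStarDynamicalSystem

end AveragedForm

/-! ### Matrix coefficients and the existence of `π_A` -/

section CoefficientForm

namespace IsometryFamily

section Algebraic

variable {G : Type*} [Group G] [TopologicalSpace G] {A : Type*} [CStarAlgebra A]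
  {α : CStarDynamicalSystem G A} {ι : Type*} {R : IrrepSystem G ι} (S : IsometryFamily α R)

/-- The elements `√(dim σ) s(σ)_{ij}^*` of `A`; the matrix coefficients of `s j_α(x) s^*` are
averages of products of these. -/
def scaledStar (σ : ι) (p : Fin (S.mult σ) × Fin (R.dim σ)) : A :=
  (Real.sqrt (R.dim σ) : ℂ) • star (S.s σ p.1 p.2)

theorem act_inv_scaledStar (g : G) (ρ : ι) (i : Fin (S.mult ρ)) (j : Fin (R.dim ρ)) :
    α.act g⁻¹ (S.scaledStar ρ (i, j)) =
      ∑ a, (R.rep ρ g : Matrix (Fin (R.dim ρ)) (Fin (R.dim ρ)) ℂ) j a • S.scaledStar ρ (i, a) := by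
  simp only [scaledStar, map_smul, map_star]
  rw [act_inv_s, star_sum, Finset.smul_sum]
  refine Finset.sum_congr rfl fun a _ => ?_
  rw [star_smul, star_star, smul_comm]

variable {HB : Type*} [NormedAddCommGroup HB] [InnerProductSpace ℂ HB]
  [CompleteSpace HB] (πB : α.fixedAlgebra →⋆ₐ[ℂ] (HB →L[ℂ] HB))

open scoped Classical in
/-- The projection `p` is diagonal with respect to the isotypic components. -/
theorem single_mem_hilbertP {τ : ι} {v : S.Block HB τ}
    (hv : ∀ i j, v (i, j) = ∑ k, πB (S.projEntry τ i k) (v (k, j))) :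
    (lp.single 2 τ v : S.TensorH HB) ∈ S.hilbertP πB := by
  intro σ i j
  by_cases h : σ = τ
  · subst h
    simp only [lp.single_apply_self]
    exact hv i j
  · simp only [lp.single_apply_ne 2 τ v h]
    simp

open scoped Classical in
theorem single_coord_mem_hilbertP (ξ : S.hilbertP πB) (τ : ι) :
    (lp.single 2 τ ((ξ : S.TensorH HB) τ) : S.TensorH HB) ∈ S.hilbertP πB :=
  S.single_mem_hilbertP πB (ξ.2 τ)

end Algebraic

variable {G : Type*} [Group G] [TopologicalSpace G] [IsTopologicalGroup G] [CompactSpace G]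
  [MeasurableSpace G] [BorelSpace G] (ν : MeasureTheory.Measure G) [ν.IsHaarMeasure]
  {A : Type*} [CStarAlgebra A] {α : CStarDynamicalSystem G A} {ι : Type*} {R : IrrepSystem G ι}
  (S : IsometryFamily α R) {HB : Type*} [NormedAddCommGroup HB] [InnerProductSpace ℂ HB]
  [CompleteSpace HB] (πB : α.fixedAlgebra →⋆ₐ[ℂ] (HB →L[ℂ] HB))

/-- The factors `s(σ)_{ij}` absorb the matrix coefficients of `σ` under the action of `G`, so the
matrix coefficients of `s j_α(x) s^*` are values of the conditional expectation. -/
theorem piEntry_eq_average (x : A) (ρ : ι) (p : Fin (S.mult ρ) × Fin (R.dim ρ)) (τ : ι)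
    (q : Fin (S.mult τ) × Fin (R.dim τ)) :
    S.piEntry ν x ρ p.1 p.2 τ q.1 q.2 =
      α.average ν (star (S.scaledStar ρ p) * x * S.scaledStar τ q) := by
  apply Subtype.ext
  change S.piEntryAux ν x ρ p.1 p.2 τ q.1 q.2 = _
  have h1 : star (S.scaledStar ρ p) * x * S.scaledStar τ q =
      ((Real.sqrt (R.dim ρ) * Real.sqrt (R.dim τ) : ℝ) : ℂ) •
        (S.s ρ p.1 p.2 * x * star (S.s τ q.1 q.2)) := by
    simp only [scaledStar, star_smul, star_star, Complex.star_def, Complex.conj_ofReal,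
      smul_mul_assoc, mul_smul_comm, smul_smul, Complex.ofReal_mul]
    rw [mul_comm]
  rw [piEntryAux_eq, h1, map_smul]
  rfl

/-- The sesquilinear form on `H_p` given by the finitely many matrix coefficients of `s j_α(x) s^*`
between the isotypic components in `F`. -/
def coeffForm (x : A) (F : Finset ι) : S.hilbertP πB →ₗ⋆[ℂ] S.hilbertP πB →ₗ[ℂ] ℂ :=
  LinearMap.mk₂'ₛₗ (starRingEnd ℂ) (RingHom.id ℂ)
    (fun w v => ∑ ρ ∈ F, ∑ τ ∈ F, ∑ p, ∑ q, inner ℂ ((w : S.TensorH HB) ρ p)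
      (πB (S.piEntry ν x ρ p.1 p.2 τ q.1 q.2) ((v : S.TensorH HB) τ q)))
    (fun w w' v => by
      simp only [Submodule.coe_add, lp.coeFn_add, Pi.add_apply, PiLp.add_apply, inner_add_left,
        Finset.sum_add_distrib])
    (fun c w v => by
      simp only [Submodule.coe_smul, lp.coeFn_smul, Pi.smul_apply, PiLp.smul_apply,
        inner_smul_left, Finset.mul_sum, smul_eq_mul])
    (fun w v v' => by
      simp only [Submodule.coe_add, lp.coeFn_add, Pi.add_apply, PiLp.add_apply, map_add,
        inner_add_right, Finset.sum_add_distrib])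
    (fun c w v => by
      simp only [Submodule.coe_smul, lp.coeFn_smul, Pi.smul_apply, PiLp.smul_apply, map_smul,
        inner_smul_right, Finset.mul_sum, smul_eq_mul, RingHom.id_apply])

theorem coeffForm_apply (x : A) (F : Finset ι) (w v : S.hilbertP πB) :
    S.coeffForm ν πB x F w v = ∑ ρ ∈ F, ∑ τ ∈ F, ∑ p, ∑ q, inner ℂ ((w : S.TensorH HB) ρ p)
      (πB (S.piEntry ν x ρ p.1 p.2 τ q.1 q.2) ((v : S.TensorH HB) τ q)) := rfl

/-- On the diagonal the coefficient form is one of the positive functionals `averagedForm`. -/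
theorem coeffForm_self (x : A) (F : Finset ι) (v : S.hilbertP πB) :
    S.coeffForm ν πB x F v v = α.averagedForm ν πB
      (fun a : Σ σ : F, Fin (S.mult σ) × Fin (R.dim σ) => S.scaledStar a.1 a.2)
      (fun a => (v : S.TensorH HB) a.1 a.2) x := by
  simp only [CStarDynamicalSystem.averagedForm, LinearMap.coe_mk, AddHom.coe_mk,
    ← piEntry_eq_average, Fintype.sum_sigma]
  rw [coeffForm_apply, ← Finset.sum_coe_sort F]
  refine Finset.sum_congr rfl fun ρ _ => ?_
  rw [← Finset.sum_coe_sort F, Finset.sum_comm]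

variable [MeasureTheory.IsProbabilityMeasure ν]

/-- By the Schur orthogonality relations the coefficients of `s j_α(1) s^*` are those of `p`. -/
theorem coeffForm_one (F : Finset ι) (v : S.hilbertP πB) :
    S.coeffForm ν πB 1 F v v = ((∑ ρ ∈ F, ‖(v : S.TensorH HB) ρ‖ ^ 2 : ℝ) : ℂ) := by
  classical
  rw [coeffForm_apply, Complex.ofReal_sum]
  refine Finset.sum_congr rfl fun ρ hρ => ?_
  rw [Finset.sum_eq_single ρ]
  · rw [PiLp.norm_sq_eq_of_L2, Complex.ofReal_sum]
    refine Finset.sum_congr rfl fun p _ => ?_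
    have h1 : ∑ q : Fin (S.mult ρ) × Fin (R.dim ρ),
        πB (S.piEntry ν 1 ρ p.1 p.2 ρ q.1 q.2) ((v : S.TensorH HB) ρ q) =
          (v : S.TensorH HB) ρ p := by
      rw [Fintype.sum_prod_type]
      refine Eq.trans (Finset.sum_congr rfl fun k _ => ?_) (v.2 ρ p.1 p.2).symm
      rw [Finset.sum_eq_single p.2]
      · rw [piEntry_one_self, if_pos rfl]
      · intro l _ hl
        rw [piEntry_one_self, if_neg hl.symm, map_zero, zero_apply]
      · intro h; exact absurd (Finset.mem_univ _) h
    rw [← inner_sum, h1, inner_self_eq_norm_sq_to_K, Complex.ofReal_pow]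
    rfl
  · intro τ _ hτ
    refine Finset.sum_eq_zero fun p _ => Finset.sum_eq_zero fun q _ => ?_
    rw [piEntry_one_of_ne ν S hτ.symm, map_zero, zero_apply, inner_zero_right]
  · intro h; exact absurd hρ h

/-- A bound independent of `F`: one factor `2` comes from polarization, the other from splitting `x`
into real and imaginary parts. -/
theorem norm_coeffForm_le (x : A) (F : Finset ι) (w v : S.hilbertP πB) :
    ‖S.coeffForm ν πB x F w v‖ ≤ 2 * (2 * ‖x‖) * ‖w‖ * ‖v‖ := by
  refine norm_sesquilinear_le_of_quadratic (S.coeffForm ν πB x F) (fun v => ?_) w v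
  rw [coeffForm_self]
  refine (α.norm_averagedForm_le ν πB _ _ x).trans ?_
  rw [← coeffForm_self, coeffForm_one, Complex.norm_real]
  have h1 := lp.sum_rpow_le_norm_rpow (p := 2) (by norm_num) (v : S.TensorH HB) F
  simp only [ENNReal.toReal_ofNat, Real.rpow_ofNat] at h1
  rw [Real.norm_of_nonneg (Finset.sum_nonneg fun _ _ => sq_nonneg _)]
  exact mul_le_mul_of_nonneg_left h1 (by positivity)

/-- Existence of `π_A(x)`: a limit point of the truncated coefficient forms. -/
theorem exists_isPiA (x : A) : ∃ T : S.hilbertP πB →L[ℂ] S.hilbertP πB,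
    S.IsPiA ν πB x T ∧ ∀ v, ‖T v‖ ≤ 2 * (2 * ‖x‖) * ‖v‖ := by
  classical
  obtain ⟨T, hT, l', hl', hlim⟩ := exists_clm_tendsto_of_bounded (E := S.hilbertP πB)
    (Filter.atTop : Filter (Finset ι)) (S.coeffForm ν πB x) (S.norm_coeffForm_le ν πB x)
  refine ⟨T, ?_, hT⟩
  intro τ v hv ρ i j
  set Tv : S.TensorH HB := (T ⟨lp.single 2 τ v, hv⟩ : S.TensorH HB) with hTv
  let col : S.Block HB ρ := WithLp.toLp 2 fun p => ∑ q : Fin (S.mult τ) × Fin (R.dim τ),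
    πB (S.piEntry ν x ρ p.1 p.2 τ q.1 q.2) (v q)
  have hcol : ∀ i j, col (i, j) = ∑ k, πB (S.projEntry ρ i k) (col (k, j)) := fun i j => by
    change ∑ q : Fin (S.mult τ) × Fin (R.dim τ), πB (S.piEntry ν x ρ i j τ q.1 q.2) (v q) =
      ∑ k, πB (S.projEntry ρ i k) (∑ q : Fin (S.mult τ) × Fin (R.dim τ),
        πB (S.piEntry ν x ρ k j τ q.1 q.2) (v q))
    simp only [map_sum]
    rw [Finset.sum_comm]
    refine Finset.sum_congr rfl fun q _ => ?_
    rw [← S.sum_projEntry_mul_piEntry ν x ρ i j τ q.1 q.2, map_sum, sum_apply]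
    refine Finset.sum_congr rfl fun k _ => ?_
    rw [map_mul]
    rfl
  -- The difference `y` of the component of `T v` and the expected value lies in `H_p`. The forms
  -- evaluated at `y` and `v` are eventually constant, so the limit shows that `y` is orthogonal to
  -- itself.
  let y : S.Block HB ρ := Tv ρ - col
  have hy : ∀ i j, y (i, j) = ∑ k, πB (S.projEntry ρ i k) (y (k, j)) := fun i j => by
    simp only [y, PiLp.sub_apply, map_sub, Finset.sum_sub_distrib]
    rw [← hcol i j, ← (T ⟨lp.single 2 τ v, hv⟩).2 ρ i j]
  have hyH := S.single_mem_hilbertP πB hy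
  have h1 := hlim ⟨lp.single 2 ρ y, hyH⟩ ⟨lp.single 2 τ v, hv⟩
  have h2 : ∀ F : Finset ι, {ρ, τ} ≤ F →
      S.coeffForm ν πB x F ⟨lp.single 2 ρ y, hyH⟩ ⟨lp.single 2 τ v, hv⟩ = inner ℂ y col := by
    intro F hF
    have hρ : ρ ∈ F := hF (by simp)
    have hτ : τ ∈ F := hF (by simp)
    rw [coeffForm_apply, Finset.sum_eq_single ρ, Finset.sum_eq_single τ]
    · simp only [lp.single_apply_self]
      rw [PiLp.inner_apply]
      refine Finset.sum_congr rfl fun p _ => ?_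
      rw [← inner_sum]
    · intro σ _ hσ
      simp only [lp.single_apply_ne 2 τ v hσ]
      simp
    · intro h; exact absurd hτ h
    · intro σ _ hσ
      simp only [lp.single_apply_ne 2 ρ y hσ]
      simp
    · intro h; exact absurd hρ h
  have h3 : Filter.Tendsto (fun F => S.coeffForm ν πB x F ⟨lp.single 2 ρ y, hyH⟩
      ⟨lp.single 2 τ v, hv⟩) l' (nhds (inner ℂ y col)) := by
    refine tendsto_const_nhds.congr' ?_
    filter_upwards [hl' (Filter.eventually_ge_atTop ({ρ, τ} : Finset ι))] with F hF
    exact (h2 F hF).symm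
  have h4 := tendsto_nhds_unique h1 h3
  rw [Submodule.coe_inner, lp.inner_single_left] at h4
  have h5 : inner ℂ y y = 0 := by
    change inner ℂ y (Tv ρ - col) = 0
    rw [inner_sub_right, sub_eq_zero]
    exact h4
  have h6 : Tv ρ = col := sub_eq_zero.1 (inner_self_eq_zero.1 h5)
  rw [h6]
  change ∑ q : Fin (S.mult τ) × Fin (R.dim τ), πB (S.piEntry ν x ρ i j τ q.1 q.2) (v q) = _
  rw [Fintype.sum_prod_type]

end IsometryFamily

end CoefficientForm

/-! ### Truncation to finitely many isotypic components -/

section Truncation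

variable {G : Type*} [Group G] [TopologicalSpace G]
  {A : Type*} [CStarAlgebra A] {α : CStarDynamicalSystem G A} {ι : Type*} {R : IrrepSystem G ι}
  (S : IsometryFamily α R) {K : Type*} [NormedAddCommGroup K] [InnerProductSpace ℂ K]

namespace IsometryFamily

open scoped Classical in
/-- The orthogonal projection of `K ⊗ H` onto the sum of the finitely many summands
`K ⊗ H_σ ⊗ \bar V_σ` with `σ ∈ F`. -/
def truncation (K : Type*) [NormedAddCommGroup K] [InnerProductSpace ℂ K] (F : Finset ι) :
    S.TensorH K →L[ℂ] S.TensorH K :=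
  ∑ σ ∈ F, lp.singleContinuousLinearMap ℂ (fun σ => S.Block K σ) 2 σ ∘L
    lp.evalCLM ℂ (fun σ => S.Block K σ) 2 σ

open scoped Classical in
theorem truncation_apply (F : Finset ι) (v : S.TensorH K) :
    S.truncation K F v = ∑ σ ∈ F, lp.single 2 σ (v σ) := by
  rw [truncation, sum_apply]
  rfl

open scoped Classical in
theorem truncation_apply_apply (F : Finset ι) (v : S.TensorH K) (σ : ι) :
    S.truncation K F v σ = if σ ∈ F then v σ else 0 := by
  rw [truncation_apply, lp.coeFn_sum, Finset.sum_apply]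
  split_ifs with h
  · rw [Finset.sum_eq_single σ]
    · exact lp.single_apply_self _ _ _
    · intro τ _ hτ
      exact lp.single_apply_ne _ _ _ hτ.symm
    · intro h'; exact absurd h h'
  · refine Finset.sum_eq_zero fun τ hτ => lp.single_apply_ne _ _ _ ?_
    rintro rfl
    exact h hτ

theorem tendsto_truncation (v : S.TensorH K) :
    Filter.Tendsto (fun F => S.truncation K F v) Filter.atTop (nhds v) := by
  classical
  have h1 := lp.hasSum_single (p := 2) (by norm_num) v
  simp only [HasSum, SummationFilter.unconditional_filter] at h1
  simp only [truncation_apply]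
  convert h1

theorem inner_truncation (F : Finset ι) (v w : S.TensorH K) :
    inner ℂ (S.truncation K F v) w = inner ℂ v (S.truncation K F w) := by
  classical
  simp only [truncation_apply, sum_inner, inner_sum, lp.inner_single_left, lp.inner_single_right]

theorem truncation_oneTensorMu (F : Finset ι) (g : G) (v : S.TensorH K) :
    S.truncation K F (S.oneTensorMu K g v) = S.oneTensorMu K g (S.truncation K F v) := by
  classical
  refine lp.ext (funext fun σ => ?_)
  change _ = conjAction K (S.mult σ) (R.rep σ g) (S.truncation K F v σ)
  rw [truncation_apply_apply, truncation_apply_apply, apply_ite (conjAction K _ _), map_zero]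
  rfl

open scoped Classical in
theorem oneTensorMu_single (g : G) (σ : ι) (v : S.Block K σ) :
    S.oneTensorMu K g (lp.single 2 σ v) =
      lp.single 2 σ (conjAction K (S.mult σ) (R.rep σ g) v) := by
  refine lp.ext (funext fun τ => ?_)
  change conjAction K (S.mult τ) (R.rep τ g) ((lp.single 2 σ v : S.TensorH K) τ) = _
  by_cases h : τ = σ
  · subst h
    rw [lp.single_apply_self, lp.single_apply_self]
  · rw [lp.single_apply_ne _ _ _ h, lp.single_apply_ne _ _ _ h, map_zero]

section HilbertP

variable {HB : Type*} [NormedAddCommGroup HB] [InnerProductSpace ℂ HB]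
  [CompleteSpace HB] (πB : α.fixedAlgebra →⋆ₐ[ℂ] (HB →L[ℂ] HB))

theorem truncation_mem_hilbertP (F : Finset ι) (v : S.hilbertP πB) :
    S.truncation HB F v ∈ S.hilbertP πB := by
  classical
  rw [truncation_apply]
  exact sum_mem fun σ _ => S.single_coord_mem_hilbertP πB v σ

/-- The restriction of the truncation to `H_p`. -/
def truncationP (F : Finset ι) : S.hilbertP πB →L[ℂ] S.hilbertP πB :=
  (S.truncation HB F ∘L (S.hilbertP πB).subtypeL).codRestrict (S.hilbertP πB)
    (S.truncation_mem_hilbertP πB F)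

theorem coe_truncationP (F : Finset ι) (v : S.hilbertP πB) :
    (S.truncationP πB F v : S.TensorH HB) = S.truncation HB F v := rfl

theorem tendsto_truncationP (v : S.hilbertP πB) :
    Filter.Tendsto (fun F => S.truncationP πB F v) Filter.atTop (nhds v) :=
  tendsto_subtype_rng.2 (S.tendsto_truncation (v : S.TensorH HB))

theorem inner_truncationP (F : Finset ι) (v w : S.hilbertP πB) :
    inner ℂ (S.truncationP πB F v) w = inner ℂ v (S.truncationP πB F w) :=
  S.inner_truncation F (v : S.TensorH HB) w

theorem truncationP_uA (F : Finset ι) (g : G) (v : S.hilbertP πB) :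
    S.truncationP πB F (S.uA πB g v) = S.uA πB g (S.truncationP πB F v) :=
  Subtype.ext (S.truncation_oneTensorMu F g (v : S.TensorH HB))

end HilbertP

section Smooth

variable {n : ℕ} [ChartedSpace (EuclideanSpace ℝ (Fin n)) G] [LieGroup (𝓡 n) ∞ G]
  [IsTopologicalGroup G] [CompactSpace G] [T2Space G]

open scoped Classical in
/-- On a single isotypic component the orbits are linear combinations of matrix coefficients. -/
theorem single_mem_smoothVectors (σ : ι) (v : S.Block K σ) :
    (lp.single 2 σ v : S.TensorH K) ∈ smoothVectors (n := n) (S.oneTensorMu K) := by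
  let _ : MeasurableSpace G := borel G
  have : BorelSpace G := ⟨rfl⟩
  let L : S.Block K σ →L[ℂ] S.TensorH K :=
    lp.singleContinuousLinearMap ℂ (fun σ => S.Block K σ) 2 σ
  let e : (Fin (S.mult σ) × Fin (R.dim σ) → K) →L[ℂ] S.Block K σ :=
    (PiLp.continuousLinearEquiv 2 ℂ (fun _ : Fin (S.mult σ) × Fin (R.dim σ) => K)).symm
  have h1 : ContMDiff (𝓡 n) 𝓘(ℝ, Fin (S.mult σ) × Fin (R.dim σ) → K) ∞ fun g : G =>
      fun p : Fin (S.mult σ) × Fin (R.dim σ) =>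
        ∑ l, star ((R.rep σ g : Matrix (Fin (R.dim σ)) (Fin (R.dim σ)) ℂ) p.2 l) • v (p.1, l) := by
    rw [contMDiff_pi_space]
    intro p
    refine contMDiff_finsetSum fun l _ => ?_
    have h2 := contMDiff_unitary_entry (n := n) (R.rep σ) (R.continuous_rep σ) p.2 l
    let b : ℂ →L[ℝ] K :=
      ((ContinuousLinearMap.toSpanSingleton ℂ (v (p.1, l))).restrictScalars ℝ) ∘L
        (Complex.conjCLE : ℂ →L[ℝ] ℂ)
    exact b.contMDiff.comp h2
  have h3 := ((L ∘L e).restrictScalars ℝ).contMDiff.comp h1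
  change ContMDiff (𝓡 n) 𝓘(ℝ, S.TensorH K) ∞ fun g => S.oneTensorMu K g (lp.single 2 σ v)
  simp only [oneTensorMu_single]
  exact h3

theorem truncation_mem_smoothVectors (F : Finset ι) (v : S.TensorH K) :
    S.truncation K F v ∈ smoothVectors (n := n) (S.oneTensorMu K) := by
  classical
  rw [truncation_apply]
  exact sum_mem fun σ _ => S.single_mem_smoothVectors σ _

variable {HB : Type*} [NormedAddCommGroup HB] [InnerProductSpace ℂ HB]
  [CompleteSpace HB] (πB : α.fixedAlgebra →⋆ₐ[ℂ] (HB →L[ℂ] HB))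

/-- Smoothness in `K ⊗ H` implies smoothness in `H_p`, by the orthogonal projection onto `H_p`. -/
theorem truncationP_mem_smoothVectors (F : Finset ι) (v : S.hilbertP πB) :
    S.truncationP πB F v ∈ smoothVectors (n := n) (S.uA πB) := by
  have : (S.hilbertP πB).HasOrthogonalProjection :=
    Submodule.HasOrthogonalProjection.ofCompleteSpace _
  exact mem_smoothVectors_of_map (S.hilbertP πB).orthogonalProjectionOnto
    (fun g => Submodule.orthogonalProjectionOnto_mem_subspace_eq_self
      (S.uA πB g (S.truncationP πB F v)))
    (S.truncation_mem_smoothVectors (n := n) F (v : S.TensorH HB))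

end Smooth

end IsometryFamily

end Truncation

/-! ### Linearity, boundedness and covariance of `π_A` -/

section PiA

variable {G : Type*} [Group G] [TopologicalSpace G] [IsTopologicalGroup G] [CompactSpace G]
  [MeasurableSpace G] [BorelSpace G] (ν : MeasureTheory.Measure G) [ν.IsHaarMeasure]
  {A : Type*} [CStarAlgebra A] {α : CStarDynamicalSystem G A} {ι : Type*} {R : IrrepSystem G ι}
  (S : IsometryFamily α R) {HB : Type*} [NormedAddCommGroup HB] [InnerProductSpace ℂ HB]
  [CompleteSpace HB] (πB : α.fixedAlgebra →⋆ₐ[ℂ] (HB →L[ℂ] HB))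

/-- Left invariance of Haar measure makes the conditional expectation invariant. -/
theorem CStarDynamicalSystem.average_act (g : G) (x : A) :
    α.average ν (α.act g x) = α.average ν x := by
  apply Subtype.ext
  rw [coe_average, coe_average,
    ← MeasureTheory.integral_mul_left_eq_self (fun h => α.act h⁻¹ (α.act g x)) g]
  congr 1
  ext h
  have h1 : h⁻¹ = (g * h)⁻¹ * g := by group
  rw [h1, map_mul]
  rfl

namespace IsometryFamily

/-- Translating `x` by `g` conjugates the matrix of `s j_α(x) s^*` by `μ_g`. -/
theorem piEntry_act (g : G) (x : A) (ρ : ι) (i : Fin (S.mult ρ)) (j : Fin (R.dim ρ)) (τ : ι)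
    (k : Fin (S.mult τ)) (l : Fin (R.dim τ)) :
    S.piEntry ν (α.act g x) ρ i j τ k l =
      ∑ a, ∑ b, (star ((R.rep ρ g : Matrix (Fin (R.dim ρ)) (Fin (R.dim ρ)) ℂ) j a) *
        (R.rep τ g : Matrix (Fin (R.dim τ)) (Fin (R.dim τ)) ℂ) l b) •
          S.piEntry ν x ρ i a τ k b := by
  rw [S.piEntry_eq_average ν _ ρ (i, j) τ (k, l), ← α.average_act ν g⁻¹]
  have h1 : α.act g⁻¹ (α.act g x) = x := by
    change (α.act g⁻¹ * α.act g) x = x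
    rw [← map_mul, inv_mul_cancel, map_one]
    rfl
  rw [map_mul (α.act g⁻¹), map_mul (α.act g⁻¹), h1, map_star, act_inv_scaledStar,
    act_inv_scaledStar, star_sum, Finset.sum_mul, Finset.sum_mul, map_sum]
  refine Finset.sum_congr rfl fun a _ => ?_
  rw [Finset.mul_sum, map_sum]
  refine Finset.sum_congr rfl fun b _ => ?_
  rw [S.piEntry_eq_average ν _ ρ (i, a) τ (k, b), ← map_smul]
  simp only [star_smul, smul_mul_assoc, mul_smul_comm, smul_smul]
  rw [mul_comm]

variable {S πB ν}

theorem IsPiA.add {x y : A} {T T' : S.hilbertP πB →L[ℂ] S.hilbertP πB} (h : S.IsPiA ν πB x T)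
    (h' : S.IsPiA ν πB y T') : S.IsPiA ν πB (x + y) (T + T') := by
  intro τ v hv ρ i j
  rw [add_apply, Submodule.coe_add, lp.coeFn_add, Pi.add_apply, PiLp.add_apply, h, h']
  simp only [← Finset.sum_add_distrib]
  refine Finset.sum_congr rfl fun k _ => Finset.sum_congr rfl fun l _ => ?_
  simp only [S.piEntry_eq_average ν _ ρ (i, j) τ (k, l), mul_add, add_mul, map_add, add_apply]

theorem IsPiA.smul {x : A} {T : S.hilbertP πB →L[ℂ] S.hilbertP πB} (h : S.IsPiA ν πB x T)
    (c : ℂ) : S.IsPiA ν πB (c • x) (c • T) := by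
  intro τ v hv ρ i j
  rw [smul_apply, Submodule.coe_smul, lp.coeFn_smul, Pi.smul_apply, PiLp.smul_apply, h]
  simp only [Finset.smul_sum]
  refine Finset.sum_congr rfl fun k _ => Finset.sum_congr rfl fun l _ => ?_
  simp only [S.piEntry_eq_average ν _ ρ (i, j) τ (k, l), mul_smul_comm, smul_mul_assoc, map_smul,
    smul_apply]

/-- A bounded operator is determined by its matrix coefficients. -/
theorem IsPiA.unique {x : A} {T T' : S.hilbertP πB →L[ℂ] S.hilbertP πB} (h : S.IsPiA ν πB x T)
    (h' : S.IsPiA ν πB x T') : T = T' := by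
  classical
  have h1 : ∀ F v, T (S.truncationP πB F v) = T' (S.truncationP πB F v) := fun F v => by
    have h2 : S.truncationP πB F v =
        ∑ σ ∈ F, (⟨lp.single 2 σ ((v : S.TensorH HB) σ), S.single_coord_mem_hilbertP πB v σ⟩ :
          S.hilbertP πB) := by
      apply Subtype.ext
      rw [coe_truncationP, truncation_apply, AddSubmonoidClass.coe_finsetSum]
    rw [h2, map_sum, map_sum]
    refine Finset.sum_congr rfl fun σ _ => Subtype.ext (lp.ext (funext fun ρ => ?_))
    ext ⟨i, j⟩
    rw [h, h']
  ext1 v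
  have h3 := (T.continuous.tendsto v).comp (S.tendsto_truncationP πB v)
  have h4 := (T'.continuous.tendsto v).comp (S.tendsto_truncationP πB v)
  refine tendsto_nhds_unique h3 (h4.congr fun F => (h1 F v).symm)

variable [MeasureTheory.IsProbabilityMeasure ν]

variable (S πB ν)

theorem isPiA_piA (x : A) : S.IsPiA ν πB x (S.piA ν πB x) := by
  have h : ∃ T, S.IsPiA ν πB x T := (S.exists_isPiA ν πB x).imp fun T hT => hT.1
  rw [piA, dif_pos h]
  exact h.choose_spec

variable {S πB ν} in
theorem IsPiA.piA_eq {x : A} {T : S.hilbertP πB →L[ℂ] S.hilbertP πB} (h : S.IsPiA ν πB x T) :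
    S.piA ν πB x = T :=
  (S.isPiA_piA ν πB x).unique h

theorem norm_piA_le (x : A) : ‖S.piA ν πB x‖ ≤ 4 * ‖x‖ := by
  obtain ⟨T, hT, hn⟩ := S.exists_isPiA ν πB x
  rw [hT.piA_eq]
  refine ContinuousLinearMap.opNorm_le_bound _ (by positivity) fun v => (hn v).trans (le_of_eq ?_)
  ring

/-- `x ↦ π_A(x)` as a bounded linear map. -/
def piAL : A →L[ℂ] (S.hilbertP πB →L[ℂ] S.hilbertP πB) :=
  LinearMap.mkContinuous
    { toFun := S.piA ν πB
      map_add' := fun x y => ((S.isPiA_piA ν πB x).add (S.isPiA_piA ν πB y)).piA_eq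
      map_smul' := fun c x => ((S.isPiA_piA ν πB x).smul c).piA_eq } 4 (S.norm_piA_le ν πB)

/-- Covariance: `u_A(g) π_A(x) u_A(g)^* = π_A(α_g(x))`. -/
theorem piA_act_uA (g : G) (x : A) (v : S.hilbertP πB) :
    S.piA ν πB (α.act g x) (S.uA πB g v) = S.uA πB g (S.piA ν πB x v) := by
  classical
  let U : G → S.hilbertP πB →L[ℂ] S.hilbertP πB := fun g =>
    (S.uA πB g).toContinuousLinearEquiv.toContinuousLinearMap
  -- The conjugated operator has the matrix coefficients of `π_A(α_g(x))`; uniqueness applies.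
  have h1 : S.IsPiA ν πB (α.act g x) (U g ∘L S.piA ν πB x ∘L U g⁻¹) := by
    intro τ v hv ρ i j
    have hmem : (lp.single 2 τ (conjAction HB (S.mult τ) (R.rep τ g⁻¹) v) : S.TensorH HB) ∈
        S.hilbertP πB := by
      rw [← S.oneTensorMu_single]
      exact S.oneTensorMu_mem πB g⁻¹ hv
    have h2 : U g⁻¹ ⟨lp.single 2 τ v, hv⟩ =
        ⟨lp.single 2 τ (conjAction HB (S.mult τ) (R.rep τ g⁻¹) v), hmem⟩ :=
      Subtype.ext (S.oneTensorMu_single g⁻¹ τ v)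
    rw [ContinuousLinearMap.comp_apply, ContinuousLinearMap.comp_apply, h2]
    change (S.oneTensorMu HB g (S.piA ν πB x _ : S.TensorH HB)) ρ (i, j) = _
    rw [oneTensorMu_apply]
    have h3 : ∀ k l, conjAction HB (S.mult τ) (R.rep τ g⁻¹) v (k, l) =
        ∑ m, (R.rep τ g : Matrix (Fin (R.dim τ)) (Fin (R.dim τ)) ℂ) m l • v (k, m) := by
      intro k l
      change ∑ m, star ((R.rep τ g⁻¹ : Matrix (Fin (R.dim τ)) (Fin (R.dim τ)) ℂ) l m) • v (k, m) = _
      refine Finset.sum_congr rfl fun m _ => ?_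
      rw [map_inv]
      congr 1
      exact star_star _
    simp only [S.isPiA_piA ν πB x τ _ hmem, h3, piEntry_act, map_sum, map_smul, sum_apply,
      smul_apply, Finset.smul_sum, smul_smul]
    rw [Finset.sum_comm]
    refine Finset.sum_congr rfl fun k _ => ?_
    conv_rhs => rw [Finset.sum_comm]
    refine Finset.sum_congr rfl fun a _ => ?_
    rw [Finset.sum_comm]
  rw [h1.piA_eq]
  change S.uA πB g (S.piA ν πB x (S.uA πB g⁻¹ (S.uA πB g v))) = _
  have h4 : S.uA πB g⁻¹ (S.uA πB g v) = v := by
    change (S.uA πB g⁻¹ * S.uA πB g) v = v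
    rw [← map_mul, inv_mul_cancel, map_one]
    rfl
  rw [h4]

end IsometryFamily

end PiA

/-! ### Skew-adjointness of the Clifford matrices -/

section Spin

variable {V : Type*} [AddCommGroup V] [Module ℝ V]

theorem star_spinMatrix (B : LinearMap.BilinForm ℝ V) {r n : ℕ}
    (πspin : ComplexClifford B →⋆ₐ[ℂ] Matrix (Fin r) (Fin r) ℂ) (X : Fin n → V) (k : Fin n) :
    star (spinMatrix B πspin X k) = -spinMatrix B πspin X k := by
  have h1 : star (cliffordVec B (X k)) = -cliffordVec B (X k) := by
    rw [cliffordVec, TensorProduct.star_tmul, star_one, CliffordAlgebra.star_ι,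
      TensorProduct.tmul_neg]
  rw [spinMatrix, ← map_star, h1, map_neg]

end Spin

/-! ### The Dirac operator of `1 ⊗ μ` and the operator `1 ⊗ D_v` -/

section TensorOperator

variable {G : Type*} [Group G] [TopologicalSpace G]
  {A : Type*} [CStarAlgebra A] {α : CStarDynamicalSystem G A} {ι : Type*} {R : IrrepSystem G ι}
  (S : IsometryFamily α R) {K : Type*} [NormedAddCommGroup K] [InnerProductSpace ℂ K]

namespace IsometryFamily

theorem norm_tmulH (ξ : K) (h : S.TensorH ℂ) : ‖S.tmulH ξ h‖ = ‖ξ‖ * ‖h‖ := by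
  have h1 : ∀ σ, ‖S.tmulH ξ h σ‖ = ‖ξ‖ * ‖h σ‖ := fun σ => by
    change ‖(WithLp.toLp 2 fun p => h σ p • ξ : S.Block K σ)‖ = _
    rw [PiLp.norm_eq_of_L2, PiLp.norm_eq_of_L2]
    simp only [norm_smul, mul_pow]
    rw [← Finset.sum_mul, Real.sqrt_mul (Finset.sum_nonneg fun _ _ => sq_nonneg _),
      Real.sqrt_sq (norm_nonneg _), mul_comm]
  have h2 := lp.norm_rpow_eq_tsum (p := 2) (by norm_num) (S.tmulH ξ h)
  have h3 := lp.norm_rpow_eq_tsum (p := 2) (by norm_num) h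
  simp only [ENNReal.toReal_ofNat, Real.rpow_ofNat, h1, mul_pow] at h2 h3
  rw [tsum_mul_left, ← h3, ← mul_pow] at h2
  exact (pow_left_inj₀ (norm_nonneg _) (by positivity) two_ne_zero).1 h2

/-- `h ↦ ξ ⊗ h` as a bounded operator `H → K ⊗ H`. -/
def tmulHL (ξ : K) : S.TensorH ℂ →L[ℂ] S.TensorH K :=
  LinearMap.mkContinuous
    { toFun := S.tmulH ξ
      map_add' := fun _ _ => lp.ext (funext fun _ => PiLp.ext fun _ => add_smul _ _ _)
      map_smul' := fun _ _ => lp.ext (funext fun _ => PiLp.ext fun _ => mul_smul _ _ _) }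
    ‖ξ‖ fun h => (S.norm_tmulH ξ h).le

theorem tmulH_oneTensorMu (ξ : K) (g : G) (h : S.TensorH ℂ) :
    S.tmulHL ξ (S.oneTensorMu ℂ g h) = S.oneTensorMu K g (S.tmulHL ξ h) := by
  refine lp.ext (funext fun σ => ?_)
  ext ⟨i, j⟩
  rw [oneTensorMu_apply]
  change (S.oneTensorMu ℂ g h) σ (i, j) • ξ = ∑ l, _ • (h σ (i, l) • ξ)
  rw [oneTensorMu_apply, Finset.sum_smul]
  refine Finset.sum_congr rfl fun l _ => ?_
  rw [smul_eq_mul, mul_smul]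

theorem continuous_tmulHSpin {r : ℕ} (ξ : K) :
    Continuous fun z : TensorSpin (S.TensorH ℂ) r => S.tmulHSpin ξ z := by
  refine (PiLp.continuous_toLp 2 _).comp (continuous_pi fun a => ?_)
  exact (S.tmulHL ξ).continuous.comp (PiLp.continuous_apply 2 _ a)

variable {r : ℕ}

/-- The vector `e_a` of `ℂ^r` tensored with `e_i ⊗ \bar e_j ∈ H_σ ⊗ \bar V_σ`. -/
def basisSpin (a : Fin r) (σ : ι) (p : Fin (S.mult σ) × Fin (R.dim σ)) :
    TensorSpin (S.TensorH ℂ) r := by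
  classical
  exact WithLp.toLp 2 (Pi.single a (lp.single 2 σ (WithLp.toLp 2 (Pi.single p 1))))

/-- A truncated vector is a finite sum of elementary tensors. -/
theorem truncation_eq_sum_tmulHSpin (s : Finset ι) (η : TensorSpin (S.TensorH K) r) :
    boundedTensor (S.truncation K s) 1 η =
      ∑ a, ∑ σ ∈ s, ∑ p, S.tmulHSpin (η a σ p) (S.basisSpin a σ p) := by
  classical
  have h1 : ∀ f : Fin r → TensorSpin (S.TensorH K) r, ∀ b, (∑ a, f a) b = ∑ a, f a b :=
    fun f b => map_sum (PiLp.proj (𝕜 := ℂ) 2 (fun _ : Fin r => S.TensorH K) b) f Finset.univ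
  have h2 : ∀ (f : ι → TensorSpin (S.TensorH K) r) b, (∑ σ ∈ s, f σ) b = ∑ σ ∈ s, f σ b :=
    fun f b => map_sum (PiLp.proj (𝕜 := ℂ) 2 (fun _ : Fin r => S.TensorH K) b) f s
  have h3 : ∀ σ (f : Fin (S.mult σ) × Fin (R.dim σ) → TensorSpin (S.TensorH K) r) b,
      (∑ p, f p) b = ∑ p, f p b :=
    fun σ f b => map_sum (PiLp.proj (𝕜 := ℂ) 2 (fun _ : Fin r => S.TensorH K) b) f Finset.univ
  have hb : ∀ (a b : Fin r) σ p, S.tmulHSpin (η a σ p) (S.basisSpin a σ p) b =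
      if a = b then S.tmulH (η b σ p) (lp.single 2 σ (WithLp.toLp 2 (Pi.single p 1))) else 0 := by
    intro a b σ p
    change S.tmulHL (η a σ p) ((Pi.single a (lp.single 2 σ (WithLp.toLp 2 (Pi.single p 1)) :
      S.TensorH ℂ) : Fin r → S.TensorH ℂ) b) = _
    split_ifs with h
    · subst h
      rw [Pi.single_eq_same]
      rfl
    · rw [Pi.single_eq_of_ne (Ne.symm h), map_zero]
  ext1 b
  rw [boundedTensor_one_apply, h1, Finset.sum_eq_single b]
  · rw [h2, truncation_apply]
    refine Finset.sum_congr rfl fun σ _ => ?_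
    rw [h3]
    simp only [hb, if_true]
    refine lp.ext (funext fun τ => ?_)
    rw [lp.coeFn_sum, Finset.sum_apply]
    have h4 : ∀ p : Fin (S.mult σ) × Fin (R.dim σ),
        S.tmulH (η b σ p) (lp.single 2 σ (WithLp.toLp 2 (Pi.single p 1))) =
          (lp.single 2 σ (WithLp.toLp 2 (Pi.single p (η b σ p))) : S.TensorH K) := by
      intro p
      refine lp.ext (funext fun τ => ?_)
      ext1 q
      change ((lp.single 2 σ (WithLp.toLp 2 (Pi.single p 1)) : S.TensorH ℂ) τ) q • η b σ p = _
      by_cases hτ : τ = σ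
      · subst hτ
        rw [lp.single_apply_self, lp.single_apply_self]
        change (Pi.single p 1 : _ → ℂ) q • η b τ p = (Pi.single p (η b τ p) : _ → K) q
        by_cases hq : q = p
        · subst hq
          rw [Pi.single_eq_same, Pi.single_eq_same, one_smul]
        · rw [Pi.single_eq_of_ne hq, Pi.single_eq_of_ne hq, zero_smul]
      · rw [lp.single_apply_ne _ _ _ hτ, lp.single_apply_ne _ _ _ hτ]
        simp
    simp only [h4]
    by_cases hτ : τ = σ
    · subst hτ
      simp only [lp.single_apply_self]
      ext1 q
      rw [WithLp.ofLp_sum, Finset.sum_apply]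
      simp [Pi.single_apply]
    · simp only [lp.single_apply_ne _ _ _ hτ, Finset.sum_const_zero]
  · intro a _ ha
    rw [h2]
    refine Finset.sum_eq_zero fun σ _ => ?_
    rw [h3]
    refine Finset.sum_eq_zero fun p _ => ?_
    rw [hb, if_neg ha]
  · intro h; exact absurd (Finset.mem_univ _) h

section Dirac

variable {n : ℕ} [ChartedSpace (EuclideanSpace ℝ (Fin n)) G] [LieGroup (𝓡 n) ∞ G] [T2Space G]
  (X : Fin n → GroupLieAlgebra (𝓡 n) G) (F : Fin n → Matrix (Fin r) (Fin r) ℂ)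

/-- `ξ ⊗ ·` intertwines `μ` with `1 ⊗ μ`, so it maps the graph of one Dirac operator into the graph
of the other. -/
theorem tmulHSpin_mem_graph (ξ : K) {z w : TensorSpin (S.TensorH ℂ) r}
    (h : (z, w) ∈ (diracCore (S.oneTensorMu ℂ) X F).graph) :
    (S.tmulHSpin ξ z, S.tmulHSpin ξ w) ∈ (diracCore (S.oneTensorMu K) X F).graph := by
  rw [LinearPMap.mem_graph_iff] at h ⊢
  obtain ⟨η, h1, h2⟩ := h
  dsimp only at h1 h2
  subst h1 h2
  have hm : S.tmulHSpin ξ (η : TensorSpin (S.TensorH ℂ) r) ∈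
      (diracCore (S.oneTensorMu K) X F).domain := fun a =>
    mem_smoothVectors_of_intertwining (S.tmulHL ξ) (S.tmulH_oneTensorMu ξ) (η.2 a)
  refine ⟨⟨_, hm⟩, rfl, ?_⟩
  ext1 a
  rw [diracCore_apply]
  change _ = S.tmulHL ξ ((diracCore (S.oneTensorMu ℂ) X F η) a)
  rw [diracCore_apply, map_sum]
  refine Finset.sum_congr rfl fun k _ => ?_
  rw [map_sum]
  refine Finset.sum_congr rfl fun b _ => ?_
  rw [map_smul, ← partialRep_of_intertwining (S.tmulHL ξ) (S.tmulH_oneTensorMu ξ)]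
  rfl

section Inclusion

variable {HB : Type*} [NormedAddCommGroup HB] [InnerProductSpace ℂ HB]
  [CompleteSpace HB] (πB : α.fixedAlgebra →⋆ₐ[ℂ] (HB →L[ℂ] HB))

theorem inclSpin_mem_domain (η : (diracCore (S.uA πB) X F).domain) :
    S.inclSpin πB (η : TensorSpin (S.hilbertP πB) r) ∈
      (diracCore (S.oneTensorMu HB) X F).domain := fun a =>
  mem_smoothVectors_of_intertwining (S.hilbertP πB).subtypeL (fun _ _ => rfl) (η.2 a)

/-- The inclusion of `H_p` intertwines `u_A` with `1 ⊗ μ`, hence also the Dirac operators. -/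
theorem diracCore_inclSpin (η : (diracCore (S.uA πB) X F).domain) :
    diracCore (S.oneTensorMu HB) X F ⟨_, S.inclSpin_mem_domain X F πB η⟩ =
      S.inclSpin πB (diracCore (S.uA πB) X F η) := by
  ext1 a
  rw [diracCore_apply]
  change _ = (S.hilbertP πB).subtypeL ((diracCore (S.uA πB) X F η) a)
  rw [diracCore_apply, map_sum]
  refine Finset.sum_congr rfl fun k _ => ?_
  rw [map_sum]
  refine Finset.sum_congr rfl fun b _ => ?_
  rw [map_smul, ← partialRep_of_intertwining (u' := S.oneTensorMu HB) (S.hilbertP πB).subtypeL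
    (fun _ _ => rfl)]
  rfl

end Inclusion

variable [IsTopologicalGroup G] [CompactSpace G] {F}

theorem isClosable_diracCore_oneTensorMu [CompleteSpace K] (hF : ∀ k, star (F k) = -F k) :
    (diracCore (S.oneTensorMu K) X F).IsClosable :=
  (isSelfAdjoint_diracCore_closure (u := S.oneTensorMu K) (Q := S.truncation K)
    (l := Filter.atTop) X hF S.truncation_oneTensorMu S.inner_truncation
    S.truncation_mem_smoothVectors S.tendsto_truncation).1

variable (F)

theorem basisSpin_mem_domain (a : Fin r) (σ : ι) (p : Fin (S.mult σ) × Fin (R.dim σ)) :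
    S.basisSpin a σ p ∈ (diracCore (S.oneTensorMu ℂ) X F).domain := fun b => by
  classical
  change (Pi.single a (lp.single 2 σ (WithLp.toLp 2 (Pi.single p 1)) : S.TensorH ℂ) :
    Fin r → S.TensorH ℂ) b ∈ smoothVectors (n := n) (S.oneTensorMu ℂ)
  by_cases hb : b = a
  · subst hb
    rw [Pi.single_eq_same]
    exact S.single_mem_smoothVectors σ _
  · rw [Pi.single_eq_of_ne hb]
    exact zero_mem _

variable {F} in
/-- On the smooth vectors, `1 ⊗ D_v` is the Dirac operator of the representation `1 ⊗ μ`: the span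
`Γ` of the elementary tensors lies in the closure of the graph of the latter, and truncations of
smooth vectors lie in `Γ` and converge in the graph norm. -/
theorem takesValue_oneTensorOp [CompleteSpace K] (hF : ∀ k, star (F k) = -F k) :
    ∀ η : (diracCore (S.oneTensorMu K) X F).domain,
    TakesValue (S.oneTensorOp K (S.verticalDirac X F)) (η : TensorSpin (S.TensorH K) r)
      (diracCore (S.oneTensorMu K) X F η) := by
  set D₀ := diracCore (S.oneTensorMu ℂ) X F with hD₀
  set D := diracCore (S.oneTensorMu K) X F with hD
  have hcl₀ : D₀.IsClosable := S.isClosable_diracCore_oneTensorMu X hF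
  have hcl : D.IsClosable := S.isClosable_diracCore_oneTensorMu X hF
  set Γ := Submodule.span ℂ (Set.range fun q : K × (S.verticalDirac X F).domain =>
    (S.tmulHSpin q.1 (q.2 : TensorSpin (S.TensorH ℂ) r),
      S.tmulHSpin q.1 (S.verticalDirac X F q.2))) with hΓ
  have hpair : ∀ (ξ : K) (z : D₀.domain),
      (S.tmulHSpin ξ (z : TensorSpin (S.TensorH ℂ) r), S.tmulHSpin ξ (D₀ z)) ∈ Γ := by
    intro ξ z
    have hle := LinearPMap.le_closure D₀
    refine Submodule.subset_span ⟨(ξ, ⟨z, hle.1 z.2⟩), ?_⟩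
    have h1 : S.verticalDirac X F ⟨z, hle.1 z.2⟩ = D₀ z :=
      (hle.2 (x := z) (y := ⟨z, hle.1 z.2⟩) rfl).symm
    simp only [h1]
  have hΓle : Γ ≤ D.closure.graph := by
    rw [hΓ, Submodule.span_le]
    rintro _ ⟨⟨ξ, z⟩, rfl⟩
    have h1 : ((z : TensorSpin (S.TensorH ℂ) r), S.verticalDirac X F z) ∈
        D₀.graph.topologicalClosure := by
      rw [hcl₀.graph_closure_eq_closure_graph]
      exact LinearPMap.mem_graph _ z
    rw [← hcl.graph_closure_eq_closure_graph]
    refine map_mem_closure (f := fun p : TensorSpin (S.TensorH ℂ) r × TensorSpin (S.TensorH ℂ) r =>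
      (S.tmulHSpin ξ p.1, S.tmulHSpin ξ p.2)) ?_ h1
      fun p hp => S.tmulHSpin_mem_graph X F ξ hp
    exact ((S.continuous_tmulHSpin ξ).comp continuous_fst).prodMk
      ((S.continuous_tmulHSpin ξ).comp continuous_snd)
  -- `oneTensorOp` is the closure of `Γ` only if that closure is a graph, which holds because it is
  -- contained in the graph of a closed operator.
  have hsingle : ∀ p ∈ Γ.topologicalClosure, p.1 = 0 → p.2 = 0 := by
    intro p hp hp1
    have h1 : p ∈ D.closure.graph := by
      have h2 := Submodule.topologicalClosure_minimal Γ hΓle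
        (LinearPMap.IsClosable.closure_isClosed hcl)
      exact h2 hp
    exact D.closure.graph_fst_eq_zero_snd h1 hp1
  intro η
  have htrunc : ∀ s, (boundedTensor (S.truncation K s) 1 (η : TensorSpin (S.TensorH K) r),
      boundedTensor (S.truncation K s) 1 (D η)) ∈ Γ := by
    intro s
    have hsum : ∃ w, (boundedTensor (S.truncation K s) 1 (η : TensorSpin (S.TensorH K) r), w) ∈
        Γ ⊓ D.graph := by
      refine ⟨∑ a, ∑ σ ∈ s, ∑ p, S.tmulHSpin ((η : TensorSpin (S.TensorH K) r) a σ p)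
        (D₀ ⟨_, S.basisSpin_mem_domain X F a σ p⟩), ?_⟩
      rw [truncation_eq_sum_tmulHSpin]
      have h1 : ∀ a σ p, (S.tmulHSpin ((η : TensorSpin (S.TensorH K) r) a σ p)
          (S.basisSpin a σ p), S.tmulHSpin ((η : TensorSpin (S.TensorH K) r) a σ p)
            (D₀ ⟨_, S.basisSpin_mem_domain X F a σ p⟩)) ∈ Γ ⊓ D.graph := fun a σ p =>
        ⟨hpair _ ⟨_, S.basisSpin_mem_domain X F a σ p⟩,
          S.tmulHSpin_mem_graph X F _ (D₀.mem_graph ⟨_, S.basisSpin_mem_domain X F a σ p⟩)⟩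
      have h2 := Submodule.sum_mem (Γ ⊓ D.graph) (t := Finset.univ) fun a _ =>
        Submodule.sum_mem _ (t := s) fun σ _ =>
          Submodule.sum_mem _ (t := Finset.univ) fun p _ => h1 a σ p
      convert h2 using 1
      ext1 <;> simp only [Prod.fst_sum, Prod.snd_sum]
    obtain ⟨w, hw1, hw2⟩ := hsum
    have h3 := diracCore_commute X F (S.truncation K s) (S.truncation_oneTensorMu s) η
    have h4 := D.mem_graph ⟨_, mem_diracCore_domain_of_commute (S.truncation K s)
      (S.truncation_oneTensorMu s) η⟩
    have h5 : w = boundedTensor (S.truncation K s) 1 (D η) := by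
      rw [← h3]
      exact LinearPMap.mem_graph_snd_inj D hw2 h4 rfl
    exact h5 ▸ hw1
  have hmem : ((η : TensorSpin (S.TensorH K) r), D η) ∈ Γ.topologicalClosure := by
    refine mem_closure_of_tendsto (b := Filter.atTop)
      (f := fun s => (boundedTensor (S.truncation K s) 1 (η : TensorSpin (S.TensorH K) r),
        boundedTensor (S.truncation K s) 1 (D η))) ?_ (Filter.Eventually.of_forall htrunc)
    refine Filter.Tendsto.prodMk_nhds (tendsto_tensorSpin fun a => ?_)
      (tendsto_tensorSpin fun a => ?_) <;>
    · simp only [boundedTensor_one_apply]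
      exact S.tendsto_truncation _
  have hgr := Submodule.toLinearPMap_graph_eq Γ.topologicalClosure hsingle
  rw [← hgr, LinearPMap.mem_graph_iff] at hmem
  obtain ⟨y, hy1, hy2⟩ := hmem
  dsimp only at hy1 hy2
  have hd : (η : TensorSpin (S.TensorH K) r) ∈ (S.oneTensorOp K (S.verticalDirac X F)).domain :=
    hy1 ▸ y.2
  refine ⟨hd, ?_⟩
  have hy : y = ⟨η, hd⟩ := Subtype.ext hy1
  rw [← hy2, hy]
  rfl

end Dirac

end IsometryFamily

end TensorOperator

/-! ### Derivatives along bounded linear maps -/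

section SmoothElements

variable {n : ℕ} {G : Type*} [TopologicalSpace G] [ChartedSpace (EuclideanSpace ℝ (Fin n)) G]
  {A : Type*} [CStarAlgebra A]

theorem contMDiff_clm_comp {E : Type*} [NormedAddCommGroup E] [NormedSpace ℂ E]
    (L : A →L[ℂ] E) {f : G → A} (h : ContMDiff (𝓡 n) 𝓘(ℝ, A) ∞ f) :
    ContMDiff (𝓡 n) 𝓘(ℝ, E) ∞ fun g => L (f g) :=
  (L.restrictScalars ℝ).contMDiff.comp h

variable [Group G] [LieGroup (𝓡 n) ∞ G] [T2Space G] (α : CStarDynamicalSystem G A)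

theorem HasLieDeriv.clm_comp {E : Type*} [NormedAddCommGroup E] [NormedSpace ℂ E]
    (L : A →L[ℂ] E) {f : G → A} {X : GroupLieAlgebra (𝓡 n) G} {y : A} (h : HasLieDeriv f X y) :
    HasLieDeriv (fun g => L (f g)) X (L y) :=
  (L.restrictScalars ℝ).hasFDerivAt.comp_hasDerivAt (0 : ℝ) h

theorem CStarDynamicalSystem.exists_hasLieDeriv {x : A} (hx : x ∈ α.smoothElements (n := n))
    (X : GroupLieAlgebra (𝓡 n) G) : ∃ y, HasLieDeriv (fun g => α.act g x) X y := by
  refine ⟨_, DifferentiableAt.hasDerivAt ?_⟩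
  rw [← mdifferentiableAt_iff_differentiableAt]
  have h : MDifferentiableAt (𝓡 n) 𝓘(ℝ, A) (fun g => α.act g x) (lieExp ((0 : ℝ) • X)) :=
    ContMDiff.mdifferentiableAt hx (by simp)
  exact h.comp (0 : ℝ) (mdifferentiableAt_lieExp_smul X)

end SmoothElements

end

theorem corollary5p6 {n r : ℕ} {G : Type*} [TopologicalSpace G]
    [ChartedSpace (EuclideanSpace ℝ (Fin n)) G] [Group G] [LieGroup (𝓡 n) ∞ G]
    [IsTopologicalGroup G] [CompactSpace G] [T2Space G] [MeasurableSpace G] [BorelSpace G]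
    (ν : MeasureTheory.Measure G) [ν.IsHaarMeasure] [MeasureTheory.IsProbabilityMeasure ν]
    {A : Type*} [CStarAlgebra A] (α : CStarDynamicalSystem G A) (_hfree : α.IsFree)
    {ι : Type*} (R : IrrepSystem G ι) (S : IsometryFamily α R)
    {HB : Type*} [NormedAddCommGroup HB] [InnerProductSpace ℂ HB] [CompleteSpace HB]
    (πB : α.fixedAlgebra →⋆ₐ[ℂ] (HB →L[ℂ] HB)) (_hπB : Function.Injective πB)
    (B : LinearMap.BilinForm ℝ (GroupLieAlgebra (𝓡 n) G))
    (_hsymm : ∀ X Y, B X Y = B Y X) (_hpos : ∀ X, X ≠ 0 → 0 < B X X)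
    (_hAd : ∀ (g : G) (X Y : GroupLieAlgebra (𝓡 n) G),
      B (adjointAction g X) (adjointAction g Y) = B X Y)
    (πspin : ComplexClifford B →⋆ₐ[ℂ] Matrix (Fin r) (Fin r) ℂ)
    (X : Module.Basis (Fin n) ℝ (GroupLieAlgebra (𝓡 n) G))
    (_hX : ∀ k l, B (X k) (X l) = if k = l then 1 else 0) :
    (∀ x : A, S.IsPiA ν πB x (S.piA ν πB x)) ∧
    (IsSelfAdjoint (S.hatVerticalDirac πB X (spinMatrix B πspin X)) ∧
      ∀ η ∈ subTensorSpin (smoothVectors (n := n) (S.uA πB)) r,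
        ∃ ζ : TensorSpin (S.hilbertP πB) r,
          TakesValue (S.hatVerticalDirac πB X (spinMatrix B πspin X)) η ζ ∧
          TakesValue (S.oneTensorOp HB (S.verticalDirac X (spinMatrix B πspin X)))
            (S.inclSpin πB η) (S.inclSpin πB ζ)) ∧
    ∀ x ∈ α.smoothElements (n := n),
      ∃ T : Fin n → (S.hilbertP πB →L[ℂ] S.hilbertP πB),
        (∀ k, HasLieDeriv (fun g => S.piA ν πB (α.act g x)) (X k) (T k)) ∧
        HasBoundedCommutator (S.hatVerticalDirac πB X (spinMatrix B πspin X))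
          (boundedTensor (S.piA ν πB x) 1)
          (∑ k, boundedTensor (T k) (spinMatrix B πspin X k)) := by
  have hF := star_spinMatrix B πspin X
  obtain ⟨hcl, hsa⟩ := isSelfAdjoint_diracCore_closure (u := S.uA πB) (Q := S.truncationP πB)
    (l := Filter.atTop) X hF (S.truncationP_uA πB) (S.inner_truncationP πB)
    (S.truncationP_mem_smoothVectors πB) (S.tendsto_truncationP πB)
  refine ⟨S.isPiA_piA ν πB, ⟨hsa, fun η hη => ?_⟩, fun x hx => ?_⟩
  · have hle := LinearPMap.le_closure (diracCore (S.uA πB) X (spinMatrix B πspin X))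
    refine ⟨diracCore (S.uA πB) X (spinMatrix B πspin X) ⟨η, hη⟩, ⟨hle.1 hη, ?_⟩, ?_⟩
    · exact (hle.2 (x := ⟨η, hη⟩) (y := ⟨η, hle.1 hη⟩) rfl).symm
    · rw [← S.diracCore_inclSpin X _ πB ⟨η, hη⟩]
      exact S.takesValue_oneTensorOp X hF ⟨_, S.inclSpin_mem_domain X _ πB ⟨η, hη⟩⟩
  · choose y hy using α.exists_hasLieDeriv hx
    have hP := contMDiff_clm_comp (S.piAL ν πB) hx
    have hT : ∀ k, HasLieDeriv (fun g => S.piA ν πB (α.act g x)) (X k) (S.piAL ν πB (y (X k))) :=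
      fun k => (hy (X k)).clm_comp (S.piAL ν πB)
    refine ⟨fun k => S.piAL ν πB (y (X k)), hT, ?_⟩
    have h1 : α.act 1 x = x := by rw [map_one]; rfl
    have h2 := hasBoundedCommutator_diracCore_closure hcl hP (fun g v => by
      rw [h1]
      exact S.piA_act_uA ν πB g x v) hT
    rw [h1] at h2
    exact h2
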